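/- Let $q:\mathbb{R}\to\mathbb{C}$ be $1$-periodic and Lebesgue integrable on $[0,1]$, and let $H$ be the Hill operator generated in $L_2(\mathbb{R})$ by $-y''+qy$. For $t\in\mathbb{R}$ let $H_t$ be the operator generated in $L_2[0,1]$ by $-y''+qy$ and the boundary conditions $y(1)=e^{it}y(0)$, $y'(1)=e^{it}y'(0)$; the spectrum of $H$ is the union of the spectra of the $H_t$, $t\in[0,2\pi)$, and the spectrum of $H_t$ consists of eigenvalues, which are the roots of $F(\lambda)=2\cos t$. Here $F(\lambda)=\varphi'(1,\lambda)+\theta(1,\lambda)$ is the Hill discriminant, $\theta,\varphi$ being the solutions of $-y''+qy=\lambda y$ with $\theta(0)=\varphi'(0)=1$, $\theta'(0)=\varphi(0)=0$. The multiplicity of an eigenvalue of $H_t$ is its multiplicity as a root of $F(\lambda)=2\cos t$ (simple: multiplicity $1$; multiple: multiplicity at least $2$); its geometric multiplicity is the dimension of the space of eigenfunctions. A point $\lambda_0\in\sigma(H)$ is a *spectral singularity* of $H$ if for every $\varepsilon>0$ the spectral projections of the operators $H_t$, $t\in[0,2\pi)$, corresponding to simple eigenvalues lying in $\{|z-\lambda_0|<\varepsilon\}$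 are not uniformly bounded. It is an *essential spectral singularity* (ESS) of $H$ if there are $t_0\in(-\pi,\pi]$ with $\lambda_0\in\sigma(H_{t_0})$, a number $\delta>0$ and a continuous branch $\mu(t)$ of simple eigenvalues of $H_t$, defined for $0<|t-t_0|<\delta$, such that $\mu(t)\to\lambda_0$ as $t\to t_0$ and $$\int_{0<|t-t_0|<\delta'}\frac{dt}{|\alpha(t)|}=\infty\quad\text{for every }\delta'\in(0,\delta],$$ where $\alpha(t)=(\Psi_t^*,\Psi_t)$ and $\Psi_t$, $\Psi_t^*$ are normalized eigenfunctions of $H_t$ and of its adjoint $H_t^*$ for the eigenvalues $\mu(t)$ and $\overline{\mu(t)}$. **Theorem.** Let $t_0=0$ or $t_0=\pi$. The eigenvalues of $H_{t_0}$, counted with multiplicity, can be numbered by the integers, and for every such numbering $\{\lambda_k(t_0)\}_{k\in\mathbb{Z}}$ there is a number $N$ such that for all $|k|>N$ for which $\lambda_k(t_0)$ is a multiple eigenvalue of $H_{t_0}$ the following holds: $\lambda_k(t_0)$ is a spectral singularity of $H$ if and only if its geometric multiplicity is $1$, and $\lambda_k(t_0)$ is an ESS of $H$ if and only if its geometric multiplicity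 is $1$. -/

import Mathlib

open MeasureTheory Set Filter Topology

namespace Hill

/-- The Hilbert space `L₂[0,1]` of complex-valued functions. -/
abbrev L2 : Type := Lp ℂ 2 (volume.restrict (Icc (0 : ℝ) 1))

/-- `y` solves `-y'' + q y = f` on `[0,1]` in the Carathéodory sense, with `dy = y'`:
`y` and `y'` are absolutely continuous on `[0,1]` and the equation holds almost everywhere
(written in the equivalent integrated form). -/
structure Solves (q f y dy : ℝ → ℂ) : Prop where
  cont : ContinuousOn y (Icc 0 1)
  cont_deriv : ContinuousOn dy (Icc 0 1)
  integrable : IntegrableOn (fun s => q s * y s - f s) (Icc 0 1)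
  eq_integral : ∀ x ∈ Icc (0 : ℝ) 1, y x = y 0 + ∫ s in (0 : ℝ)..x, dy s
  deriv_eq_integral : ∀ x ∈ Icc (0 : ℝ) 1,
    dy x = dy 0 + ∫ s in (0 : ℝ)..x, (q s * y s - f s)

/-- `(u, f)` belongs to the graph of the operator `H_t` generated in `L₂[0,1]` by
`-y'' + q y` and the boundary conditions `y(1) = e^{it} y(0)`, `y'(1) = e^{it} y'(0)`. -/
def InGraph (q : ℝ → ℂ) (t : ℝ) (u f : L2) : Prop :=
  ∃ y dy : ℝ → ℂ, (u : ℝ → ℂ) =ᵐ[volume.restrict (Icc (0 : ℝ) 1)] y ∧ Solves q f y dy ∧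
    y 1 = Complex.exp (Complex.I * t) * y 0 ∧ dy 1 = Complex.exp (Complex.I * t) * dy 0

lemma intervalIntegrable_of_Icc {g : ℝ → ℂ} (hg : IntegrableOn g (Icc 0 1)) {x : ℝ}
    (hx : x ∈ Icc (0 : ℝ) 1) : IntervalIntegrable g volume 0 x := by
  rw [intervalIntegrable_iff_integrableOn_Icc_of_le hx.1]
  exact hg.mono_set (Icc_subset_Icc le_rfl hx.2)

lemma Solves.congr_right {q f g y dy : ℝ → ℂ} (h : Solves q f y dy)
    (hfg : f =ᵐ[volume.restrict (Icc (0 : ℝ) 1)] g) : Solves q g y dy := by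
  have hae : (fun s => q s * y s - f s) =ᵐ[volume.restrict (Icc (0 : ℝ) 1)]
      fun s => q s * y s - g s := by
    filter_upwards [hfg] with s hs
    rw [hs]
  refine ⟨h.cont, h.cont_deriv, h.integrable.congr hae, h.eq_integral, fun x hx => ?_⟩
  rw [h.deriv_eq_integral x hx]
  congr 1
  refine intervalIntegral.integral_congr_ae_restrict ?_
  refine ae_restrict_of_ae_restrict_of_subset ?_ hae
  rw [uIoc_of_le hx.1]
  exact (Ioc_subset_Icc_self).trans (Icc_subset_Icc le_rfl hx.2)

lemma Solves.add {q f g y dy z dz : ℝ → ℂ} (h : Solves q f y dy) (h' : Solves q g z dz) :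
    Solves q (f + g) (y + z) (dy + dz) := by
  have e : (fun s => q s * (y + z) s - (f + g) s) =
      fun s => (q s * y s - f s) + (q s * z s - g s) := by
    funext s; simp only [Pi.add_apply]; ring
  refine ⟨h.cont.add h'.cont, h.cont_deriv.add h'.cont_deriv, ?_, fun x hx => ?_, fun x hx => ?_⟩
  · rw [e]; exact h.integrable.add h'.integrable
  · simp only [Pi.add_apply]
    rw [intervalIntegral.integral_add
      (intervalIntegrable_of_Icc (h.cont_deriv.integrableOn_compact isCompact_Icc) hx)
      (intervalIntegrable_of_Icc (h'.cont_deriv.integrableOn_compact isCompact_Icc) hx),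
      h.eq_integral x hx, h'.eq_integral x hx]
    ring
  · rw [e, intervalIntegral.integral_add (intervalIntegrable_of_Icc h.integrable hx)
      (intervalIntegrable_of_Icc h'.integrable hx)]
    simp only [Pi.add_apply]
    rw [h.deriv_eq_integral x hx, h'.deriv_eq_integral x hx]
    ring

lemma Solves.smul {q f y dy : ℝ → ℂ} (c : ℂ) (h : Solves q f y dy) :
    Solves q (c • f) (c • y) (c • dy) := by
  have e : (fun s => q s * (c • y) s - (c • f) s) = fun s => c * (q s * y s - f s) := by
    funext s; simp only [Pi.smul_apply, smul_eq_mul]; ring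
  refine ⟨h.cont.const_smul c, h.cont_deriv.const_smul c, ?_, fun x hx => ?_, fun x hx => ?_⟩
  · rw [e]; exact h.integrable.const_mul c
  · simp only [Pi.smul_apply, smul_eq_mul]
    rw [intervalIntegral.integral_const_mul, h.eq_integral x hx]
    ring
  · rw [e, intervalIntegral.integral_const_mul]
    simp only [Pi.smul_apply, smul_eq_mul]
    rw [h.deriv_eq_integral x hx]
    ring

/-- The graph of the operator `H_t`, as a subspace of `L₂[0,1] × L₂[0,1]`. -/
def graph (q : ℝ → ℂ) (t : ℝ) : Submodule ℂ (L2 × L2) where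
  carrier := {p | InGraph q t p.1 p.2}
  zero_mem' := by
    have h : Solves q 0 0 0 :=
      ⟨continuousOn_const, continuousOn_const, by simp, by simp, by simp⟩
    exact ⟨0, 0, Lp.coeFn_zero _ _ _, h.congr_right (Lp.coeFn_zero ℂ 2 _).symm, by simp, by simp⟩
  add_mem' := by
    rintro ⟨u, f⟩ ⟨v, g⟩ ⟨y, dy, hu, hy, b1, b2⟩ ⟨z, dz, hv, hz, c1, c2⟩
    refine ⟨y + z, dy + dz, (Lp.coeFn_add u v).trans (hu.add hv),
      (hy.add hz).congr_right (Lp.coeFn_add f g).symm, ?_, ?_⟩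
    · simp only [Pi.add_apply]; rw [b1, c1]; ring
    · simp only [Pi.add_apply]; rw [b2, c2]; ring
  smul_mem' := by
    rintro c ⟨u, f⟩ ⟨y, dy, hu, hy, b1, b2⟩
    refine ⟨c • y, c • dy, (Lp.coeFn_smul c u).trans (hu.const_smul c),
      (hy.smul c).congr_right (Lp.coeFn_smul c f).symm, ?_, ?_⟩
    · simp only [Pi.smul_apply, smul_eq_mul]; rw [b1]; ring
    · simp only [Pi.smul_apply, smul_eq_mul]; rw [b2]; ring

/-- The kernel of `T - μ` for an operator `T` in `L₂[0,1]` with graph `G`. -/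
noncomputable def eigenspace (G : Submodule ℂ (L2 × L2)) (μ : ℂ) : Submodule ℂ L2 :=
  G.comap (LinearMap.prod LinearMap.id (μ • LinearMap.id))

/-- The range of `T - μ` for an operator `T` in `L₂[0,1]` with graph `G`. -/
noncomputable def rangeSub (G : Submodule ℂ (L2 × L2)) (μ : ℂ) : Submodule ℂ L2 :=
  G.map (LinearMap.snd ℂ L2 L2 - μ • LinearMap.fst ℂ L2 L2)

/-- `μ` is an eigenvalue of `H_t`. As `H_t` has compact resolvent, the spectrum `σ(H_t)` is the
set of its eigenvalues. -/
def IsEigenvalue (q : ℝ → ℂ) (t : ℝ) (μ : ℂ) : Prop :=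
  eigenspace (graph q t) μ ≠ ⊥

/-- The geometric multiplicity of `μ` as an eigenvalue of `H_t`. -/
noncomputable def geomMult (q : ℝ → ℂ) (t : ℝ) (μ : ℂ) : ℕ :=
  Module.finrank ℂ (eigenspace (graph q t) μ)

/-- The solution of `-y'' + q y = μ y` on `[0,1]` with `y(0) = a`, `y'(0) = b`, paired with its
derivative. For `q` integrable on `[0,1]` it exists and is unique on `[0,1]`. -/
noncomputable def cauchySol (q : ℝ → ℂ) (μ a b : ℂ) : (ℝ → ℂ) × (ℝ → ℂ) :=
  Classical.epsilon fun p => Solves q (μ • p.1) p.1 p.2 ∧ p.1 0 = a ∧ p.2 0 = b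

/-- The Hill discriminant `F(μ) = φ'(1,μ) + θ(1,μ)`, where `θ, φ` are the solutions of
`-y'' + q y = μ y` with `θ(0) = φ'(0) = 1`, `θ'(0) = φ(0) = 0`. -/
noncomputable def discriminant (q : ℝ → ℂ) (μ : ℂ) : ℂ :=
  (cauchySol q μ 0 1).2 1 + (cauchySol q μ 1 0).1 1

/-- The (algebraic) multiplicity of `μ` as an eigenvalue of `H_t`, that is, its multiplicity as a
root of the characteristic equation `F(μ) = 2 cos t`. -/
noncomputable def algMult (q : ℝ → ℂ) (t : ℝ) (μ : ℂ) : ℕ∞ :=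
  analyticOrderAt (fun z => discriminant q z - 2 * (Real.cos t : ℂ)) μ

/-- `μ` is a simple eigenvalue of `H_t`. -/
def IsSimpleEigenvalue (q : ℝ → ℂ) (t : ℝ) (μ : ℂ) : Prop :=
  IsEigenvalue q t μ ∧ algMult q t μ = 1

/-- `μ` is a multiple eigenvalue of `H_t`. -/
def IsMultipleEigenvalue (q : ℝ → ℂ) (t : ℝ) (μ : ℂ) : Prop :=
  IsEigenvalue q t μ ∧ 2 ≤ algMult q t μ

/-- `lam` is a numbering, by the integers and counting multiplicity, of all eigenvalues
of `H_t`. -/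
def IsNumbering (q : ℝ → ℂ) (t : ℝ) (lam : ℤ → ℂ) : Prop :=
  (∀ k, IsEigenvalue q t (lam k)) ∧ ∀ μ, {k : ℤ | lam k = μ}.encard = algMult q t μ

/-- `P` is the spectral projection of `H_t` corresponding to a simple eigenvalue `μ`:
the bounded projection onto the eigenspace along the range of `H_t - μ`. -/
structure IsSpectralProjection (q : ℝ → ℂ) (t : ℝ) (μ : ℂ) (P : L2 →L[ℂ] L2) : Prop where
  idem : IsIdempotentElem P
  range_eq : LinearMap.range (P : L2 →ₗ[ℂ] L2) = eigenspace (graph q t) μ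
  ker_eq : LinearMap.ker (P : L2 →ₗ[ℂ] L2) = rangeSub (graph q t) μ

/-- The spectrum of the Hill operator `H`, the union of the spectra of `H_t`, `t ∈ [0, 2π)`. -/
def hillSpectrum (q : ℝ → ℂ) : Set ℂ :=
  {μ | ∃ t ∈ Ico (0 : ℝ) (2 * Real.pi), IsEigenvalue q t μ}

/-- `lam₀` is a spectral singularity of `H`: for every `ε > 0` the spectral projections of the
operators `H_t`, `t ∈ [0, 2π)`, corresponding to simple eigenvalues in the `ε`-neighbourhood of
`lam₀` are not uniformly bounded. -/
def IsSpectralSingularity (q : ℝ → ℂ) (lam₀ : ℂ) : Prop :=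
  lam₀ ∈ hillSpectrum q ∧
    ∀ ε > 0, ∀ M : ℝ, ∃ t ∈ Ico (0 : ℝ) (2 * Real.pi), ∃ μ ∈ Metric.ball lam₀ ε,
      IsSimpleEigenvalue q t μ ∧ ∃ P, IsSpectralProjection q t μ P ∧ M < ‖P‖

/-- The punctured interval `(t₀ - δ, t₀) ∪ (t₀, t₀ + δ)`. -/
def puncturedInterval (t₀ δ : ℝ) : Set ℝ := Ioo (t₀ - δ) t₀ ∪ Ioo t₀ (t₀ + δ)

/-- `lam₀` is an essential spectral singularity (ESS) of `H`: for some quasimomentum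
`t₀ ∈ (-π, π]` with `lam₀ ∈ σ(H_{t₀})` there is a continuous branch `μ(t)` of simple eigenvalues
of `H_t` on a punctured neighbourhood of `t₀`, tending to `lam₀` as `t → t₀`, such that
`1 / |α(t)|` is not integrable over any punctured neighbourhood of `t₀`.
Here `α(t) = (Ψ*_t, Ψ_t)`, where `Ψ_t` and `Ψ*_t` are normalized eigenfunctions of `H_t` and of
the adjoint `H_t*` for the eigenvalues `μ(t)` and `conj μ(t)`; `|α(t)|` does not depend on the
choice of these functions. -/
def IsESS (q : ℝ → ℂ) (lam₀ : ℂ) : Prop :=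
  ∃ t₀ ∈ Ioc (-Real.pi) Real.pi, IsEigenvalue q t₀ lam₀ ∧
    ∃ δ > 0, ∃ (μ : ℝ → ℂ) (Ψ Ψs : ℝ → L2),
      ContinuousOn μ (puncturedInterval t₀ δ) ∧
      (∀ t ∈ puncturedInterval t₀ δ,
        IsSimpleEigenvalue q t (μ t) ∧
        Ψ t ∈ eigenspace (graph q t) (μ t) ∧ ‖Ψ t‖ = 1 ∧
        Ψs t ∈ eigenspace (graph q t).adjoint (starRingEnd ℂ (μ t)) ∧ ‖Ψs t‖ = 1) ∧
      Tendsto μ (𝓝[≠] t₀) (𝓝 lam₀) ∧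
      ∀ δ' ∈ Ioc 0 δ, ∫⁻ t in puncturedInterval t₀ δ', ‖inner ℂ (Ψs t) (Ψ t)‖ₑ⁻¹ = ⊤

end Hill

/-! Let `M(μ)` be the monodromy matrix. It has determinant `1` and trace `F(μ)`, and `μ` is an
eigenvalue of `H_t` exactly when `e^{it}` is an eigenvalue of `M(μ)`. When `sin t ≠ 0`, let `v` and
`w` be eigenvectors of `M(μ)` for `e^{it}` and `e^{-it}`, and let `ψ_v`, `ψ_w` be the solutions with
these initial data. Then `ψ_v` spans the eigenspace of `H_t` and the conjugate of `ψ_w` spans that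
of the adjoint. So `|α|` is `|∫ ψ_v ψ_w|` divided by the two norms, and where it is nonzero the
spectral projection has norm `1/|α|`.

Differentiating Green's identity in the spectral parameter gives the key identity `F'(μ) · symp v w
= 2i sin t · ∫ ψ_v ψ_w` (`IsFloquetPair.deriv_discriminant_mul_symp`).

Since `F(k²) = 2 cos k + O(e^{|Im k|}/|k|)`, Cauchy's estimates show that `F'` and `F''` have no
common zero far from the origin. Hence multiple eigenvalues `λ₀` of large modulus are double
(`exists_algMult_eq_two`). At such a point `F = ±2`, so both `F'` and `2 sin t = ±√(4 - F²)` are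
comparable to `|μ - λ₀|`. By the key identity `|α|` is then comparable to `|symp v w|` for unit `v`,
`w` (`exists_pairing_bounds`). It remains to decide whether the two eigenvectors of `M(μ)` merge as
`μ → λ₀`.

The geometric multiplicity is `1` exactly when `M(λ₀)` is not scalar (`geomMult_eq_one_iff`). If it
is not scalar, `v` and `w` are both driven to the line `ker (M(λ₀) ∓ 1)`, so `|α| = O(|t - t₀|)`
along a branch of eigenvalues. Then `1/|α|` is unbounded and not integrable
(`exists_singular_branch`). If it is scalar, the off-diagonal entries of `M(μ)` are `O(|μ - λ₀|)`,
no larger in order than the gap `2|sin t|` between the multipliers. The eigenvectors then stay apart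
and `|α|` is bounded below near `λ₀`, uniformly in `t`, which excludes both kinds of singularity
(`exists_regular_neighbourhood`). -/

namespace Hill

/-! ### Calculus of absolutely continuous functions and Green's identity. -/

/-- `u` is, on `[0,1]`, an absolutely continuous function with integrable derivative `f`. -/
structure IsPrim (f u : ℝ → ℂ) : Prop where
  integrable : IntegrableOn f (Icc 0 1)
  eq_integral : ∀ x ∈ Icc (0 : ℝ) 1, u x = u 0 + ∫ s in (0 : ℝ)..x, f s

lemma IsPrim.intervalIntegrable {f u : ℝ → ℂ} (h : IsPrim f u) :
    IntervalIntegrable f volume 0 1 :=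
  intervalIntegrable_of_Icc h.integrable ⟨zero_le_one, le_rfl⟩

/-- Increments of `∫ f` are dominated by those of `∫ ‖f‖`, so absolute continuity passes from the
real primitive to the complex one. -/
lemma absolutelyContinuousOnInterval_integral {f : ℝ → ℂ}
    (hf : IntervalIntegrable f volume 0 1) :
    AbsolutelyContinuousOnInterval (fun x => ∫ s in (0 : ℝ)..x, f s) 0 1 := by
  have hac := hf.norm.absolutelyContinuousOnInterval_intervalIntegral (c := 0) (by simp)
  rw [absolutelyContinuousOnInterval_iff] at hac ⊢
  intro ε hε
  obtain ⟨δ, hδ, H⟩ := hac ε hε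
  refine ⟨δ, hδ, fun E hE hEδ => lt_of_le_of_lt ?_ (H E hE hEδ)⟩
  refine Finset.sum_le_sum fun i hi => ?_
  have hmem := hE.1 i hi
  have hint : ∀ x ∈ uIcc (0 : ℝ) 1, IntervalIntegrable f volume 0 x := fun x hx =>
    hf.mono_set (uIcc_subset_uIcc left_mem_uIcc hx)
  rw [dist_eq_norm, dist_eq_norm,
    intervalIntegral.integral_interval_sub_left (hint _ hmem.1) (hint _ hmem.2),
    intervalIntegral.integral_interval_sub_left (hint _ hmem.1).norm (hint _ hmem.2).norm]
  exact intervalIntegral.norm_integral_le_abs_integral_norm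

lemma IsPrim.continuousOn {f u : ℝ → ℂ} (h : IsPrim f u) : ContinuousOn u (Icc 0 1) := by
  have := (absolutelyContinuousOnInterval_integral h.intervalIntegrable).continuousOn
  rw [uIcc_of_le zero_le_one] at this
  exact (continuousOn_const.add this).congr h.eq_integral

/-- The product rule for absolutely continuous functions. -/
lemma IsPrim.mul {f g u v : ℝ → ℂ} (hu : IsPrim f u) (hv : IsPrim g v) :
    IsPrim (fun s => f s * v s + u s * g s) (fun s => u s * v s) := by
  have hI : IntegrableOn (fun s => f s * v s + u s * g s) (Icc 0 1) :=
    (hu.integrable.mul_continuousOn hv.continuousOn isCompact_Icc).add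
      (hv.integrable.continuousOn_mul hu.continuousOn isCompact_Icc)
  have hI' := intervalIntegrable_of_Icc hI ⟨zero_le_one, le_rfl⟩
  refine ⟨hI, ?_⟩
  -- `u` and `v` are controlled on `[0,1]` only, while `HasDerivAt` looks at a full neighbourhood.
  -- They are therefore replaced by the primitives `U`, `V`; then `U V - W` is absolutely continuous
  -- with zero derivative almost everywhere, hence constant.
  set U : ℝ → ℂ := fun x => u 0 + ∫ s in (0 : ℝ)..x, f s
  set V : ℝ → ℂ := fun x => v 0 + ∫ s in (0 : ℝ)..x, g s
  set W : ℝ → ℂ := fun x => ∫ s in (0 : ℝ)..x, (f s * v s + u s * g s)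
  have hconst : ∀ c : ℂ, AbsolutelyContinuousOnInterval (fun _ : ℝ => c) 0 1 := fun c =>
    contDiff_const.contDiffOn.absolutelyContinuousOnInterval
  have hUac : AbsolutelyContinuousOnInterval U 0 1 :=
    (hconst _).fun_add (absolutelyContinuousOnInterval_integral hu.intervalIntegrable)
  have hVac : AbsolutelyContinuousOnInterval V 0 1 :=
    (hconst _).fun_add (absolutelyContinuousOnInterval_integral hv.intervalIntegrable)
  have hac : AbsolutelyContinuousOnInterval (fun x => U x * V x - W x) 0 1 :=
    (hUac.fun_smul hVac).fun_sub (absolutelyContinuousOnInterval_integral hI')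
  have hd : ∀ᵐ x, x ∈ uIcc (0 : ℝ) 1 → HasDerivAt (fun x => U x * V x - W x) 0 x := by
    filter_upwards [hu.intervalIntegrable.ae_hasDerivAt_integral,
      hv.intervalIntegrable.ae_hasDerivAt_integral, hI'.ae_hasDerivAt_integral] with x h1 h2 h3 hx
    have d := ((((h1 hx 0 (by simp)).const_add (u 0)).mul
      ((h2 hx 0 (by simp)).const_add (v 0))).sub (h3 hx 0 (by simp)))
    have hx' : x ∈ Icc (0 : ℝ) 1 := by rwa [uIcc_of_le zero_le_one] at hx
    rw [← hu.eq_integral x hx', ← hv.eq_integral x hx', sub_self] at d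
    exact d
  obtain ⟨C, hC⟩ := hac.const_of_ae_hasDerivAt_zero hd
  intro x hx
  have h0 := hC 0 (by simp)
  have hx1 := hC x (by rwa [uIcc_of_le zero_le_one])
  have e1 : U x = u x := (hu.eq_integral x hx).symm
  have e2 : V x = v x := (hv.eq_integral x hx).symm
  have e3 : U 0 = u 0 := by simp [U]
  have e4 : V 0 = v 0 := by simp [V]
  have e5 : W 0 = 0 := by simp [W]
  simp only [e1, e2, e3, e4, e5] at h0 hx1
  change u x * v x = u 0 * v 0 + W x
  linear_combination hx1 - h0

lemma IsPrim.add {f g u v : ℝ → ℂ} (hu : IsPrim f u) (hv : IsPrim g v) :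
    IsPrim (fun s => f s + g s) (fun s => u s + v s) := by
  refine ⟨hu.integrable.add hv.integrable, fun x hx => ?_⟩
  rw [intervalIntegral.integral_add (intervalIntegrable_of_Icc hu.integrable hx)
    (intervalIntegrable_of_Icc hv.integrable hx)]
  simp only [hu.eq_integral x hx, hv.eq_integral x hx]
  ring

lemma IsPrim.sub {f g u v : ℝ → ℂ} (hu : IsPrim f u) (hv : IsPrim g v) :
    IsPrim (fun s => f s - g s) (fun s => u s - v s) := by
  refine ⟨hu.integrable.sub hv.integrable, fun x hx => ?_⟩
  rw [intervalIntegral.integral_sub (intervalIntegrable_of_Icc hu.integrable hx)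
    (intervalIntegrable_of_Icc hv.integrable hx)]
  simp only [hu.eq_integral x hx, hv.eq_integral x hx]
  ring

lemma IsPrim.of_hasDerivAt {f u : ℝ → ℂ} (hd : ∀ x, HasDerivAt u (f x) x) (hf : Continuous f) :
    IsPrim f u := by
  refine ⟨hf.continuousOn.integrableOn_compact isCompact_Icc, fun x _ => ?_⟩
  rw [intervalIntegral.integral_eq_sub_of_hasDerivAt (fun y _ => hd y)
    (hf.intervalIntegrable _ _)]
  ring

lemma Solves.isPrim {q f y dy : ℝ → ℂ} (h : Solves q f y dy) : IsPrim dy y :=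
  ⟨h.cont_deriv.integrableOn_compact isCompact_Icc, h.eq_integral⟩

lemma Solves.isPrim_deriv {q f y dy : ℝ → ℂ} (h : Solves q f y dy) :
    IsPrim (fun s => q s * y s - f s) dy :=
  ⟨h.integrable, h.deriv_eq_integral⟩

/-- Green's identity. -/
lemma Solves.green {q f g y dy z dz : ℝ → ℂ} (h : Solves q f y dy) (h' : Solves q g z dz) :
    (dy 1 * z 1 - y 1 * dz 1) - (dy 0 * z 0 - y 0 * dz 0) =
      ∫ s in (0 : ℝ)..1, (y s * g s - f s * z s) := by
  have := ((h.isPrim_deriv.mul h'.isPrim).sub (h.isPrim.mul h'.isPrim_deriv)).eq_integral 1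
    ⟨zero_le_one, le_rfl⟩
  rw [this, add_sub_cancel_left]
  congr 1
  funext s
  ring

end Hill

/-! ### The Cauchy problem as a Volterra equation; entire dependence on the spectral parameter. -/

namespace Hill

/-- The continuous functions on `[0,1]`. -/
abbrev C01 : Type := C(Icc (0 : ℝ) 1, ℂ)

/-- The extension of a continuous function on `[0,1]` to the line by constants. -/
noncomputable def extend (y : C01) : ℝ → ℂ := IccExtend zero_le_one y

lemma continuous_extend (y : C01) : Continuous (extend y) := y.continuous.Icc_extend'

lemma extend_apply (y : C01) {x : ℝ} (hx : x ∈ Icc (0 : ℝ) 1) : extend y x = y ⟨x, hx⟩ :=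
  IccExtend_of_mem _ _ hx

lemma extend_add (y z : C01) (x : ℝ) : extend (y + z) x = extend y x + extend z x := rfl

lemma extend_smul (c : ℂ) (y : C01) (x : ℝ) : extend (c • y) x = c * extend y x := rfl

lemma norm_extend_le (y : C01) (x : ℝ) : ‖extend y x‖ ≤ ‖y‖ := y.norm_coe_le_norm _

lemma integrableOn_mul_extend {g : ℝ → ℂ} (hg : IntegrableOn g (Icc 0 1)) (y : C01) :
    IntegrableOn (fun s => g s * extend y s) (Icc 0 1) :=
  hg.mul_continuousOn (continuous_extend y).continuousOn isCompact_Icc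

/-- The primitive of an integrable function that vanishes at `0`. -/
noncomputable def primitive (g : ℝ → ℂ) (hg : IntegrableOn g (Icc 0 1)) : C01 where
  toFun x := ∫ s in (0 : ℝ)..x, g s
  continuous_toFun := by
    have := (absolutelyContinuousOnInterval_integral
      (intervalIntegrable_of_Icc hg ⟨zero_le_one, le_rfl⟩)).continuousOn
    rw [uIcc_of_le zero_le_one] at this
    exact this.domRestrict

lemma primitive_apply {g : ℝ → ℂ} (hg : IntegrableOn g (Icc 0 1)) (x : Icc (0 : ℝ) 1) :
    primitive g hg x = ∫ s in (0 : ℝ)..x, g s := rfl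

lemma integral_le_integral_one {g : ℝ → ℝ} (hg : IntegrableOn g (Icc 0 1)) (h0 : ∀ x, 0 ≤ g x)
    {x : ℝ} (hx : x ∈ Icc (0 : ℝ) 1) : ∫ s in (0 : ℝ)..x, g s ≤ ∫ s in (0 : ℝ)..1, g s := by
  rw [intervalIntegral.integral_of_le hx.1, intervalIntegral.integral_of_le zero_le_one]
  exact setIntegral_mono_set (hg.mono_set Ioc_subset_Icc_self) (Eventually.of_forall h0)
    (Ioc_subset_Ioc_right hx.2).eventuallyLE

/-- The Volterra operator `y ↦ ∫₀ˣ g y`. -/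
noncomputable def volterra (g : ℝ → ℂ) (hg : IntegrableOn g (Icc 0 1)) : C01 →L[ℂ] C01 :=
  LinearMap.mkContinuous
    { toFun := fun y => primitive (fun s => g s * extend y s) (integrableOn_mul_extend hg y)
      map_add' := fun y z => by
        ext x
        simp only [primitive_apply, ContinuousMap.add_apply]
        rw [← intervalIntegral.integral_add
          (intervalIntegrable_of_Icc (integrableOn_mul_extend hg y) x.2)
          (intervalIntegrable_of_Icc (integrableOn_mul_extend hg z) x.2)]
        simp only [extend_add, mul_add]
      map_smul' := fun c y => by
        ext x
        simp only [primitive_apply, ContinuousMap.smul_apply, RingHom.id_apply, smul_eq_mul]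
        rw [← intervalIntegral.integral_const_mul]
        congr 1
        funext s
        rw [extend_smul]
        ring }
    (∫ s in (0 : ℝ)..1, ‖g s‖) (fun y => by
      have h0 : 0 ≤ ∫ s in (0 : ℝ)..1, ‖g s‖ :=
        intervalIntegral.integral_nonneg zero_le_one fun _ _ => norm_nonneg _
      refine (ContinuousMap.norm_le _ (by positivity)).2 fun x => ?_
      have hi := intervalIntegrable_of_Icc hg x.2
      calc ‖∫ s in (0 : ℝ)..x, g s * extend y s‖ ≤ ∫ s in (0 : ℝ)..x, ‖g s‖ * ‖y‖ := by
            refine intervalIntegral.norm_integral_le_of_norm_le x.2.1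
              (Eventually.of_forall fun s _ => ?_) (hi.norm.mul_const _)
            rw [norm_mul]
            exact mul_le_mul_of_nonneg_left (norm_extend_le y s) (norm_nonneg _)
        _ = (∫ s in (0 : ℝ)..x, ‖g s‖) * ‖y‖ := intervalIntegral.integral_mul_const _ _
        _ ≤ _ := mul_le_mul_of_nonneg_right
            (integral_le_integral_one hg.norm (fun _ => norm_nonneg _) x.2) (norm_nonneg _))

lemma volterra_apply {g : ℝ → ℂ} (hg : IntegrableOn g (Icc 0 1)) (y : C01) (x : Icc (0 : ℝ) 1) :
    volterra g hg y x = ∫ s in (0 : ℝ)..x, g s * extend y s := rfl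

lemma integrableOn_one : IntegrableOn (fun _ : ℝ => (1 : ℂ)) (Icc 0 1) :=
  continuousOn_const.integrableOn_compact isCompact_Icc

/-- The operator `y ↦ ∫₀ˣ y`. -/
noncomputable def integ : C01 →L[ℂ] C01 := volterra (fun _ => 1) integrableOn_one

lemma integ_apply (y : C01) (x : Icc (0 : ℝ) 1) :
    integ y x = ∫ s in (0 : ℝ)..x, extend y s := by
  simp only [integ, volterra_apply, one_mul]

variable {q : ℝ → ℂ} (hq : IntegrableOn q (Icc 0 1))

/-- The operator `y ↦ ∫₀ˣ (q - μ) y`. -/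
noncomputable def integPot (μ : ℂ) : C01 →L[ℂ] C01 := volterra q hq - μ • integ

lemma integPot_apply (μ : ℂ) (y : C01) (x : Icc (0 : ℝ) 1) :
    integPot hq μ y x = ∫ s in (0 : ℝ)..x, (q s - μ) * extend y s := by
  simp only [integPot, sub_apply, smul_apply,
    ContinuousMap.sub_apply, ContinuousMap.smul_apply, volterra_apply, integ_apply, smul_eq_mul]
  rw [← intervalIntegral.integral_const_mul, ← intervalIntegral.integral_sub
    (intervalIntegrable_of_Icc (integrableOn_mul_extend hq y) x.2)
    (((continuous_extend y).intervalIntegrable _ _).const_mul μ)]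
  simp only [sub_mul]

/-- The operator `T` for which `y = T y + a + b x` expresses the Cauchy problem. -/
noncomputable def cauchyOp (μ : ℂ) : C01 →L[ℂ] C01 := integ.comp (integPot hq μ)

/-- `∫₀ˣ |q - μ|`. -/
noncomputable def potMass (q : ℝ → ℂ) (μ : ℂ) (x : ℝ) : ℝ := ∫ s in (0 : ℝ)..x, ‖q s - μ‖

lemma integrableOn_sub_const (hq : IntegrableOn q (Icc 0 1)) (μ : ℂ) :
    IntegrableOn (fun s => q s - μ) (Icc 0 1) :=
  hq.sub (continuousOn_const.integrableOn_compact isCompact_Icc)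

/-- The chain rule for powers of the mass, by induction from the product rule; it produces the
factorials in the Volterra iteration. At `n = 0` the truncated exponent `n - 1` is harmless because
of the factor `n`. -/
lemma isPrim_potMass_pow (hq : IntegrableOn q (Icc 0 1)) (μ : ℂ) (n : ℕ) :
    IsPrim (fun s => (n : ℂ) * ((‖q s - μ‖ : ℂ) * (potMass q μ s : ℂ) ^ (n - 1)))
      (fun s => (potMass q μ s : ℂ) ^ n) := by
  have h1 : IsPrim (fun s => (‖q s - μ‖ : ℂ)) (fun s => (potMass q μ s : ℂ)) := by
    refine ⟨(integrableOn_sub_const hq μ).norm.ofReal, fun x _ => ?_⟩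
    rw [intervalIntegral.integral_ofReal]
    simp [potMass]
  induction n with
  | zero => simpa using IsPrim.of_hasDerivAt (fun x => hasDerivAt_const x (1 : ℂ)) continuous_const
  | succ n ih =>
    have h2 := ih.mul h1
    have e : (fun s => ((n + 1 : ℕ) : ℂ) * ((‖q s - μ‖ : ℂ) * (potMass q μ s : ℂ) ^ (n + 1 - 1))) =
        fun s => (n : ℂ) * ((‖q s - μ‖ : ℂ) * (potMass q μ s : ℂ) ^ (n - 1)) * (potMass q μ s : ℂ) +
          (potMass q μ s : ℂ) ^ n * (‖q s - μ‖ : ℂ) := by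
      funext s
      rcases n with _ | n
      · simp
      · simp only [Nat.add_sub_cancel]
        push_cast
        ring
    simp only [e, pow_succ]
    exact h2

lemma integral_potMass_pow (hq : IntegrableOn q (Icc 0 1)) (μ : ℂ) (n : ℕ) {x : ℝ}
    (hx : x ∈ Icc (0 : ℝ) 1) :
    ∫ s in (0 : ℝ)..x, ‖q s - μ‖ * potMass q μ s ^ n = potMass q μ x ^ (n + 1) / (n + 1) := by
  have h := (isPrim_potMass_pow hq μ (n + 1)).eq_integral x hx
  have h0 : potMass q μ 0 = 0 := by simp [potMass]
  rw [intervalIntegral.integral_const_mul] at h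
  simp only [h0, Nat.add_sub_cancel] at h
  have e : ∀ s : ℝ, (‖q s - μ‖ : ℂ) * (potMass q μ s : ℂ) ^ n =
      ((‖q s - μ‖ * potMass q μ s ^ n : ℝ) : ℂ) := fun s => by push_cast; rfl
  simp only [e, intervalIntegral.integral_ofReal] at h
  have h' : potMass q μ x ^ (n + 1) =
      (n + 1) * ∫ s in (0 : ℝ)..x, ‖q s - μ‖ * potMass q μ s ^ n := by
    have h3 : ((potMass q μ x ^ (n + 1) : ℝ) : ℂ) =
      (((n + 1) * ∫ s in (0 : ℝ)..x, ‖q s - μ‖ * potMass q μ s ^ n : ℝ) : ℂ) := by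
      push_cast
      rw [h]
      simp
    exact_mod_cast h3
  rw [h']
  field_simp

lemma potMass_nonneg (μ : ℂ) {x : ℝ} (hx : 0 ≤ x) : 0 ≤ potMass q μ x :=
  intervalIntegral.integral_nonneg hx fun _ _ => norm_nonneg _

lemma intervalIntegrable_norm_mul_potMass_pow (hq : IntegrableOn q (Icc 0 1)) (μ : ℂ) (n : ℕ)
    {x : ℝ} (hx : x ∈ Icc (0 : ℝ) 1) :
    IntervalIntegrable (fun s => ‖q s - μ‖ * potMass q μ s ^ n) volume 0 x := by
  have hc : ContinuousOn (fun s => potMass q μ s) (Icc 0 1) := by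
    have := (isPrim_potMass_pow hq μ 1).continuousOn
    simp only [pow_one] at this
    exact (Complex.continuous_re.comp_continuousOn this).congr fun s _ => by simp
  have hn : IntegrableOn (fun s => ‖q s - μ‖) (Icc 0 1) := (integrableOn_sub_const hq μ).norm
  have := hn.mul_continuousOn (hc.pow n) isCompact_Icc
  rw [intervalIntegrable_iff_integrableOn_Icc_of_le hx.1]
  exact this.mono_set (Icc_subset_Icc le_rfl hx.2)

/-- Integrating `|q - μ| mⁿ/n!`, with `m = potMass q μ`, gives `m^{n+1}/(n+1)!`. The outer
integration costs nothing, since `m` is nondecreasing and the interval has length at most `1`. -/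
lemma norm_cauchyOp_pow_apply_le (μ : ℂ) (n : ℕ) (y : C01) (x : Icc (0 : ℝ) 1) :
    ‖(cauchyOp hq μ ^ n) y x‖ ≤ ‖y‖ * (potMass q μ x ^ n / n.factorial) := by
  induction n generalizing x with
  | zero => simpa using y.norm_coe_le_norm x
  | succ n ih =>
    set z := (cauchyOp hq μ ^ n) y with hz
    have e : (cauchyOp hq μ ^ (n + 1)) y = integ (integPot hq μ z) := by
      rw [pow_succ', hz]; rfl
    set B : ℝ := ‖y‖ * (potMass q μ x ^ (n + 1) / (n + 1).factorial)
    have hinner : ∀ s : Icc (0 : ℝ) 1, s ≤ x → ‖integPot hq μ z s‖ ≤ B := by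
      intro s hs
      rw [integPot_apply]
      calc ‖∫ r in (0 : ℝ)..s, (q r - μ) * extend z r‖
          ≤ ∫ r in (0 : ℝ)..s, (‖y‖ / n.factorial) * (‖q r - μ‖ * potMass q μ r ^ n) := by
            refine intervalIntegral.norm_integral_le_of_norm_le s.2.1
              (Eventually.of_forall fun r hr => ?_)
              ((intervalIntegrable_norm_mul_potMass_pow hq μ n s.2).const_mul _)
            have hr' : r ∈ Icc (0 : ℝ) 1 := ⟨hr.1.le, hr.2.trans s.2.2⟩
            rw [norm_mul, extend_apply z hr']
            refine (mul_le_mul_of_nonneg_left (ih ⟨r, hr'⟩) (norm_nonneg _)).trans (le_of_eq ?_)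
            ring
        _ = (‖y‖ / n.factorial) * (potMass q μ s ^ (n + 1) / (n + 1)) := by
            rw [intervalIntegral.integral_const_mul, integral_potMass_pow hq μ n s.2]
        _ ≤ (‖y‖ / n.factorial) * (potMass q μ x ^ (n + 1) / (n + 1)) := by
            have hm : potMass q μ s ≤ potMass q μ x := by
              have hi : IntegrableOn (fun s => ‖q s - μ‖) (Icc 0 1) :=
                (integrableOn_sub_const hq μ).norm
              unfold potMass
              rw [intervalIntegral.integral_of_le s.2.1, intervalIntegral.integral_of_le x.2.1]
              refine setIntegral_mono_set (hi.mono_set ?_)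
                (Eventually.of_forall fun _ => norm_nonneg _)
                (Ioc_subset_Ioc_right (Subtype.coe_le_coe.2 hs)).eventuallyLE
              exact Ioc_subset_Icc_self.trans (Icc_subset_Icc le_rfl x.2.2)
            have := potMass_nonneg (q := q) μ s.2.1
            gcongr
        _ = B := by
            simp only [B, Nat.factorial_succ]
            push_cast
            field_simp
    have hB : 0 ≤ B := mul_nonneg (norm_nonneg _)
      (div_nonneg (pow_nonneg (potMass_nonneg μ x.2.1) _) (Nat.cast_nonneg _))
    rw [e, integ_apply]
    refine (intervalIntegral.norm_integral_le_of_norm_le_const (C := B) fun s hs => ?_).trans ?_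
    · rw [uIoc_of_le x.2.1] at hs
      have hs' : s ∈ Icc (0 : ℝ) 1 := ⟨hs.1.le, hs.2.trans x.2.2⟩
      rw [extend_apply _ hs']
      exact hinner ⟨s, hs'⟩ hs.2
    · rw [sub_zero, abs_of_nonneg x.2.1]
      exact mul_le_of_le_one_right hB x.2.2

/-- `1 - aⁿ` is the product of the commuting factors `1 - a` and `∑ aⁱ`, so its invertibility forces
that of `1 - a`. -/
lemma isUnit_one_sub_of_norm_pow_lt_one {A : Type*} [NormedRing A] [HasSummableGeomSeries A]
    {a : A} {n : ℕ} (h : ‖a ^ n‖ < 1) : IsUnit (1 - a) := by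
  have hu := isUnit_one_sub_of_norm_lt_one h
  have hc : Commute (1 - a) (∑ i ∈ Finset.range n, a ^ i) :=
    Commute.sum_right _ _ _ fun i _ => ((Commute.one_left _).sub_left
      ((Commute.refl a).pow_right i))
  rw [← mul_neg_geom_sum] at hu
  exact (hc.isUnit_mul_iff.1 hu).1

/-- Because `mⁿ/n! → 0`, some power of the operator is a strict contraction, whatever the size of
`q` and `μ`. -/
lemma isUnit_one_sub_cauchyOp (μ : ℂ) : IsUnit (1 - cauchyOp hq μ) := by
  have ht := FloorSemiring.tendsto_pow_div_factorial_atTop (potMass q μ 1)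
  obtain ⟨n, hn⟩ := (ht.eventually (gt_mem_nhds (show (0 : ℝ) < 1 by norm_num))).exists
  refine isUnit_one_sub_of_norm_pow_lt_one (A := C01 →L[ℂ] C01) (n := n) (lt_of_le_of_lt ?_ hn)
  have h0 : 0 ≤ potMass q μ 1 ^ n / (n.factorial : ℝ) :=
    div_nonneg (pow_nonneg (potMass_nonneg μ zero_le_one) _) (Nat.cast_nonneg _)
  refine ContinuousLinearMap.opNorm_le_bound _ h0 fun y => ?_
  refine (ContinuousMap.norm_le _ (by positivity)).2 fun x => ?_
  refine (norm_cauchyOp_pow_apply_le hq μ n y x).trans ?_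
  rw [mul_comm]
  have h1 : potMass q μ x ≤ potMass q μ 1 :=
    integral_le_integral_one (integrableOn_sub_const hq μ).norm (fun _ => norm_nonneg _) x.2
  have := potMass_nonneg (q := q) μ x.2.1
  gcongr

/-- The inverse of `1 - T`. -/
noncomputable def cauchyInv (μ : ℂ) : C01 →L[ℂ] C01 := Ring.inverse (1 - cauchyOp hq μ)

lemma cauchyInv_apply (μ : ℂ) (r : C01) :
    cauchyInv hq μ r = r + cauchyOp hq μ (cauchyInv hq μ r) := by
  have h : (1 - cauchyOp hq μ) (cauchyInv hq μ r) = r := congrArg (fun A : C01 →L[ℂ] C01 => A r)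
    (Ring.mul_inverse_cancel _ (isUnit_one_sub_cauchyOp hq μ))
  exact sub_eq_iff_eq_add.1 h

lemma eq_cauchyInv_apply (μ : ℂ) {r y : C01} (h : y = r + cauchyOp hq μ y) :
    y = cauchyInv hq μ r := by
  have h1 : cauchyInv hq μ (y - cauchyOp hq μ y) = y := congrArg (fun A : C01 →L[ℂ] C01 => A y)
    (Ring.inverse_mul_cancel _ (isUnit_one_sub_cauchyOp hq μ))
  rw [sub_eq_iff_eq_add.2 h] at h1
  exact h1.symm

lemma differentiable_sub_smul {E : Type*} [NormedAddCommGroup E] [NormedSpace ℂ E] (a b : E) :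
    Differentiable ℂ fun μ : ℂ => a - μ • b := by
  fun_prop

lemma differentiable_integPot : Differentiable ℂ (integPot hq) :=
  differentiable_sub_smul (volterra q hq) integ

/-- Inversion is analytic on the units and the operator is affine in `μ`. This is the source of the
analyticity of the monodromy and of `F`. -/
lemma differentiable_cauchyInv : Differentiable ℂ (cauchyInv hq) := by
  intro μ
  have h := (differentiable_const (1 : C01 →L[ℂ] C01)).sub
    ((differentiable_const integ).clm_comp (differentiable_integPot hq))
  exact (differentiableAt_inverse (isUnit_one_sub_cauchyOp hq μ)).comp μ (h μ)

/-- The affine function `a + b x` on `[0,1]`. -/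
noncomputable def affineFun : ℂ × ℂ →L[ℂ] C01 :=
  (ContinuousLinearMap.fst ℂ ℂ ℂ).smulRight (1 : C01) +
    (ContinuousLinearMap.snd ℂ ℂ ℂ).smulRight (⟨fun x => ((x : ℝ) : ℂ), by fun_prop⟩ : C01)

lemma affineFun_apply (v : ℂ × ℂ) (x : Icc (0 : ℝ) 1) :
    affineFun v x = v.1 + v.2 * ((x : ℝ) : ℂ) := by
  simp [affineFun]

/-- The solution of `-y'' + q y = μ y` with `(y(0), y'(0)) = v`. -/
noncomputable def flow (μ : ℂ) : ℂ × ℂ →L[ℂ] C01 := (cauchyInv hq μ).comp affineFun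

lemma differentiable_flow : Differentiable ℂ (flow hq) := by
  have := differentiable_cauchyInv hq
  unfold flow
  fun_prop

/-- The derivative of `flow`. -/
noncomputable def flowDeriv (μ : ℂ) : ℂ × ℂ →L[ℂ] C01 :=
  (ContinuousLinearMap.snd ℂ ℂ ℂ).smulRight (1 : C01) + (integPot hq μ).comp (flow hq μ)

lemma differentiable_flowDeriv : Differentiable ℂ (flowDeriv hq) := by
  exact (differentiable_const _).add
    ((differentiable_integPot hq).clm_comp (differentiable_flow hq))

/-- A fixed point of the integral equation solves the inhomogeneous Cauchy problem. -/
lemma solves_of_integral_eq (μ : ℂ) {f : ℝ → ℂ} (hf : IntegrableOn f (Icc 0 1)) (v : ℂ × ℂ)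
    {y : C01} (h : y = affineFun v - integ (primitive f hf) + cauchyOp hq μ y) :
    Solves q (f + μ • extend y) (extend y)
        (extend (ContinuousMap.const _ v.2 + integPot hq μ y - primitive f hf)) ∧
      extend y 0 = v.1 ∧
      extend (ContinuousMap.const _ v.2 + integPot hq μ y - primitive f hf) 0 = v.2 := by
  set dy : C01 := ContinuousMap.const _ v.2 + integPot hq μ y - primitive f hf with hdy
  have hi1 : IntegrableOn (fun s => (q s - μ) * extend y s) (Icc 0 1) :=
    integrableOn_mul_extend (integrableOn_sub_const hq μ) y
  have e : (fun s => q s * extend y s - (f + μ • extend y) s) =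
      fun s => (q s - μ) * extend y s - f s := by
    funext s
    simp only [Pi.add_apply, Pi.smul_apply, smul_eq_mul]
    ring
  have h0 : (0 : ℝ) ∈ Icc (0 : ℝ) 1 := ⟨le_rfl, zero_le_one⟩
  have hdyx : ∀ x (hx : x ∈ Icc (0 : ℝ) 1), extend dy x =
      v.2 + ∫ s in (0 : ℝ)..x, ((q s - μ) * extend y s - f s) := by
    intro x hx
    rw [extend_apply _ hx, intervalIntegral.integral_sub (intervalIntegrable_of_Icc hi1 hx)
      (intervalIntegrable_of_Icc hf hx)]
    simp only [hdy, ContinuousMap.sub_apply, ContinuousMap.add_apply, integPot_apply,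
      primitive_apply, ContinuousMap.const_apply]
    ring
  have hdy0 : extend dy 0 = v.2 := by simp [hdyx 0 h0]
  have hyx : ∀ x (hx : x ∈ Icc (0 : ℝ) 1), extend y x =
      v.1 + ∫ s in (0 : ℝ)..x, extend dy s := by
    intro x hx
    -- The fixed-point equation rewritten as `y = v.1 + ∫ dy`, with the two single integrations
    -- collected under one `integ`.
    have e1 : y = affineFun v + integ (integPot hq μ y - primitive f hf) := by
      rw [map_sub]
      nth_rewrite 1 [h]
      simp only [cauchyOp, ContinuousLinearMap.comp_apply]
      abel
    have e2 : ∀ s, extend dy s = v.2 + extend (integPot hq μ y - primitive f hf) s := by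
      intro s
      rw [hdy, add_sub_assoc, extend_add]
      rfl
    rw [extend_apply y hx, e1]
    simp only [e2]
    rw [intervalIntegral.integral_add (intervalIntegrable_const)
      ((continuous_extend _).intervalIntegrable _ _), ContinuousMap.add_apply, affineFun_apply,
      integ_apply, intervalIntegral.integral_const]
    rw [Complex.real_smul]
    push_cast
    ring
  have hy0 : extend y 0 = v.1 := by simp [hyx 0 h0]
  refine ⟨⟨(continuous_extend y).continuousOn, (continuous_extend dy).continuousOn, ?_,
    fun x hx => ?_, fun x hx => ?_⟩, hy0, hdy0⟩
  · rw [e]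
    exact hi1.sub hf
  · rw [hy0, hyx x hx]
  · rw [e, hdy0, hdyx x hx]

/-- Solvability of the inhomogeneous Cauchy problem. -/
lemma exists_solves (hq : IntegrableOn q (Icc 0 1)) (μ : ℂ) {f : ℝ → ℂ}
    (hf : IntegrableOn f (Icc 0 1)) (v : ℂ × ℂ) :
    ∃ y dy : ℝ → ℂ, Solves q (f + μ • y) y dy ∧ y 0 = v.1 ∧ dy 0 = v.2 :=
  ⟨_, _, solves_of_integral_eq hq μ hf v
    (cauchyInv_apply hq μ (affineFun v - integ (primitive f hf)))⟩

lemma solves_flow (μ : ℂ) (v : ℂ × ℂ) :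
    Solves q (μ • extend (flow hq μ v)) (extend (flow hq μ v)) (extend (flowDeriv hq μ v)) ∧
      extend (flow hq μ v) 0 = v.1 ∧ extend (flowDeriv hq μ v) 0 = v.2 := by
  have h0 : primitive 0 integrableOn_zero = 0 := by
    ext x
    simp [primitive_apply]
  have h := solves_of_integral_eq hq μ (f := 0) integrableOn_zero v (y := flow hq μ v) (by
    rw [h0, map_zero, sub_zero]
    exact cauchyInv_apply hq μ (affineFun v))
  have e : ContinuousMap.const _ v.2 + integPot hq μ (flow hq μ v) - primitive 0 integrableOn_zero =
      flowDeriv hq μ v := by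
    rw [h0, sub_zero]
    ext x
    simp [flowDeriv]
  rwa [e, zero_add] at h

/-- Uniqueness in the Cauchy problem. -/
lemma Solves.eq_flow {μ : ℂ} {y dy : ℝ → ℂ} (h : Solves q (μ • y) y dy) :
    (∀ x ∈ Icc (0 : ℝ) 1, y x = extend (flow hq μ (y 0, dy 0)) x) ∧
      ∀ x ∈ Icc (0 : ℝ) 1, dy x = extend (flowDeriv hq μ (y 0, dy 0)) x := by
  set Y : C01 := ⟨(Icc (0 : ℝ) 1).domRestrict y, h.cont.domRestrict⟩ with hY
  have hYx : ∀ x ∈ Icc (0 : ℝ) 1, extend Y x = y x := fun x hx => extend_apply Y hx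
  have hdyx : ∀ x (hx : x ∈ Icc (0 : ℝ) 1), dy x = dy 0 + integPot hq μ Y ⟨x, hx⟩ := by
    intro x hx
    rw [h.deriv_eq_integral x hx, integPot_apply]
    congr 1
    refine intervalIntegral.integral_congr fun s hs => ?_
    rw [uIcc_of_le hx.1] at hs
    simp only [Pi.smul_apply, smul_eq_mul]
    rw [hYx s ⟨hs.1, hs.2.trans hx.2⟩]
    ring
  have hfix : Y = affineFun (y 0, dy 0) + cauchyOp hq μ Y := by
    ext x
    have e1 : Y x = y x := rfl
    have e2 : ∫ s in (0 : ℝ)..x, dy s =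
        ∫ s in (0 : ℝ)..x, (dy 0 + extend (integPot hq μ Y) s) := by
      refine intervalIntegral.integral_congr fun s hs => ?_
      rw [uIcc_of_le x.2.1] at hs
      have hs' : s ∈ Icc (0 : ℝ) 1 := ⟨hs.1, hs.2.trans x.2.2⟩
      simp only [extend_apply _ hs', ← hdyx s hs']
    rw [e1, h.eq_integral x x.2, e2, intervalIntegral.integral_add (intervalIntegrable_const)
      ((continuous_extend _).intervalIntegrable _ _), ContinuousMap.add_apply, affineFun_apply,
      cauchyOp, ContinuousLinearMap.comp_apply, integ_apply, intervalIntegral.integral_const,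
      Complex.real_smul]
    push_cast
    ring
  have hYflow : Y = flow hq μ (y 0, dy 0) := eq_cauchyInv_apply hq μ hfix
  refine ⟨fun x hx => ?_, fun x hx => ?_⟩
  · rw [← hYflow, hYx x hx]
  · rw [hdyx x hx, extend_apply _ hx, hYflow]
    simp [flowDeriv]

/-- The monodromy operator `(y(0), y'(0)) ↦ (y(1), y'(1))`. -/
noncomputable def monodromy (μ : ℂ) : ℂ × ℂ →L[ℂ] ℂ × ℂ :=
  ((ContinuousMap.evalCLM ℂ (⟨1, zero_le_one, le_rfl⟩ : Icc (0 : ℝ) 1)).comp (flow hq μ)).prod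
    ((ContinuousMap.evalCLM ℂ (⟨1, zero_le_one, le_rfl⟩ : Icc (0 : ℝ) 1)).comp (flowDeriv hq μ))

lemma monodromy_apply (μ : ℂ) (v : ℂ × ℂ) :
    monodromy hq μ v = (extend (flow hq μ v) 1, extend (flowDeriv hq μ v) 1) := by
  rw [extend_apply _ ⟨zero_le_one, le_rfl⟩, extend_apply _ ⟨zero_le_one, le_rfl⟩]
  rfl

lemma differentiable_monodromy_apply (v : ℂ × ℂ) :
    Differentiable ℂ fun μ => monodromy hq μ v := by
  have h1 := differentiable_flow hq
  have h2 := differentiable_flowDeriv hq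
  have e : (fun μ => monodromy hq μ v) = fun μ =>
    (ContinuousMap.evalCLM ℂ (⟨1, zero_le_one, le_rfl⟩ : Icc (0 : ℝ) 1) (flow hq μ v),
      ContinuousMap.evalCLM ℂ (⟨1, zero_le_one, le_rfl⟩ : Icc (0 : ℝ) 1) (flowDeriv hq μ v)) := rfl
  rw [e]
  refine Differentiable.prodMk ?_ ?_ <;>
  · refine (ContinuousLinearMap.differentiable _).comp ?_
    fun_prop

lemma cauchySol_spec (hq : IntegrableOn q (Icc 0 1)) (μ a b : ℂ) :
    Solves q (μ • (cauchySol q μ a b).1) (cauchySol q μ a b).1 (cauchySol q μ a b).2 ∧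
      (cauchySol q μ a b).1 0 = a ∧ (cauchySol q μ a b).2 0 = b :=
  Classical.epsilon_spec (p := fun p : (ℝ → ℂ) × (ℝ → ℂ) =>
    Solves q (μ • p.1) p.1 p.2 ∧ p.1 0 = a ∧ p.2 0 = b)
    ⟨(extend (flow hq μ (a, b)), extend (flowDeriv hq μ (a, b))), solves_flow hq μ (a, b)⟩

/-- `cauchySol` is an arbitrary choice outside `[0,1]`, but uniqueness of the Cauchy problem pins
its value at `1`. Consequently `F` is the trace of the monodromy. -/
lemma cauchySol_one (μ a b : ℂ) :
    ((cauchySol q μ a b).1 1, (cauchySol q μ a b).2 1) = monodromy hq μ (a, b) := by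
  obtain ⟨h, h1, h2⟩ := cauchySol_spec hq μ a b
  have := h.eq_flow hq
  rw [h1, h2] at this
  rw [monodromy_apply, this.1 1 ⟨zero_le_one, le_rfl⟩, this.2 1 ⟨zero_le_one, le_rfl⟩]

lemma discriminant_eq (μ : ℂ) :
    discriminant q μ = (monodromy hq μ (1, 0)).1 + (monodromy hq μ (0, 1)).2 := by
  rw [← cauchySol_one hq, ← cauchySol_one hq, discriminant, add_comm]

lemma differentiable_discriminant (hq : IntegrableOn q (Icc 0 1)) :
    Differentiable ℂ (discriminant q) := by
  have e : discriminant q = fun μ => (monodromy hq μ (1, 0)).1 + (monodromy hq μ (0, 1)).2 :=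
    funext (discriminant_eq hq)
  rw [e]
  exact (differentiable_monodromy_apply hq _).fst.add (differentiable_monodromy_apply hq _).snd

end Hill

/-! ### Asymptotics of the discriminant for large spectral parameter. -/

namespace Hill

lemma norm_cos_le_exp (z : ℂ) : ‖Complex.cos z‖ ≤ Real.exp |z.im| := by
  rw [Complex.cos, norm_div, Complex.norm_ofNat, div_le_iff₀ two_pos]
  refine (norm_add_le _ _).trans ?_
  rw [Complex.norm_exp, Complex.norm_exp]
  have h1 : Real.exp (z * Complex.I).re ≤ Real.exp |z.im| :=
    Real.exp_le_exp.2 (by simpa using neg_le_abs z.im)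
  have h2 : Real.exp (-z * Complex.I).re ≤ Real.exp |z.im| :=
    Real.exp_le_exp.2 (by simpa using le_abs_self z.im)
  linarith

lemma norm_sin_le_exp (z : ℂ) : ‖Complex.sin z‖ ≤ Real.exp |z.im| := by
  rw [Complex.sin, norm_div, Complex.norm_ofNat, div_le_iff₀ two_pos, norm_mul, Complex.norm_I,
    mul_one]
  refine (norm_sub_le _ _).trans ?_
  rw [Complex.norm_exp, Complex.norm_exp]
  have h1 : Real.exp (z * Complex.I).re ≤ Real.exp |z.im| :=
    Real.exp_le_exp.2 (by simpa using neg_le_abs z.im)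
  have h2 : Real.exp (-z * Complex.I).re ≤ Real.exp |z.im| :=
    Real.exp_le_exp.2 (by simpa using le_abs_self z.im)
  linarith

/-- One of `e^{±iz} = cos z ± i sin z` has modulus exactly `e^{|Im z|}`. Hence sine and cosine
cannot both be small on this scale, which is what excludes `F' = F'' = 0`. -/
lemma exp_le_norm_cos_add_norm_sin (z : ℂ) :
    Real.exp |z.im| ≤ ‖Complex.cos z‖ + ‖Complex.sin z‖ := by
  rcases abs_cases z.im with ⟨h, -⟩ | ⟨h, -⟩
  · have e : Complex.exp (-z * Complex.I) = Complex.cos z - Complex.sin z * Complex.I := by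
      rw [Complex.exp_mul_I, Complex.cos_neg, Complex.sin_neg]
      ring
    have := norm_sub_le (Complex.cos z) (Complex.sin z * Complex.I)
    rw [← e, Complex.norm_exp, norm_mul, Complex.norm_I, mul_one] at this
    rw [h]
    simpa using this
  · have := norm_add_le (Complex.cos z) (Complex.sin z * Complex.I)
    rw [← Complex.exp_mul_I, Complex.norm_exp, norm_mul, Complex.norm_I, mul_one] at this
    rw [h]
    simpa using this

variable {q : ℝ → ℂ}

lemma hasDerivAt_sin_mul_sub (k : ℂ) (x s : ℝ) :
    HasDerivAt (fun s : ℝ => Complex.sin (k * (x - s))) (-k * Complex.cos (k * (x - s))) s := by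
  have h : HasDerivAt (fun s : ℝ => k * ((x : ℂ) - s)) (-k) s := by
    simpa using ((Complex.ofRealCLM.hasDerivAt (x := s)).const_sub (x : ℂ)).const_mul k
  convert! (Complex.hasDerivAt_sin (k * ((x : ℂ) - s))).comp s h using 1
  ring

lemma hasDerivAt_cos_mul_sub (k : ℂ) (x s : ℝ) :
    HasDerivAt (fun s : ℝ => Complex.cos (k * (x - s))) (k * Complex.sin (k * (x - s))) s := by
  have h : HasDerivAt (fun s : ℝ => k * ((x : ℂ) - s)) (-k) s := by
    simpa using ((Complex.ofRealCLM.hasDerivAt (x := s)).const_sub (x : ℂ)).const_mul k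
  convert! (Complex.hasDerivAt_cos (k * ((x : ℂ) - s))).comp s h using 1
  ring

/-- Variation of constants with respect to the free equation. -/
lemma Solves.variation {k : ℂ} {y dy : ℝ → ℂ} (h : Solves q (k ^ 2 • y) y dy) {x : ℝ}
    (hx : x ∈ Icc (0 : ℝ) 1) :
    k * y x = dy 0 * Complex.sin (k * x) + k * y 0 * Complex.cos (k * x) +
      ∫ s in (0 : ℝ)..x, Complex.sin (k * (x - s)) * (q s * y s) := by
  have hS : IsPrim (fun s : ℝ => -k * Complex.cos (k * (x - s)))
      (fun s : ℝ => Complex.sin (k * (x - s))) :=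
    .of_hasDerivAt (hasDerivAt_sin_mul_sub k x) (by fun_prop)
  have hC : IsPrim (fun s : ℝ => k * (k * Complex.sin (k * (x - s))))
      (fun s : ℝ => k * Complex.cos (k * (x - s))) :=
    .of_hasDerivAt (fun s => (hasDerivAt_cos_mul_sub k x s).const_mul k) (by fun_prop)
  -- The function `s ↦ y'(s) sin k(x-s) + k y(s) cos k(x-s)` equals `k y(x)` at `s = x`, and its
  -- derivative is `sin k(x-s) · q y`.
  have := ((h.isPrim_deriv.mul hS).add (h.isPrim.mul hC)).eq_integral x hx
  simp only [sub_self, mul_zero, Complex.sin_zero, Complex.cos_zero, Complex.ofReal_zero,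
    sub_zero, zero_add, mul_one] at this
  rw [mul_comm k (y x), this]
  congr 1
  · ring
  · congr 1
    funext s
    simp only [Pi.smul_apply, smul_eq_mul]
    ring

lemma Solves.variation_deriv {k : ℂ} {y dy : ℝ → ℂ} (h : Solves q (k ^ 2 • y) y dy) {x : ℝ}
    (hx : x ∈ Icc (0 : ℝ) 1) :
    dy x = dy 0 * Complex.cos (k * x) - k * y 0 * Complex.sin (k * x) +
      ∫ s in (0 : ℝ)..x, Complex.cos (k * (x - s)) * (q s * y s) := by
  have hS : IsPrim (fun s : ℝ => -k * (-k * Complex.cos (k * (x - s))))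
      (fun s : ℝ => -k * Complex.sin (k * (x - s))) :=
    .of_hasDerivAt (fun s => (hasDerivAt_sin_mul_sub k x s).const_mul (-k)) (by fun_prop)
  have hC : IsPrim (fun s : ℝ => k * Complex.sin (k * (x - s)))
      (fun s : ℝ => Complex.cos (k * (x - s))) :=
    .of_hasDerivAt (hasDerivAt_cos_mul_sub k x) (by fun_prop)
  have := ((h.isPrim_deriv.mul hC).add (h.isPrim.mul hS)).eq_integral x hx
  simp only [sub_self, mul_zero, Complex.sin_zero, Complex.cos_zero, Complex.ofReal_zero,
    sub_zero, add_zero, mul_one] at this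
  rw [this]
  congr 1
  · ring
  · congr 1
    funext s
    simp only [Pi.smul_apply, smul_eq_mul]
    ring

/-- The bound for the integral term in the variation of constants formula. -/
lemma norm_integral_kernel_le (hq : IntegrableOn q (Icc 0 1)) {c y : ℝ → ℂ} {τ B x : ℝ}
    (hB : 0 ≤ B) (hx : x ∈ Icc (0 : ℝ) 1)
    (hc : ∀ s ∈ Icc (0 : ℝ) x, ‖c s‖ ≤ Real.exp (τ * (x - s)))
    (hy : ∀ s ∈ Icc (0 : ℝ) 1, ‖y s‖ ≤ B * Real.exp (τ * s)) :
    ‖∫ s in (0 : ℝ)..x, c s * (q s * y s)‖ ≤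
      (∫ s in (0 : ℝ)..1, ‖q s‖) * (B * Real.exp (τ * x)) := by
  calc ‖∫ s in (0 : ℝ)..x, c s * (q s * y s)‖
      ≤ ∫ s in (0 : ℝ)..x, ‖q s‖ * (B * Real.exp (τ * x)) := by
        refine intervalIntegral.norm_integral_le_of_norm_le hx.1
          (Eventually.of_forall fun s hs => ?_)
          ((intervalIntegrable_of_Icc hq hx).norm.mul_const _)
        have h1 := hc s ⟨hs.1.le, hs.2⟩
        have h2 := hy s ⟨hs.1.le, hs.2.trans hx.2⟩
        rw [norm_mul, norm_mul]
        calc ‖c s‖ * (‖q s‖ * ‖y s‖)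
            ≤ Real.exp (τ * (x - s)) * (‖q s‖ * (B * Real.exp (τ * s))) := by gcongr
          _ = ‖q s‖ * (B * (Real.exp (τ * (x - s)) * Real.exp (τ * s))) := by ring
          _ = ‖q s‖ * (B * Real.exp (τ * x)) := by rw [← Real.exp_add]; ring_nf
    _ = (∫ s in (0 : ℝ)..x, ‖q s‖) * (B * Real.exp (τ * x)) :=
        intervalIntegral.integral_mul_const _ _
    _ ≤ _ := mul_le_mul_of_nonneg_right
        (integral_le_integral_one hq.norm (fun _ => norm_nonneg _) hx) (by positivity)

lemma abs_im_mul_sub (k : ℂ) {x s : ℝ} (h : s ≤ x) :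
    |(k * ((x : ℂ) - s)).im| = |k.im| * (x - s) := by
  have : (k * ((x : ℂ) - s)).im = k.im * (x - s) := by
    rw [← Complex.ofReal_sub, Complex.im_mul_ofReal]
  rw [this, abs_mul, abs_of_nonneg (sub_nonneg.2 h)]

lemma abs_im_mul_ofReal (k : ℂ) {x : ℝ} (h : 0 ≤ x) :
    |(k * (x : ℂ)).im| = |k.im| * x := by
  rw [Complex.im_mul_ofReal, abs_mul, abs_of_nonneg h]

/-- A maximum argument in place of Gronwall's. If `B` is the maximum of `|y(x)| e^{-|Im k| x}`, the
variation formula at the maximum gives `|k| B ≤ A + Q B`, and `Q ≤ |k|/2` absorbs the last term. -/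
lemma Solves.norm_le (hq : IntegrableOn q (Icc 0 1)) {k : ℂ} (hk0 : 0 < ‖k‖)
    (hk : 2 * ∫ s in (0 : ℝ)..1, ‖q s‖ ≤ ‖k‖)
    {y dy : ℝ → ℂ} (h : Solves q (k ^ 2 • y) y dy) {x : ℝ} (hx : x ∈ Icc (0 : ℝ) 1) :
    ‖y x‖ ≤ 2 * ((‖dy 0‖ + ‖k‖ * ‖y 0‖) / ‖k‖) * Real.exp (|k.im| * x) := by
  set Q := ∫ s in (0 : ℝ)..1, ‖q s‖ with hQ
  have hQ0 : 0 ≤ Q := intervalIntegral.integral_nonneg zero_le_one fun _ _ => norm_nonneg _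
  set A := ‖dy 0‖ + ‖k‖ * ‖y 0‖ with hA
  have hcont : ContinuousOn (fun x => ‖y x‖ * Real.exp (-(|k.im| * x))) (Icc 0 1) :=
    h.cont.norm.mul (by fun_prop)
  obtain ⟨x₀, hx₀, hmax⟩ := isCompact_Icc.exists_isMaxOn ⟨(0 : ℝ), le_rfl, zero_le_one⟩ hcont
  set B := ‖y x₀‖ * Real.exp (-(|k.im| * x₀)) with hB
  have hB0 : 0 ≤ B := by positivity
  have hyB : ∀ s ∈ Icc (0 : ℝ) 1, ‖y s‖ ≤ B * Real.exp (|k.im| * s) := by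
    intro s hs
    have h1 : ‖y s‖ * Real.exp (-(|k.im| * s)) ≤ B := hmax hs
    calc ‖y s‖ = ‖y s‖ * Real.exp (-(|k.im| * s)) * Real.exp (|k.im| * s) := by
          rw [mul_assoc, ← Real.exp_add]; simp
      _ ≤ _ := by gcongr
  have hint := norm_integral_kernel_le hq (c := fun s => Complex.sin (k * (x₀ - s)))
    (y := y) (τ := |k.im|) hB0 hx₀ (fun s hs => by
      rw [← abs_im_mul_sub k hs.2]; exact norm_sin_le_exp _) hyB
  have key : ‖k‖ * ‖y x₀‖ ≤ (A + Q * B) * Real.exp (|k.im| * x₀) := by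
    rw [← norm_mul, h.variation hx₀]
    refine (norm_add₃_le).trans ?_
    rw [norm_mul, norm_mul, norm_mul]
    have e1 := norm_sin_le_exp (k * (x₀ : ℂ))
    have e2 := norm_cos_le_exp (k * (x₀ : ℂ))
    rw [abs_im_mul_ofReal k hx₀.1] at e1 e2
    have e3 : ‖dy 0‖ * ‖Complex.sin (k * x₀)‖ ≤ ‖dy 0‖ * Real.exp (|k.im| * x₀) := by gcongr
    have e4 : ‖k‖ * ‖y 0‖ * ‖Complex.cos (k * x₀)‖ ≤ ‖k‖ * ‖y 0‖ * Real.exp (|k.im| * x₀) := by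
      gcongr
    rw [hA]
    linarith
  have key2 : ‖k‖ * B ≤ A + Q * B := by
    calc ‖k‖ * B = ‖k‖ * ‖y x₀‖ * Real.exp (-(|k.im| * x₀)) := by rw [hB]; ring
      _ ≤ (A + Q * B) * Real.exp (|k.im| * x₀) * Real.exp (-(|k.im| * x₀)) := by gcongr
      _ = A + Q * B := by rw [mul_assoc, ← Real.exp_add]; simp
  have key3 : B ≤ 2 * (A / ‖k‖) := by
    rw [mul_div_assoc', le_div_iff₀ hk0]
    nlinarith
  exact (hyB x hx).trans (by gcongr)

/-- The asymptotics of the discriminant. -/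
lemma norm_discriminant_sub_le (hq : IntegrableOn q (Icc 0 1)) {k : ℂ} (hk0 : 0 < ‖k‖)
    (hk : 2 * ∫ s in (0 : ℝ)..1, ‖q s‖ ≤ ‖k‖) :
    ‖discriminant q (k ^ 2) - 2 * Complex.cos k‖ ≤
      4 * (∫ s in (0 : ℝ)..1, ‖q s‖) * Real.exp |k.im| / ‖k‖ := by
  set Q := ∫ s in (0 : ℝ)..1, ‖q s‖ with hQ
  have h1m : (1 : ℝ) ∈ Icc (0 : ℝ) 1 := ⟨zero_le_one, le_rfl⟩
  have hkne : k ≠ 0 := norm_pos_iff.1 hk0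
  obtain ⟨hθ, hθ0, hθ1⟩ := cauchySol_spec hq (k ^ 2) 1 0
  obtain ⟨hφ, hφ0, hφ1⟩ := cauchySol_spec hq (k ^ 2) 0 1
  set θ := (cauchySol q (k ^ 2) 1 0).1
  set dθ := (cauchySol q (k ^ 2) 1 0).2
  set φ := (cauchySol q (k ^ 2) 0 1).1
  set dφ := (cauchySol q (k ^ 2) 0 1).2
  have bθ : ∀ s ∈ Icc (0 : ℝ) 1, ‖θ s‖ ≤ 2 * Real.exp (|k.im| * s) := fun s hs => by
    have := hθ.norm_le hq hk0 hk hs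
    rw [hθ0, hθ1] at this
    simpa [hk0.ne'] using this
  have bφ : ∀ s ∈ Icc (0 : ℝ) 1, ‖φ s‖ ≤ 2 / ‖k‖ * Real.exp (|k.im| * s) := fun s hs => by
    have := hφ.norm_le hq hk0 hk hs
    rw [hφ0, hφ1] at this
    simpa [div_eq_mul_inv] using this
  have vθ := hθ.variation h1m
  have vφ := hφ.variation_deriv h1m
  have iθ := norm_integral_kernel_le hq (c := fun s => Complex.sin (k * ((1 : ℝ) - s)))
    (y := θ) (τ := |k.im|) (B := 2) (x := 1) (by norm_num) h1m (fun s hs => by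
      rw [← abs_im_mul_sub k hs.2]; exact norm_sin_le_exp _) bθ
  have iφ := norm_integral_kernel_le hq (c := fun s => Complex.cos (k * ((1 : ℝ) - s)))
    (y := φ) (τ := |k.im|) (B := 2 / ‖k‖) (x := 1) (by positivity) h1m (fun s hs => by
      rw [← abs_im_mul_sub k hs.2]; exact norm_cos_le_exp _) bφ
  set Iθ := ∫ s in (0 : ℝ)..1, Complex.sin (k * ((1 : ℝ) - s)) * (q s * θ s)
  set Iφ := ∫ s in (0 : ℝ)..1, Complex.cos (k * ((1 : ℝ) - s)) * (q s * φ s)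
  -- Both corrections are `O(1/|k|)`: for `Iφ` the factor comes from the bound on `φ`, for `Iθ / k`
  -- from the division.
  have e : discriminant q (k ^ 2) - 2 * Complex.cos k = Iφ + Iθ / k := by
    have e1 : θ 1 = Complex.cos k + Iθ / k := by
      rw [hθ0, hθ1] at vθ
      field_simp
      rw [mul_comm, mul_comm (Complex.cos k)]
      simpa using vθ
    have e2 : dφ 1 = Complex.cos k + Iφ := by
      rw [hφ0, hφ1] at vφ
      simpa using vφ
    change dφ 1 + θ 1 - _ = _
    rw [e1, e2]
    ring
  rw [e]
  refine (norm_add_le _ _).trans ?_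
  rw [norm_div]
  simp only [mul_one] at iθ iφ
  calc ‖Iφ‖ + ‖Iθ‖ / ‖k‖
      ≤ Q * (2 / ‖k‖ * Real.exp |k.im|) + Q * (2 * Real.exp |k.im|) / ‖k‖ := by gcongr
    _ = _ := by ring

end Hill

/-! ### Consequences of the asymptotics: nondegenerate critical points and large roots. -/

namespace Hill

variable {q : ℝ → ℂ}

/-- The deviation of the discriminant from that of the free equation, in the variable `k = √μ`. -/
noncomputable def discDev (q : ℝ → ℂ) (k : ℂ) : ℂ := discriminant q (k ^ 2) - 2 * Complex.cos k

lemma differentiable_discDev (hq : IntegrableOn q (Icc 0 1)) : Differentiable ℂ (discDev q) := by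
  have := differentiable_discriminant hq
  unfold discDev
  fun_prop

/-- The bound is uniform on the unit disc about `k`, as needed for Cauchy's estimates and for
locating roots. Moving inside the disc costs a factor `e` in the exponential and, since `|k + z| ≥
|k|/2`, a factor `2`. -/
lemma exists_norm_discDev_le (hq : IntegrableOn q (Icc 0 1)) :
    ∃ C R : ℝ, 0 ≤ C ∧ 1 ≤ R ∧ ∀ k : ℂ, R ≤ ‖k‖ →
      ∀ z : ℂ, ‖z‖ ≤ 1 → ‖discDev q (k + z)‖ ≤ C * Real.exp |k.im| / ‖k‖ := by
  set Q := ∫ s in (0 : ℝ)..1, ‖q s‖ with hQ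
  have hQ0 : 0 ≤ Q := intervalIntegral.integral_nonneg zero_le_one fun _ _ => norm_nonneg _
  refine ⟨8 * Q * Real.exp 1, 2 * Q + 2, by positivity, by linarith, fun k hk z hz => ?_⟩
  have h1 : ‖k‖ - 1 ≤ ‖k + z‖ := by
    have := norm_sub_le (k + z) z
    rw [add_sub_cancel_right] at this
    linarith
  have h2 : ‖k‖ / 2 ≤ ‖k + z‖ := by linarith
  have hk0 : 0 < ‖k‖ := by linarith
  refine (norm_discriminant_sub_le hq (k := k + z) (by linarith) (by linarith)).trans ?_
  have him : |(k + z).im| ≤ |k.im| + 1 := by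
    rw [Complex.add_im]
    exact (abs_add_le _ _).trans (by linarith [Complex.abs_im_le_norm z])
  calc 4 * Q * Real.exp |(k + z).im| / ‖k + z‖
      ≤ 4 * Q * Real.exp (|k.im| + 1) / (‖k‖ / 2) := by gcongr
    _ = _ := by rw [Real.exp_add]; field_simp; ring

/-- Cauchy's estimates on the unit circle about `k`; the `2` in the constant is the `2!` of the
second derivative. -/
lemma exists_norm_deriv_discDev_le (hq : IntegrableOn q (Icc 0 1)) :
    ∃ C R : ℝ, 0 ≤ C ∧ 1 ≤ R ∧ ∀ k : ℂ, R ≤ ‖k‖ →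
      ‖deriv (discDev q) k‖ ≤ C * Real.exp |k.im| / ‖k‖ ∧
      ‖deriv (deriv (discDev q)) k‖ ≤ C * Real.exp |k.im| / ‖k‖ := by
  obtain ⟨C, R, hC, hR, H⟩ := exists_norm_discDev_le hq
  refine ⟨2 * C, R, by positivity, hR, fun k hk => ?_⟩
  have hd : DiffContOnCl ℂ (discDev q) (Metric.ball k 1) := (differentiable_discDev hq).diffContOnCl
  have hs : ∀ z ∈ Metric.sphere k 1, ‖discDev q z‖ ≤ C * Real.exp |k.im| / ‖k‖ := by
    intro z hz
    have := H k hk (z - k) (by rw [← dist_eq_norm]; exact (Metric.mem_sphere.1 hz).le)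
    rwa [add_sub_cancel] at this
  have h1 := Complex.norm_iteratedDeriv_le_of_forall_mem_sphere_norm_le 1 one_pos hd hs
  have h2 := Complex.norm_iteratedDeriv_le_of_forall_mem_sphere_norm_le 2 one_pos hd hs
  have h0 : 0 ≤ C * Real.exp |k.im| / ‖k‖ := by positivity
  rw [iteratedDeriv_one] at h1
  rw [iteratedDeriv_succ, iteratedDeriv_one] at h2
  simp only [Nat.factorial, one_pow, div_one] at h1 h2
  push_cast at h1 h2
  rw [show 2 * C * Real.exp |k.im| / ‖k‖ = 2 * (C * Real.exp |k.im| / ‖k‖) by ring]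
  constructor <;> linarith

/-- Far from the origin the discriminant has no critical points of multiplicity two or more. -/
lemma exists_deriv_deriv_discriminant_ne_zero (hq : IntegrableOn q (Icc 0 1)) :
    ∃ R : ℝ, ∀ μ : ℂ, R < ‖μ‖ → deriv (discriminant q) μ = 0 →
      deriv (deriv (discriminant q)) μ ≠ 0 := by
  obtain ⟨C, R, hC, hR, H⟩ := exists_norm_deriv_discDev_le hq
  set K := R + C with hK
  refine ⟨K ^ 2, fun μ hμ h1 h2 => ?_⟩
  obtain ⟨k, rfl⟩ : ∃ k : ℂ, μ = k ^ 2 := by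
    obtain ⟨k, hk⟩ := IsAlgClosed.exists_pow_nat_eq μ (n := 2) two_pos
    exact ⟨k, hk.symm⟩
  have hk : K < ‖k‖ := by
    rw [norm_pow] at hμ
    exact lt_of_pow_lt_pow_left₀ 2 (norm_nonneg _) hμ
  have hkpos : 0 < ‖k‖ := by linarith
  have hF := differentiable_discriminant hq
  have hF' : Differentiable ℂ (deriv (discriminant q)) :=
    (hF.contDiff (n := 2)).differentiable_deriv_two
  have d1 : ∀ z : ℂ, HasDerivAt (discDev q)
      (deriv (discriminant q) (z ^ 2) * (2 * z) + 2 * Complex.sin z) z := by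
    intro z
    have hp : HasDerivAt (fun z : ℂ => z ^ 2) (2 * z) z := by simpa using hasDerivAt_pow 2 z
    have := ((hF (z ^ 2)).hasDerivAt.comp z hp).sub ((Complex.hasDerivAt_cos z).const_mul 2)
    convert! this using 1
    ring
  have d1' : deriv (discDev q) =
      fun z => deriv (discriminant q) (z ^ 2) * (2 * z) + 2 * Complex.sin z :=
    funext fun z => (d1 z).deriv
  have d2 : HasDerivAt (deriv (discDev q))
      (deriv (deriv (discriminant q)) (k ^ 2) * (2 * k) * (2 * k) +
        deriv (discriminant q) (k ^ 2) * 2 + 2 * Complex.cos k) k := by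
    rw [d1']
    have hp : HasDerivAt (fun z : ℂ => z ^ 2) (2 * k) k := by simpa using hasDerivAt_pow 2 k
    have hl : HasDerivAt (fun z : ℂ => 2 * z) 2 k := by simpa using (hasDerivAt_id k).const_mul 2
    exact (((hF' (k ^ 2)).hasDerivAt.comp k hp).mul hl).add ((Complex.hasDerivAt_sin k).const_mul 2)
  -- When `F'` and `F''` vanish at `k²`, the two derivatives of `discDev q` at `k` are just `2 sin
  -- k` and `2 cos k`. As `|k| > C`, both have modulus below `e^{|Im k|}`, against
  -- `exp_le_norm_cos_add_norm_sin`.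
  obtain ⟨b1, b2⟩ := H k (by linarith)
  rw [(d1 k).deriv, h1] at b1
  rw [d2.deriv, h1, h2] at b2
  simp only [zero_mul, zero_add, norm_mul, Complex.norm_ofNat] at b1 b2
  have h3 := exp_le_norm_cos_add_norm_sin k
  have h4 : C * Real.exp |k.im| / ‖k‖ < Real.exp |k.im| := by
    rw [div_lt_iff₀ hkpos, mul_comm]
    exact mul_lt_mul_of_pos_left (by linarith) (Real.exp_pos _)
  linarith

lemma discriminant_not_const (hq : IntegrableOn q (Icc 0 1)) (c : ℂ) :
    ¬ ∀ μ, discriminant q μ = c := by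
  intro h
  obtain ⟨R, hR⟩ := exists_deriv_deriv_discriminant_ne_zero hq
  have h0 : deriv (discriminant q) = fun _ => 0 := by
    rw [show discriminant q = fun _ => c from funext h]
    funext z
    simp
  refine hR ((|R| + 1 : ℝ) : ℂ) ?_ ?_ ?_
  · rw [Complex.norm_real, Real.norm_of_nonneg (by positivity)]
    linarith [le_abs_self R]
  · rw [h0]
  · rw [h0]; simp

lemma analyticOrderAt_discriminant_ne_top (hq : IntegrableOn q (Icc 0 1)) (c μ : ℂ) :
    analyticOrderAt (fun z => discriminant q z - c) μ ≠ ⊤ := by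
  intro h
  rw [analyticOrderAt_eq_top] at h
  have ha : AnalyticOnNhd ℂ (fun z => discriminant q z - c) univ := fun z _ =>
    ((differentiable_discriminant hq).sub_const c).analyticAt z
  have := ha.eqOn_zero_of_preconnected_of_eventuallyEq_zero isPreconnected_univ (mem_univ μ) h
  exact discriminant_not_const hq c fun z => sub_eq_zero.1 (this (mem_univ z))

/-- On the unit circle the quadratic Taylor term has modulus `1/2` and the remainder is below
`1/10`. -/
lemma two_fifths_le_norm_cos_sub_one {z : ℂ} (hz : ‖z‖ = 1) : 2 / 5 ≤ ‖Complex.cos z - 1‖ := by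
  have h := Complex.cos_bound (x := z) hz.le
  rw [hz] at h
  have h1 : ‖z ^ 2 / 2‖ ≤ ‖Complex.cos z - (1 - z ^ 2 / 2)‖ + ‖Complex.cos z - 1‖ := by
    have e : z ^ 2 / 2 = (Complex.cos z - (1 - z ^ 2 / 2)) - (Complex.cos z - 1) := by ring
    nth_rewrite 1 [e]
    exact norm_sub_le _ _
  rw [norm_div, norm_pow, hz, Complex.norm_ofNat] at h1
  norm_num at h h1
  linarith

/-- The equation `F(μ) = 2 cos t₀`, `t₀ ∈ {0, π}`, has arbitrarily large roots. -/
lemma exists_large_root (hq : IntegrableOn q (Icc 0 1)) {t₀ : ℝ} (ht₀ : t₀ = 0 ∨ t₀ = Real.pi)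
    (X : ℝ) : ∃ μ : ℂ, X < ‖μ‖ ∧ discriminant q μ = 2 * (Real.cos t₀ : ℂ) := by
  obtain ⟨C, R, hC, hR, H⟩ := exists_norm_discDev_le hq
  -- `10 * C` makes the deviation at most `1/10` on the disc used below; `|X| + 2` makes the square
  -- of any point of that disc exceed `X` in modulus.
  set S := max (max R (10 * C)) (|X| + 2) with hS
  obtain ⟨n, hn⟩ := exists_nat_gt S
  have hSR : R ≤ S := (le_max_left _ _).trans (le_max_left _ _)
  have hSC : 10 * C ≤ S := (le_max_right _ _).trans (le_max_left _ _)
  have hSX : |X| + 2 ≤ S := le_max_right _ _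
  set r : ℝ := t₀ + n * (2 * Real.pi) with hr
  set k : ℂ := (r : ℂ) with hk
  have ht0 : 0 ≤ t₀ := by rcases ht₀ with rfl | rfl; exacts [le_rfl, Real.pi_pos.le]
  have hrn : (n : ℝ) ≤ r := by
    have : (1 : ℝ) ≤ 2 * Real.pi := by linarith [Real.pi_gt_three]
    have h0 : (0 : ℝ) ≤ n := Nat.cast_nonneg n
    nlinarith
  have hknorm : ‖k‖ = r := by
    rw [hk, Complex.norm_real, Real.norm_of_nonneg]
    linarith [abs_nonneg X]
  have hkim : k.im = 0 := Complex.ofReal_im r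
  have hcos : ∀ z : ℂ, Complex.cos (k + z) = (Real.cos t₀ : ℂ) * Complex.cos z := by
    intro z
    have : k + z = (t₀ + z) + n * (2 * Real.pi) := by rw [hk, hr]; push_cast; ring
    rw [this, Complex.cos_add_nat_mul_two_pi, Complex.cos_add]
    rcases ht₀ with rfl | rfl <;> simp
  have hσ : ‖(Real.cos t₀ : ℂ)‖ = 1 := by rcases ht₀ with rfl | rfl <;> simp
  have hE : ∀ z : ℂ, ‖z‖ ≤ 1 → ‖discDev q (k + z)‖ ≤ 1 / 10 := by
    intro z hz
    refine (H k (by rw [hknorm]; linarith) z hz).trans ?_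
    rw [hkim, hknorm, abs_zero, Real.exp_zero, mul_one, div_le_iff₀ (by linarith)]
    linarith
  set G : ℂ → ℂ := fun z => discriminant q (z ^ 2) with hG
  have hGd : Differentiable ℂ G := by
    have := differentiable_discriminant hq
    fun_prop
  have hGe : ∀ z, G (k + z) = 2 * ((Real.cos t₀ : ℂ) * Complex.cos z) + discDev q (k + z) := by
    intro z
    rw [← hcos]
    simp only [hG, discDev]
    ring
  have hGk : G k = 2 * (Real.cos t₀ : ℂ) + discDev q k := by simpa using hGe 0
  have hEk : ‖discDev q k‖ ≤ 1 / 10 := by simpa using hE 0 (by simp)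
  -- At the centre `2 cos k = 2 cos t₀`, so the target is within `1/10` of `G k`. On the circle `G`
  -- moves by at least `2 · 2/5 - 2 · 1/10 = 3/5`. The quantitative open mapping theorem covers the
  -- disc of radius `3/10` about `G k`, which contains the target.
  have hsph : ∀ z ∈ Metric.sphere k 1, (3 / 5 : ℝ) ≤ ‖G z - G k‖ := by
    intro z hz
    have hz1 : ‖z - k‖ = 1 := by rwa [← dist_eq_norm]
    have e : G z - G k = 2 * ((Real.cos t₀ : ℂ) * (Complex.cos (z - k) - 1)) -
        (discDev q k - discDev q z) := by
      have := hGe (z - k)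
      rw [add_sub_cancel] at this
      rw [this, hGk]
      ring
    have h1 := two_fifths_le_norm_cos_sub_one hz1
    have h2 : ‖discDev q z‖ ≤ 1 / 10 := by simpa using hE (z - k) hz1.le
    have h3 := norm_sub_norm_le (2 * ((Real.cos t₀ : ℂ) * (Complex.cos (z - k) - 1)))
      (discDev q k - discDev q z)
    rw [← e, norm_mul, norm_mul, hσ, Complex.norm_ofNat, one_mul] at h3
    have h4 := norm_sub_le (discDev q k) (discDev q z)
    linarith
  have hfreq : ∃ᶠ z in 𝓝 k, G z ≠ G k := by
    intro hev
    simp only [not_not] at hev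
    have ha : AnalyticOnNhd ℂ G univ := fun z _ => hGd.analyticAt z
    have hc : AnalyticOnNhd ℂ (fun _ : ℂ => G k) univ := analyticOnNhd_const
    have := ha.eqOn_of_preconnected_of_eventuallyEq hc isPreconnected_univ (mem_univ k) hev
    have h1 := hsph (k + 1) (by simp)
    rw [this (mem_univ (k + 1)), sub_self, norm_zero] at h1
    norm_num at h1
  have hmem : 2 * (Real.cos t₀ : ℂ) ∈ Metric.ball (G k) ((3 / 5) / 2) := by
    rw [Metric.mem_ball, dist_eq_norm, hGk, sub_add_cancel_left, norm_neg]
    linarith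
  have hdc : DiffContOnCl ℂ G (Metric.ball k 1) := hGd.diffContOnCl
  obtain ⟨z, hz, hGz⟩ := hdc.ball_subset_image_closedBall one_pos hsph hfreq hmem
  refine ⟨z ^ 2, ?_, hGz⟩
  have hzk : ‖k - z‖ ≤ 1 := by
    rw [norm_sub_rev, ← dist_eq_norm]; exact hz
  have h5 : ‖k‖ - ‖z‖ ≤ 1 := (norm_sub_norm_le k z).trans hzk
  rw [norm_pow]
  have h6 : |X| + 1 ≤ ‖z‖ := by linarith
  nlinarith [abs_nonneg X, le_abs_self X]

end Hill

/-! ### Eigenfunctions in `L₂[0,1]` and the linear algebra of the monodromy. -/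

namespace Hill

variable {q : ℝ → ℂ} (hq : IntegrableOn q (Icc 0 1))

lemma memLp_extend (y : C01) : MemLp (extend y) 2 (volume.restrict (Icc (0 : ℝ) 1)) :=
  MemLp.of_bound (continuous_extend y).aestronglyMeasurable ‖y‖
    (Eventually.of_forall (norm_extend_le y))

/-- The embedding of the continuous functions into `L₂[0,1]`. -/
noncomputable def toL2 : C01 →L[ℂ] L2 :=
  LinearMap.mkContinuous
    { toFun := fun y => (memLp_extend y).toLp
      map_add' := fun y z => MemLp.toLp_add (memLp_extend y) (memLp_extend z)
      map_smul' := fun c y => MemLp.toLp_const_smul c (memLp_extend y) }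
    (measureUnivNNReal (volume.restrict (Icc (0 : ℝ) 1)) ^ (2 : ENNReal).toReal⁻¹) (fun y => by
      refine Lp.norm_le_of_ae_bound (norm_nonneg y) ?_
      filter_upwards [(memLp_extend y).coeFn_toLp] with x hx
      exact (congrArg norm hx).le.trans (norm_extend_le y x))

lemma coeFn_toL2 (y : C01) :
    (toL2 y : ℝ → ℂ) =ᵐ[volume.restrict (Icc (0 : ℝ) 1)] extend y :=
  (memLp_extend y).coeFn_toLp

lemma toL2_eq_of_ae_eq {u : L2} {y : C01}
    (h : (u : ℝ → ℂ) =ᵐ[volume.restrict (Icc (0 : ℝ) 1)] extend y) : u = toL2 y :=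
  Lp.ext (h.trans (coeFn_toL2 y).symm)

lemma toL2_injective : Function.Injective toL2 := by
  intro y z h
  have hae : extend y =ᵐ[volume.restrict (Icc (0 : ℝ) 1)] extend z := by
    have h' := coeFn_toL2 y
    rw [h] at h'
    exact h'.symm.trans (coeFn_toL2 z)
  have := Measure.eqOn_Icc_of_ae_eq volume zero_ne_one hae (continuous_extend y).continuousOn
    (continuous_extend z).continuousOn
  ext x
  have hx := this x.2
  rwa [extend_apply _ x.2, extend_apply _ x.2] at hx

lemma integrableOn_coeFn (f : L2) : IntegrableOn (f : ℝ → ℂ) (Icc 0 1) :=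
  (Lp.memLp f).integrable one_le_two

lemma extend_star (z : C01) (s : ℝ) : extend (star z) s = starRingEnd ℂ (extend z s) := rfl

/-- Conjugating the first slot undoes the sesquilinearity, so inner products become the bilinear
integrals of Green's identity. -/
lemma inner_toL2_star (z : C01) (f : L2) :
    inner ℂ (toL2 (star z)) f = ∫ s in (0 : ℝ)..1, extend z s * (f : ℝ → ℂ) s := by
  rw [L2.inner_def, intervalIntegral.integral_of_le zero_le_one, ← integral_Icc_eq_integral_Ioc]
  refine integral_congr_ae ?_
  filter_upwards [coeFn_toL2 (star z)] with s hs
  simp only [hs, extend_star, RCLike.inner_apply, Complex.conj_conj]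
  ring

/-- The bilinear pairing `∫₀¹ y z`. -/
noncomputable def pairing (z y : C01) : ℂ := inner ℂ (toL2 (star z)) (toL2 y)

lemma pairing_eq (z y : C01) : pairing z y = ∫ s in (0 : ℝ)..1, extend z s * extend y s := by
  rw [pairing, inner_toL2_star]
  refine intervalIntegral.integral_congr_ae_restrict ?_
  rw [uIoc_of_le zero_le_one]
  refine ae_restrict_of_ae_restrict_of_subset Ioc_subset_Icc_self ?_
  filter_upwards [coeFn_toL2 y] with s hs
  rw [hs]

/-- The symplectic form on `ℂ²`. -/
def symp (v w : ℂ × ℂ) : ℂ := v.1 * w.2 - v.2 * w.1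

lemma exists_smul_of_symp_eq_zero {v w : ℂ × ℂ} (hv : v ≠ 0) (h : symp v w = 0) :
    ∃ c : ℂ, w = c • v := by
  simp only [symp] at h
  by_cases h1 : v.1 = 0
  · have h2 : v.2 ≠ 0 := fun h2 => hv (Prod.ext h1 h2)
    refine ⟨w.2 / v.2, Prod.ext ?_ ?_⟩
    · simp only [h1, zero_mul, zero_sub, neg_eq_zero, mul_eq_zero, h2, false_or] at h
      simp [h, h1]
    · simp [h2]
  · refine ⟨w.1 / v.1, Prod.ext ?_ ?_⟩
    · simp [h1]
    · simp only [Prod.smul_snd, smul_eq_mul]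
      field_simp
      linear_combination h

/-- Green's identity for two spectral parameters. Setting them equal shows that the monodromy is
symplectic; differentiating at equality expresses its derivative through `pairing`. -/
lemma symp_monodromy_sub (lam μ : ℂ) (v w : ℂ × ℂ) :
    symp (monodromy hq lam v) (monodromy hq μ w) - symp v w =
      (lam - μ) * pairing (flow hq μ w) (flow hq lam v) := by
  obtain ⟨hy, hy0, hy1⟩ := solves_flow hq lam v
  obtain ⟨hz, hz0, hz1⟩ := solves_flow hq μ w
  have h := hy.green hz
  rw [hy0, hy1, hz0, hz1] at h
  rw [pairing_eq, ← intervalIntegral.integral_const_mul, monodromy_apply, monodromy_apply]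
  have e : ∀ s, (lam - μ) * (extend (flow hq μ w) s * extend (flow hq lam v) s) =
      -(extend (flow hq lam v) s * (μ • extend (flow hq μ w)) s -
        (lam • extend (flow hq lam v)) s * extend (flow hq μ w) s) := by
    intro s
    simp only [Pi.smul_apply, smul_eq_mul]
    ring
  simp only [e, intervalIntegral.integral_neg]
  rw [← h]
  simp only [symp]
  ring

lemma symp_monodromy (μ : ℂ) (v w : ℂ × ℂ) :
    symp (monodromy hq μ v) (monodromy hq μ w) = symp v w := by
  have := symp_monodromy_sub hq μ μ v w
  rwa [sub_self, zero_mul, sub_eq_zero] at this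

/-- The derivative of the monodromy operator with respect to the spectral parameter. -/
lemma symp_deriv_monodromy (μ : ℂ) (v w : ℂ × ℂ) :
    symp (deriv (fun lam => monodromy hq lam v) μ) (monodromy hq μ w) =
      pairing (flow hq μ w) (flow hq μ v) := by
  have hP : Differentiable ℂ fun lam => pairing (flow hq μ w) (flow hq lam v) := by
    have h1 : Differentiable ℂ fun lam => flow hq lam v :=
      (differentiable_flow hq).clm_apply (differentiable_const v)
    exact ((innerSL ℂ (toL2 (star (flow hq μ w)))).comp toL2).differentiable.comp h1
  have hM := ((differentiable_monodromy_apply hq v) μ).hasDerivAt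
  set M' := deriv (fun lam => monodromy hq lam v) μ
  have hM1 : HasDerivAt (fun lam => (monodromy hq lam v).1) M'.1 μ := hM.fst
  have hM2 : HasDerivAt (fun lam => (monodromy hq lam v).2) M'.2 μ := hM.snd
  have d1 : HasDerivAt (fun lam => symp (monodromy hq lam v) (monodromy hq μ w))
      (symp M' (monodromy hq μ w)) μ := (hM1.mul_const _).sub (hM2.mul_const _)
  have d2 : HasDerivAt (fun lam => symp (monodromy hq lam v) (monodromy hq μ w))
      (1 * pairing (flow hq μ w) (flow hq μ v) +
        (μ - μ) * deriv (fun lam => pairing (flow hq μ w) (flow hq lam v)) μ) μ := by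
    have := ((((hasDerivAt_id μ).sub_const μ).mul (hP μ).hasDerivAt)).const_add (symp v w)
    refine this.congr_of_eventuallyEq (Eventually.of_forall fun lam => ?_)
    simpa using sub_eq_iff_eq_add'.1 (symp_monodromy_sub hq lam μ v w)
  rw [d1.unique d2]
  ring

/-- The matrix form of the monodromy operator. -/
lemma monodromy_eq (μ : ℂ) (v : ℂ × ℂ) :
    monodromy hq μ v = v.1 • monodromy hq μ (1, 0) + v.2 • monodromy hq μ (0, 1) := by
  rw [← map_smul, ← map_smul, ← map_add]
  simp

lemma det_monodromy (μ : ℂ) :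
    (monodromy hq μ (1, 0)).1 * (monodromy hq μ (0, 1)).2 -
      (monodromy hq μ (1, 0)).2 * (monodromy hq μ (0, 1)).1 = 1 := by
  have := symp_monodromy hq μ (1, 0) (0, 1)
  simpa [symp] using this

/-- As the determinant is `1`, the characteristic equation is `e² - F e + 1 = 0`. An eigenvector is
`(b, e - a)` or `(e - d, c)`, unless both vanish and the matrix is `e` times the identity. -/
lemma exists_eigenvector_iff (μ : ℂ) {e : ℂ} (he : e ≠ 0) :
    (∃ v : ℂ × ℂ, v ≠ 0 ∧ monodromy hq μ v = e • v) ↔ discriminant q μ = e + e⁻¹ := by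
  have hdet := det_monodromy hq μ
  have hM := monodromy_eq hq μ
  rw [discriminant_eq hq]
  set a := (monodromy hq μ (1, 0)).1
  set b := (monodromy hq μ (0, 1)).1
  set c := (monodromy hq μ (1, 0)).2
  set d := (monodromy hq μ (0, 1)).2
  have hiff : ∀ v : ℂ × ℂ, monodromy hq μ v = e • v ↔
      v.1 * a + v.2 * b = e * v.1 ∧ v.1 * c + v.2 * d = e * v.2 := by
    intro v
    rw [hM v, Prod.ext_iff]
    rfl
  have hchar : a + d = e + e⁻¹ ↔ (a - e) * (d - e) = b * c := by
    constructor
    · intro h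
      have : e * (a + d) = e * e + 1 := by rw [h]; field_simp
      linear_combination hdet - this
    · intro h
      field_simp
      linear_combination hdet - h
  rw [hchar]
  constructor
  · rintro ⟨v, hv, hMv⟩
    obtain ⟨h1, h2⟩ := (hiff v).1 hMv
    by_contra hne
    have hne' : (a - e) * (d - e) - b * c ≠ 0 := sub_ne_zero.2 hne
    refine hv (Prod.ext ?_ ?_)
    · have : ((a - e) * (d - e) - b * c) * v.1 = 0 := by
        linear_combination (d - e) * h1 - b * h2
      exact (mul_eq_zero.1 this).resolve_left hne'
    · have : ((a - e) * (d - e) - b * c) * v.2 = 0 := by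
        linear_combination (a - e) * h2 - c * h1
      exact (mul_eq_zero.1 this).resolve_left hne'
  · intro h
    by_cases h1 : ((b, e - a) : ℂ × ℂ) = 0
    · rw [Prod.mk_eq_zero, sub_eq_zero] at h1
      obtain ⟨hb, ha⟩ := h1
      by_cases h2 : ((e - d, c) : ℂ × ℂ) = 0
      · rw [Prod.mk_eq_zero, sub_eq_zero] at h2
        refine ⟨(1, 0), by simp, (hiff _).2 ⟨?_, ?_⟩⟩
        · simp [ha]
        · simp [h2.2]
      · refine ⟨_, h2, (hiff _).2 ⟨?_, ?_⟩⟩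
        · simp only
          linear_combination -h
        · simp only
          ring
    · refine ⟨_, h1, (hiff _).2 ⟨?_, ?_⟩⟩
      · simp only
        ring
      · simp only
        linear_combination -h

/-- The embedding of the initial data into `L₂[0,1]` by the solutions. -/
noncomputable def flowL2 (μ : ℂ) : ℂ × ℂ →L[ℂ] L2 := toL2.comp (flow hq μ)

/-- Applying `1 - T` to a solution returns the affine function of its initial data, which determines
the data. -/
lemma flow_injective (μ : ℂ) : Function.Injective (flow hq μ) := by
  have e : ∀ u, affineFun u = flow hq μ u - cauchyOp hq μ (flow hq μ u) := fun u =>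
    (sub_eq_iff_eq_add.2 (cauchyInv_apply hq μ (affineFun u))).symm
  intro v w h
  have h1 : affineFun v = affineFun w := by rw [e v, e w, h]
  have h2 := congrArg (fun y : C01 => y ⟨0, le_rfl, zero_le_one⟩) h1
  have h3 := congrArg (fun y : C01 => y ⟨1, zero_le_one, le_rfl⟩) h1
  simp only [affineFun_apply, Complex.ofReal_zero, mul_zero, add_zero, Complex.ofReal_one,
    mul_one] at h2 h3
  exact Prod.ext h2 (by rwa [h2, add_right_inj] at h3)

lemma flowL2_injective (μ : ℂ) : Function.Injective (flowL2 hq μ) :=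
  toL2_injective.comp (flow_injective hq μ)

/-- The reduction of the spectral problem to `2 × 2` matrices: an element of the kernel has a
representative solving the equation, and that representative is fixed by its Cauchy data. -/
lemma mem_eigenspace_iff (t : ℝ) (μ : ℂ) (u : L2) :
    u ∈ eigenspace (graph q t) μ ↔
      ∃ v, monodromy hq μ v = Complex.exp (Complex.I * t) • v ∧ u = flowL2 hq μ v := by
  constructor
  · rintro ⟨y, dy, huy, hy, b1, b2⟩
    have hae : ((μ • u : L2) : ℝ → ℂ) =ᵐ[volume.restrict (Icc (0 : ℝ) 1)] μ • y :=
      (Lp.coeFn_smul μ u).trans (huy.const_smul μ)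
    have hs : Solves q (μ • y) y dy := hy.congr_right hae
    obtain ⟨e1, e2⟩ := hs.eq_flow hq
    refine ⟨(y 0, dy 0), ?_, ?_⟩
    · rw [monodromy_apply, ← e1 1 ⟨zero_le_one, le_rfl⟩, ← e2 1 ⟨zero_le_one, le_rfl⟩, b1, b2]
      rfl
    · refine toL2_eq_of_ae_eq (huy.trans ?_)
      filter_upwards [ae_restrict_mem measurableSet_Icc] with x hx using e1 x hx
  · rintro ⟨v, hv, rfl⟩
    obtain ⟨hs, h0, h1⟩ := solves_flow hq μ v
    rw [monodromy_apply, Prod.ext_iff] at hv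
    refine ⟨extend (flow hq μ v), extend (flowDeriv hq μ v), coeFn_toL2 _,
      hs.congr_right ?_, ?_, ?_⟩
    · exact ((Lp.coeFn_smul μ _).trans ((coeFn_toL2 _).const_smul μ)).symm
    · rw [h0]; exact hv.1
    · rw [h1]; exact hv.2

lemma exp_I_mul_add_inv (t : ℝ) :
    Complex.exp (Complex.I * t) + (Complex.exp (Complex.I * t))⁻¹ = 2 * (Real.cos t : ℂ) := by
  rw [← Complex.exp_neg, Complex.ofReal_cos, Complex.two_cos]
  congr 2 <;> ring

lemma isEigenvalue_iff (hq : IntegrableOn q (Icc 0 1)) (t : ℝ) (μ : ℂ) :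
    IsEigenvalue q t μ ↔ discriminant q μ = 2 * (Real.cos t : ℂ) := by
  rw [← exp_I_mul_add_inv, ← exists_eigenvector_iff hq μ (Complex.exp_ne_zero _), IsEigenvalue,
    Submodule.ne_bot_iff]
  constructor
  · rintro ⟨u, hu, hu0⟩
    obtain ⟨v, hv, rfl⟩ := (mem_eigenspace_iff hq t μ u).1 hu
    exact ⟨v, fun h => hu0 (by rw [h, map_zero]), hv⟩
  · rintro ⟨v, hv0, hv⟩
    refine ⟨_, (mem_eigenspace_iff hq t μ _).2 ⟨v, hv, rfl⟩, fun h => hv0 ?_⟩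
    exact flowL2_injective hq μ (h.trans (map_zero _).symm)

/-- For an eigenvalue, the geometric multiplicity is one unless the monodromy is scalar. -/
lemma geomMult_eq_one_iff {t : ℝ} {μ : ℂ} (h : IsEigenvalue q t μ) :
    geomMult q t μ = 1 ↔ ¬ ∀ v, monodromy hq μ v = Complex.exp (Complex.I * t) • v := by
  set K : Submodule ℂ (ℂ × ℂ) := LinearMap.eqLocus (monodromy hq μ : ℂ × ℂ →ₗ[ℂ] ℂ × ℂ)
    (Complex.exp (Complex.I * t) • LinearMap.id) with hK
  have hmem : ∀ v, v ∈ K ↔ monodromy hq μ v = Complex.exp (Complex.I * t) • v := fun v => Iff.rfl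
  have hE : eigenspace (graph q t) μ = K.map (flowL2 hq μ : ℂ × ℂ →ₗ[ℂ] L2) := by
    ext u
    rw [mem_eigenspace_iff hq, Submodule.mem_map]
    exact exists_congr fun v => and_congr Iff.rfl eq_comm
  have hfin : geomMult q t μ = Module.finrank ℂ K := by
    rw [geomMult, hE]
    exact (LinearEquiv.finrank_eq (Submodule.equivMapOfInjective _ (flowL2_injective hq μ) K)).symm
  have h2 : Module.finrank ℂ (ℂ × ℂ) = 2 := by simp
  rw [hfin]
  constructor
  · intro h1 hall
    have : K = ⊤ := eq_top_iff.2 fun v _ => (hmem v).2 (hall v)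
    rw [this, finrank_top, h2] at h1
    norm_num at h1
  · intro hnot
    have hlt : Module.finrank ℂ K < 2 := by
      rw [← h2]
      refine Submodule.finrank_lt fun htop => hnot fun v => (hmem v).1 ?_
      rw [htop]
      trivial
    have hne : Module.finrank ℂ K ≠ 0 := by
      intro h0
      rw [Submodule.finrank_eq_zero] at h0
      rw [h0, Submodule.map_bot] at hE
      exact h hE
    omega

end Hill

/-! ### Floquet pairs, the adjoint eigenfunction and the norm of the spectral projection. -/

namespace Hill

variable {q : ℝ → ℂ} (hq : IntegrableOn q (Icc 0 1))

/-- The Floquet data of a spectral parameter: `v` and `w` are eigenvectors of the monodromy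
operator with distinct multipliers `e^{it}` and `e^{-it}`. -/
structure IsFloquetPair (t : ℝ) (μ : ℂ) (v w : ℂ × ℂ) : Prop where
  left_ne : v ≠ 0
  right_ne : w ≠ 0
  left_eq : monodromy hq μ v = Complex.exp (Complex.I * t) • v
  right_eq : monodromy hq μ w = (Complex.exp (Complex.I * t))⁻¹ • w
  ne_inv : Complex.exp (Complex.I * t) ≠ (Complex.exp (Complex.I * t))⁻¹

lemma exp_sub_inv (t : ℝ) :
    Complex.exp (Complex.I * t) - (Complex.exp (Complex.I * t))⁻¹ =
      2 * Complex.I * (Real.sin t : ℂ) := by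
  have h := Complex.two_sin (t : ℂ)
  rw [show -(t : ℂ) * Complex.I = -(Complex.I * t) by ring, mul_comm (t : ℂ)] at h
  rw [← Complex.exp_neg, Complex.ofReal_sin]
  linear_combination (-Complex.I) * h - (Complex.exp (-(Complex.I * t)) -
    Complex.exp (Complex.I * t)) * Complex.I_mul_I

/-- The characteristic equation is invariant under `e ↦ e⁻¹`, and the two multipliers differ by `2i
sin t`. -/
lemma exists_isFloquetPair {t : ℝ} {μ : ℂ} (h : discriminant q μ = 2 * (Real.cos t : ℂ))
    (ht : Real.sin t ≠ 0) : ∃ v w, IsFloquetPair hq t μ v w := by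
  have he := Complex.exp_ne_zero (Complex.I * t)
  rw [← exp_I_mul_add_inv] at h
  obtain ⟨v, hv0, hv⟩ := (exists_eigenvector_iff hq μ he).2 h
  obtain ⟨w, hw0, hw⟩ := (exists_eigenvector_iff hq μ (inv_ne_zero he)).2
    (by rw [h, inv_inv, add_comm])
  refine ⟨v, w, hv0, hw0, hv, hw, ?_⟩
  rw [← sub_ne_zero, exp_sub_inv]
  exact mul_ne_zero (by simp) (Complex.ofReal_ne_zero.2 ht)

variable {hq}

namespace IsFloquetPair

variable {t : ℝ} {μ : ℂ} {v w : ℂ × ℂ}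

/-- If `v'` has the same multiplier `e` as `v`, invariance of `symp` gives `e² symp v v' = symp v
v'`. Since `e² ≠ 1`, `v'` is a multiple of `v`. -/
lemma eigenspace_eq (h : IsFloquetPair hq t μ v w) :
    eigenspace (graph q t) μ = Submodule.span ℂ {flowL2 hq μ v} := by
  have he := Complex.exp_ne_zero (Complex.I * t)
  ext u
  rw [mem_eigenspace_iff hq, Submodule.mem_span_singleton]
  constructor
  · rintro ⟨v', hv', rfl⟩
    have hs := symp_monodromy hq μ v v'
    rw [h.left_eq, hv'] at hs
    have h0 : symp v v' = 0 := by
      have h1 : (Complex.exp (Complex.I * t) - (Complex.exp (Complex.I * t))⁻¹) *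
          symp v v' = 0 := by
        simp only [symp, Prod.smul_fst, Prod.smul_snd, smul_eq_mul] at hs ⊢
        field_simp
        linear_combination hs
      exact (mul_eq_zero.1 h1).resolve_left (sub_ne_zero.2 h.ne_inv)
    obtain ⟨c, rfl⟩ := exists_smul_of_symp_eq_zero h.left_ne h0
    exact ⟨c, (map_smul _ _ _).symm⟩
  · rintro ⟨c, rfl⟩
    refine ⟨c • v, ?_, (map_smul _ _ _).symm⟩
    rw [map_smul, h.left_eq, smul_comm]

/-- The range of `H_t - μ` is the annihilator of the solution with the multiplier `e^{-it}`. -/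
lemma mem_rangeSub_iff (h : IsFloquetPair hq t μ v w) (f : L2) :
    f ∈ rangeSub (graph q t) μ ↔ inner ℂ (toL2 (star (flow hq μ w))) f = 0 := by
  have he := Complex.exp_ne_zero (Complex.I * t)
  obtain ⟨hz, hz0, hz1⟩ := solves_flow hq μ w
  have hw := h.right_eq
  rw [monodromy_apply, Prod.ext_iff] at hw
  obtain ⟨hw1, hw2⟩ := hw
  simp only [Prod.smul_fst, Prod.smul_snd, smul_eq_mul] at hw1 hw2
  set z := extend (flow hq μ w) with hzdef
  set dz := extend (flowDeriv hq μ w)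
  set e := Complex.exp (Complex.I * t) with hedef
  have green : ∀ y dy : ℝ → ℂ, Solves q ((f : ℝ → ℂ) + μ • y) y dy →
      (dy 1 * z 1 - y 1 * dz 1) - (dy 0 * z 0 - y 0 * dz 0) =
        -inner ℂ (toL2 (star (flow hq μ w))) f := by
    intro y dy hy
    rw [hy.green hz, inner_toL2_star, ← intervalIntegral.integral_neg]
    congr 1
    funext s
    simp only [Pi.add_apply, Pi.smul_apply, smul_eq_mul, ← hzdef]
    ring
  constructor
  · rintro ⟨⟨u, g⟩, ⟨y, dy, huy, hy, b1, b2⟩, hfg⟩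
    have hfg' : f = g - μ • u := hfg.symm
    have hg : g = f + μ • u := by rw [hfg', sub_add_cancel]
    have hae : (g : ℝ → ℂ) =ᵐ[volume.restrict (Icc (0 : ℝ) 1)] (f : ℝ → ℂ) + μ • y := by
      rw [hg]
      exact (Lp.coeFn_add _ _).trans
        ((EventuallyEq.refl _ _).add ((Lp.coeFn_smul μ u).trans (huy.const_smul μ)))
    have hG := green y dy (hy.congr_right hae)
    rw [b1, b2, hw1, hw2, hz0, hz1] at hG
    have : -inner ℂ (toL2 (star (flow hq μ w))) f = 0 := by
      rw [← hG]
      field_simp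
      ring
    exact neg_eq_zero.1 this
  · intro hf
    -- Start from the solution with zero Cauchy data. Orthogonality and Green's identity force its
    -- data at `1` to be `κ w`. Adding `c z` restores the boundary conditions when `κ + c e⁻¹ = e
    -- c`, whence the choice of `c`.
    obtain ⟨y, dy, hy, hy0, hdy0⟩ := exists_solves hq μ (integrableOn_coeFn f) (0, 0)
    have hG := green y dy hy
    rw [hf, hy0, hdy0, hw1, hw2] at hG
    have hsymp : symp w (y 1, dy 1) = 0 := by
      have h1 : e⁻¹ * symp w (y 1, dy 1) = 0 := by
        simp only [symp]
        linear_combination hG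
      exact (mul_eq_zero.1 h1).resolve_left (inv_ne_zero he)
    obtain ⟨κ, hκ⟩ := exists_smul_of_symp_eq_zero h.right_ne hsymp
    rw [Prod.ext_iff] at hκ
    obtain ⟨hκ1, hκ2⟩ := hκ
    simp only [Prod.smul_fst, Prod.smul_snd, smul_eq_mul] at hκ1 hκ2
    have hne : e - e⁻¹ ≠ 0 := sub_ne_zero.2 h.ne_inv
    set c := κ / (e - e⁻¹) with hc
    have hce : κ + c * e⁻¹ = e * c := by
      have : κ = c * (e - e⁻¹) := (div_mul_cancel₀ _ hne).symm
      linear_combination this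
    have hY := hy.add (hz.smul c)
    have hYmem : MemLp (y + c • z) 2 (volume.restrict (Icc (0 : ℝ) 1)) := by
      obtain ⟨B, hB⟩ := isCompact_Icc.exists_bound_of_continuousOn hY.cont
      refine MemLp.of_bound (hY.cont.aestronglyMeasurable measurableSet_Icc) B ?_
      filter_upwards [ae_restrict_mem measurableSet_Icc] with x hx using hB x hx
    set u : L2 := hYmem.toLp with hu
    have huy : (u : ℝ → ℂ) =ᵐ[volume.restrict (Icc (0 : ℝ) 1)] y + c • z := hYmem.coeFn_toLp
    refine ⟨(u, f + μ • u), ⟨y + c • z, dy + c • dz, huy, hY.congr_right ?_, ?_, ?_⟩, ?_⟩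
    · have h2 : ((f + μ • u : L2) : ℝ → ℂ) =ᵐ[volume.restrict (Icc (0 : ℝ) 1)]
          (f : ℝ → ℂ) + μ • (y + c • z) :=
        (Lp.coeFn_add _ _).trans
          ((EventuallyEq.refl _ _).add ((Lp.coeFn_smul μ u).trans (huy.const_smul μ)))
      refine (h2.trans (EventuallyEq.of_eq ?_)).symm
      funext s
      simp only [Pi.add_apply, Pi.smul_apply, smul_eq_mul]
      ring
    · simp only [Pi.add_apply, Pi.smul_apply, smul_eq_mul]
      rw [hκ1, hw1, hy0, hz0, ← hedef]
      linear_combination w.1 * hce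
    · simp only [Pi.add_apply, Pi.smul_apply, smul_eq_mul]
      rw [hκ2, hw2, hdy0, hz1, ← hedef]
      linear_combination w.2 * hce
    · change f + μ • u - μ • u = f
      rw [add_sub_cancel_right]

lemma flowL2_ne_zero {v : ℂ × ℂ} (hv : v ≠ 0) : flowL2 hq μ v ≠ 0 := fun h0 =>
  hv (flowL2_injective hq μ (h0.trans (map_zero _).symm))

/-- The kernel of the adjoint minus `conj μ` is the orthogonal complement of the range of `H_t - μ`.
That range is itself the complement of a line, and a line is its own double complement. -/
lemma adjoint_eigenspace_eq (h : IsFloquetPair hq t μ v w) :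
    eigenspace (graph q t).adjoint (starRingEnd ℂ μ) =
      Submodule.span ℂ {toL2 (star (flow hq μ w))} := by
  have h1 : eigenspace (graph q t).adjoint (starRingEnd ℂ μ) = (rangeSub (graph q t) μ)ᗮ := by
    ext u
    have e1 : u ∈ eigenspace (graph q t).adjoint (starRingEnd ℂ μ) ↔
        ((u, starRingEnd ℂ μ • u) : L2 × L2) ∈ (graph q t).adjoint := Iff.rfl
    rw [e1, Submodule.mem_adjoint_iff, Submodule.mem_orthogonal]
    have e2 : ∀ a b : L2, inner ℂ b u - inner ℂ a (starRingEnd ℂ μ • u) =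
        inner ℂ (b - μ • a) u := fun a b => by
      rw [inner_smul_right, inner_sub_left, inner_smul_left]
    simp only [e2]
    constructor
    · rintro H _ ⟨⟨a, b⟩, hab, rfl⟩
      exact H a b hab
    · intro H a b hab
      exact H _ ⟨(a, b), hab, rfl⟩
  have h2 : rangeSub (graph q t) μ = (Submodule.span ℂ {toL2 (star (flow hq μ w))})ᗮ := by
    ext f
    rw [h.mem_rangeSub_iff, Submodule.mem_orthogonal_singleton_iff_inner_right]
  rw [h1, h2, Submodule.orthogonal_orthogonal]

end IsFloquetPair

/-- The spectral projection is given by the normalized biorthogonal eigenfunctions. -/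
lemma IsSpectralProjection.norm_le {t : ℝ} {μ : ℂ} {v w : ℂ × ℂ} (h : IsFloquetPair hq t μ v w)
    {P : L2 →L[ℂ] L2} (hP : IsSpectralProjection q t μ P)
    (hne : pairing (flow hq μ w) (flow hq μ v) ≠ 0) :
    ‖P‖ ≤ ‖toL2 (star (flow hq μ w))‖ * ‖flowL2 hq μ v‖ /
      ‖pairing (flow hq μ w) (flow hq μ v)‖ := by
  set ψ := flowL2 hq μ v with hψ
  set ψs := toL2 (star (flow hq μ w)) with hψs
  set α := pairing (flow hq μ w) (flow hq μ v) with hα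
  have hαe : inner ℂ ψs ψ = α := rfl
  have hPψ : P ψ = ψ := by
    have : ψ ∈ LinearMap.range (P : L2 →ₗ[ℂ] L2) := by
      rw [hP.range_eq, h.eigenspace_eq]
      exact Submodule.mem_span_singleton_self _
    obtain ⟨x, hx⟩ := this
    have hx' : P x = ψ := hx
    rw [← hx']
    exact congrArg (fun A : L2 →L[ℂ] L2 => A x) hP.idem
  have hform : ∀ f, P f = (inner ℂ ψs f / α) • ψ := by
    intro f
    have hk : f - (inner ℂ ψs f / α) • ψ ∈ LinearMap.ker (P : L2 →ₗ[ℂ] L2) := by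
      rw [hP.ker_eq, h.mem_rangeSub_iff, inner_sub_right, inner_smul_right, hαe]
      field_simp
      ring
    have hk' : P (f - (inner ℂ ψs f / α) • ψ) = 0 := hk
    rw [map_sub, map_smul, hPψ, sub_eq_zero] at hk'
    exact hk'
  refine ContinuousLinearMap.opNorm_le_bound _ (by positivity) fun f => ?_
  rw [hform, norm_smul, norm_div]
  calc ‖inner ℂ ψs f‖ / ‖α‖ * ‖ψ‖ ≤ (‖ψs‖ * ‖f‖) / ‖α‖ * ‖ψ‖ := by
        gcongr
        exact norm_inner_le_norm _ _
    _ = _ := by ring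

/-- The projection is the rank-one operator `f ↦ α⁻¹ ⟨ψs, f⟩ ψ`, and evaluating it at `ψs` gives the
lower bound, so the estimate of `IsSpectralProjection.norm_le` is sharp. -/
lemma exists_isSpectralProjection {t : ℝ} {μ : ℂ} {v w : ℂ × ℂ} (h : IsFloquetPair hq t μ v w)
    (hne : pairing (flow hq μ w) (flow hq μ v) ≠ 0) :
    ∃ P, IsSpectralProjection q t μ P ∧ ‖toL2 (star (flow hq μ w))‖ * ‖flowL2 hq μ v‖ /
      ‖pairing (flow hq μ w) (flow hq μ v)‖ ≤ ‖P‖ := by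
  set ψ := flowL2 hq μ v with hψ
  set ψs := toL2 (star (flow hq μ w)) with hψs
  set α := pairing (flow hq μ w) (flow hq μ v) with hα
  have hαe : inner ℂ ψs ψ = α := rfl
  have hψ0 : ψ ≠ 0 := IsFloquetPair.flowL2_ne_zero h.left_ne
  set P : L2 →L[ℂ] L2 := (α⁻¹ • innerSL ℂ ψs).smulRight ψ with hPdef
  have hform : ∀ f, P f = (α⁻¹ * inner ℂ ψs f) • ψ := fun f => rfl
  have hPψ : P ψ = ψ := by
    rw [hform, hαe, inv_mul_cancel₀ hne, one_smul]
  refine ⟨P, ⟨?_, ?_, ?_⟩, ?_⟩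
  · change P.comp P = P
    ext1 f
    rw [ContinuousLinearMap.comp_apply, hform f, map_smul, hPψ]
  · rw [h.eigenspace_eq]
    ext u
    rw [Submodule.mem_span_singleton]
    constructor
    · rintro ⟨f, rfl⟩
      exact ⟨_, (hform f).symm⟩
    · rintro ⟨c, rfl⟩
      exact ⟨c • ψ, by change P (c • ψ) = _; rw [map_smul, hPψ]⟩
  · ext f
    rw [h.mem_rangeSub_iff, LinearMap.mem_ker]
    change P f = 0 ↔ _
    rw [hform, smul_eq_zero_iff_left hψ0, mul_eq_zero_iff_left (inv_ne_zero hne)]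
  · have hψs0 : 0 < ‖ψs‖ := by
      rw [norm_pos_iff]
      intro h0
      rw [h0, inner_zero_left] at hαe
      exact hne hαe.symm
    have := P.le_opNorm ψs
    rw [hform, norm_smul, norm_mul, norm_inv, inner_self_eq_norm_sq_to_K] at this
    simp only [norm_pow, Complex.coe_algebraMap, Complex.norm_real, norm_norm] at this
    rw [← mul_le_mul_iff_left₀ hψs0]
    refine le_trans (le_of_eq ?_) this
    ring

end Hill

/-! ### Local analysis of an analytic function at a double point. -/

namespace Hill

section Local

lemma exists_norm_bounds {h : ℂ → ℂ} {z₀ : ℂ} (hc : ContinuousAt h z₀) (h0 : h z₀ ≠ 0) :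
    ∃ a > 0, ∃ A > 0, ∀ᶠ z in 𝓝 z₀, a ≤ ‖h z‖ ∧ ‖h z‖ ≤ A := by
  have hp : 0 < ‖h z₀‖ := norm_pos_iff.2 h0
  refine ⟨‖h z₀‖ / 2, by positivity, ‖h z₀‖ + 1, by positivity, ?_⟩
  have h1 := hc.norm.eventually (lt_mem_nhds (half_lt_self hp))
  have h2 := hc.norm.eventually (gt_mem_nhds (lt_add_one ‖h z₀‖))
  filter_upwards [h1, h2] with z hz1 hz2 using ⟨hz1.le, hz2.le⟩

/-- The size of `f'` and of `4 - f²` at a double point of `f = 2σ`, `σ = ±1`. -/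
lemma exists_bounds_of_order_two {f : ℂ → ℂ} {z₀ σ : ℂ} (hf : AnalyticAt ℂ f z₀) (hσ : σ ^ 2 = 1)
    (ho : analyticOrderAt (fun z => f z - 2 * σ) z₀ = 2) :
    ∃ c > 0, ∃ C > 0, ∀ᶠ z in 𝓝 z₀,
      (c * ‖z - z₀‖ ≤ ‖deriv f z‖ ∧ ‖deriv f z‖ ≤ C * ‖z - z₀‖) ∧
      (c * ‖z - z₀‖) ^ 2 ≤ ‖4 - f z ^ 2‖ ∧ ‖4 - f z ^ 2‖ ≤ (C * ‖z - z₀‖) ^ 2 := by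
  have hfa : AnalyticAt ℂ (fun z => f z - 2 * σ) z₀ := hf.sub analyticAt_const
  obtain ⟨g, hg, hg0, hfg⟩ := (hfa.analyticOrderAt_eq_natCast (n := 2)).1 ho
  have hfg' : f =ᶠ[𝓝 z₀] fun z => 2 * σ + (z - z₀) ^ 2 * g z := by
    filter_upwards [hfg] with z hz
    rw [smul_eq_mul] at hz
    linear_combination hz
  have hd : deriv f =ᶠ[𝓝 z₀] fun z => (z - z₀) * (2 * g z + (z - z₀) * deriv g z) := by
    filter_upwards [hfg'.deriv, hg.eventually_analyticAt] with z hz hgz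
    rw [hz]
    have h1 : HasDerivAt (fun z => (z - z₀) ^ 2) (2 * (z - z₀)) z := by
      simpa using ((hasDerivAt_id' z).sub_const z₀).fun_pow 2
    refine ((h1.mul hgz.differentiableAt.hasDerivAt).const_add (2 * σ)).deriv.trans ?_
    ring
  have hσ0 : σ ≠ 0 := by rintro rfl; norm_num at hσ
  have hgc := hg.continuousAt
  have hgc' := hg.deriv.continuousAt
  -- The cofactors of `z - z₀` in `f'` and, up to sign, of `(z - z₀)²` in `4 - f²`. Both are nonzero
  -- at `z₀`, hence bounded above and below nearby.
  obtain ⟨a, ha, A, hA, h1⟩ := exists_norm_bounds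
    (h := fun z => 2 * g z + (z - z₀) * deriv g z) (z₀ := z₀) (by fun_prop) (by simpa using hg0)
  obtain ⟨b, hb, B, hB, h2⟩ := exists_norm_bounds
    (h := fun z => 4 * σ * g z + (z - z₀) ^ 2 * g z ^ 2) (z₀ := z₀) (by fun_prop)
    (by simpa using ⟨hσ0, hg0⟩)
  refine ⟨min a (Real.sqrt b), lt_min ha (Real.sqrt_pos.2 hb), max A (Real.sqrt B),
    lt_max_of_lt_left hA, ?_⟩
  filter_upwards [hfg', hd, h1, h2] with z hz hdz h1z h2z
  have hbs : min a (Real.sqrt b) ^ 2 ≤ b := by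
    calc min a (Real.sqrt b) ^ 2 ≤ Real.sqrt b ^ 2 :=
          pow_le_pow_left₀ (le_min ha.le (Real.sqrt_nonneg _)) (min_le_right _ _) 2
      _ = b := Real.sq_sqrt hb.le
  have hBs : B ≤ max A (Real.sqrt B) ^ 2 := by
    calc B = Real.sqrt B ^ 2 := (Real.sq_sqrt hB.le).symm
      _ ≤ _ := pow_le_pow_left₀ (Real.sqrt_nonneg _) (le_max_right _ _) 2
  have e : 4 - f z ^ 2 = -((z - z₀) ^ 2 * (4 * σ * g z + (z - z₀) ^ 2 * g z ^ 2)) := by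
    rw [hz]
    linear_combination -4 * hσ
  rw [hdz, e, norm_neg, norm_mul, norm_mul, norm_pow, mul_pow, mul_pow]
  refine ⟨⟨?_, ?_⟩, ?_, ?_⟩
  · rw [mul_comm]
    exact mul_le_mul_of_nonneg_left ((min_le_left _ _).trans h1z.1) (norm_nonneg _)
  · rw [mul_comm]
    exact mul_le_mul_of_nonneg_right (h1z.2.trans (le_max_left _ _)) (norm_nonneg _)
  · rw [mul_comm]
    exact mul_le_mul_of_nonneg_left (hbs.trans h2z.1) (by positivity)
  · rw [mul_comm]
    exact mul_le_mul_of_nonneg_right (h2z.2.trans hBs) (by positivity)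

/-- The solutions of `f(z) - f(z₀) = ζ²` near a double point `z₀` depend on `ζ` in a Lipschitz
way. -/
lemma exists_sqrt_branch {f : ℂ → ℂ} {z₀ c : ℂ} (hf : AnalyticAt ℂ f z₀)
    (ho : analyticOrderAt (fun z => f z - c) z₀ = 2) :
    ∃ ρ : ℂ → ℂ, ρ 0 = z₀ ∧ ∃ K : NNReal, ∃ s ∈ 𝓝 (0 : ℂ), LipschitzOnWith K ρ s ∧
      ∀ ζ ∈ s, f (ρ ζ) = c + ζ ^ 2 := by
  have hfa : AnalyticAt ℂ (fun z => f z - c) z₀ := hf.sub analyticAt_const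
  obtain ⟨g, hg, hg0, hfg⟩ := (hfa.analyticOrderAt_eq_natCast (n := 2)).1 ho
  obtain ⟨κ, hκ⟩ := IsAlgClosed.exists_pow_nat_eq (g z₀) (n := 2) two_pos
  have hκ0 : κ ≠ 0 := by
    rintro rfl
    exact hg0 (by simpa using hκ.symm)
  -- An analytic square root of `g` near `z₀`: the quotient `g z / g z₀` is near `1`, away from the
  -- cut of the logarithm. Then `W = (z - z₀) r` is a local coordinate with `f - c = W²`, and `ρ` is
  -- its inverse.
  set r : ℂ → ℂ := fun z => κ * Complex.exp (Complex.log (g z / g z₀) / 2) with hr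
  have hra : AnalyticAt ℂ r z₀ := by
    have h1 : AnalyticAt ℂ (fun z => g z / g z₀) z₀ := hg.div_const
    have h2 : AnalyticAt ℂ (fun z => Complex.log (g z / g z₀)) z₀ :=
      h1.clog (by simp [div_self hg0])
    exact analyticAt_const.mul (h2.div_const).cexp
  have hr2 : ∀ᶠ z in 𝓝 z₀, r z ^ 2 = g z := by
    filter_upwards [hg.continuousAt.eventually_ne hg0] with z hz
    rw [hr]
    simp only
    rw [mul_pow, hκ, ← Complex.exp_nat_mul]
    rw [show ((2 : ℕ) : ℂ) * (Complex.log (g z / g z₀) / 2) = Complex.log (g z / g z₀) by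
      push_cast; ring, Complex.exp_log (div_ne_zero hz hg0)]
    field_simp
  have hr0 : r z₀ = κ := by simp [hr, div_self hg0]
  set W : ℂ → ℂ := fun z => (z - z₀) * r z with hW
  have hWa : AnalyticAt ℂ W z₀ := (analyticAt_id.sub analyticAt_const).mul hra
  have hW0 : W z₀ = 0 := by simp [hW]
  have hWd : deriv W z₀ = κ := by
    have := ((hasDerivAt_id z₀).sub_const z₀).mul hra.differentiableAt.hasDerivAt
    have h2 := this.deriv
    simp only [id, sub_self, zero_mul, add_zero, one_mul, hr0] at h2
    exact h2
  have hst : HasStrictDerivAt W κ z₀ := hWd ▸ hWa.hasStrictDerivAt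
  set ρ := hst.localInverse W κ z₀ hκ0 with hρ
  have hρs : HasStrictDerivAt ρ κ⁻¹ 0 := hW0 ▸ hst.to_localInverse hκ0
  have hρ0 : ρ 0 = z₀ := by
    have := (hst.eventually_left_inverse hκ0).self_of_nhds
    rwa [hW0] at this
  have hright : ∀ᶠ ζ in 𝓝 (0 : ℂ), W (ρ ζ) = ζ := hW0 ▸ hst.eventually_right_inverse hκ0
  have htend : Tendsto ρ (𝓝 0) (𝓝 z₀) := by
    have := hρs.hasDerivAt.continuousAt.tendsto
    rwa [hρ0] at this
  obtain ⟨K, s, hs, hL⟩ := hρs.hasStrictFDerivAt.exists_lipschitzOnWith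
  have hev : ∀ᶠ ζ in 𝓝 (0 : ℂ), f (ρ ζ) = c + ζ ^ 2 := by
    filter_upwards [hright, htend.eventually hr2, htend.eventually hfg] with ζ h1 h2 h3
    have h1' : (ρ ζ - z₀) * r (ρ ζ) = ζ := h1
    rw [smul_eq_mul, ← h2, ← mul_pow, h1'] at h3
    linear_combination h3
  exact ⟨ρ, hρ0, K, s ∩ {ζ | f (ρ ζ) = c + ζ ^ 2}, inter_mem hs hev,
    hL.mono inter_subset_left, fun ζ hζ => hζ.2⟩

end Local

end Hill

/-! ### Near a double eigenvalue: the pairing against the angle of the Floquet vectors. -/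

namespace Hill

variable {q : ℝ → ℂ} {hq : IntegrableOn q (Icc 0 1)}

lemma pairing_comm (z y : C01) : pairing z y = pairing y z := by
  rw [pairing_eq, pairing_eq]
  simp only [mul_comm]

lemma deriv_monodromy_eq (hq : IntegrableOn q (Icc 0 1)) (μ : ℂ) (v : ℂ × ℂ) :
    deriv (fun lam => monodromy hq lam v) μ =
      v.1 • deriv (fun lam => monodromy hq lam (1, 0)) μ +
        v.2 • deriv (fun lam => monodromy hq lam (0, 1)) μ := by
  have h1 := ((differentiable_monodromy_apply hq (1, 0)) μ).hasDerivAt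
  have h2 := ((differentiable_monodromy_apply hq (0, 1)) μ).hasDerivAt
  have h3 := (h1.const_smul v.1).add (h2.const_smul v.2)
  rw [← h3.deriv]
  congr 1
  funext lam
  exact monodromy_eq hq lam v

lemma deriv_discriminant_eq (hq : IntegrableOn q (Icc 0 1)) (μ : ℂ) :
    deriv (discriminant q) μ = (deriv (fun lam => monodromy hq lam (1, 0)) μ).1 +
      (deriv (fun lam => monodromy hq lam (0, 1)) μ).2 := by
  have h1 := ((differentiable_monodromy_apply hq (1, 0)) μ).hasDerivAt
  have h2 := ((differentiable_monodromy_apply hq (0, 1)) μ).hasDerivAt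
  rw [show discriminant q = fun μ => (monodromy hq μ (1, 0)).1 + (monodromy hq μ (0, 1)).2 from
    funext (discriminant_eq hq)]
  have d1 : HasDerivAt (fun lam => (monodromy hq lam (1, 0)).1) _ μ := h1.fst
  have d2 : HasDerivAt (fun lam => (monodromy hq lam (0, 1)).2) _ μ := h2.snd
  exact (d1.add d2).deriv

lemma IsFloquetPair.discriminant_eq {t : ℝ} {μ : ℂ} {v w : ℂ × ℂ}
    (h : IsFloquetPair hq t μ v w) : discriminant q μ = 2 * (Real.cos t : ℂ) := by
  rw [← exp_I_mul_add_inv, ← exists_eigenvector_iff hq μ (Complex.exp_ne_zero _)]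
  exact ⟨v, h.left_ne, h.left_eq⟩

/-- The pairing of the two Floquet solutions in terms of the derivative of the discriminant. -/
lemma IsFloquetPair.deriv_discriminant_mul_symp {t : ℝ} {μ : ℂ} {v w : ℂ × ℂ}
    (h : IsFloquetPair hq t μ v w) :
    deriv (discriminant q) μ * symp v w =
      2 * Complex.I * (Real.sin t : ℂ) * pairing (flow hq μ w) (flow hq μ v) := by
  have he := Complex.exp_ne_zero (Complex.I * t)
  have h1 := symp_deriv_monodromy hq μ v w
  have h2 := symp_deriv_monodromy hq μ w v
  rw [pairing_comm, h.left_eq] at h2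
  rw [h.right_eq] at h1
  rw [← exp_sub_inv, deriv_discriminant_eq hq]
  rw [deriv_monodromy_eq hq μ v] at h1
  rw [deriv_monodromy_eq hq μ w] at h2
  set A := deriv (fun lam => monodromy hq lam (1, 0)) μ
  set B := deriv (fun lam => monodromy hq lam (0, 1)) μ
  set p := pairing (flow hq μ w) (flow hq μ v)
  set e := Complex.exp (Complex.I * t)
  simp only [symp, Prod.smul_fst, Prod.smul_snd, Prod.fst_add, Prod.snd_add, smul_eq_mul] at h1 h2 ⊢
  have h1' : (v.1 * A.1 + v.2 * B.1) * w.2 - (v.1 * A.2 + v.2 * B.2) * w.1 = e * p := by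
    rw [← h1]
    field_simp
  have h2' : (w.1 * A.1 + w.2 * B.1) * v.2 - (w.1 * A.2 + w.2 * B.2) * v.1 = e⁻¹ * p := by
    rw [← h2]
    field_simp
  -- The trace identity `tr A · symp v w = symp (A v) w - symp (A w) v`, for `A` the derivative of
  -- the monodromy.
  linear_combination h1' - h2'

lemma norm_toL2_star (y : C01) : ‖toL2 (star y)‖ = ‖toL2 y‖ := by
  rw [Lp.norm_def, Lp.norm_def]
  congr 1
  refine eLpNorm_congr_norm_ae ?_
  filter_upwards [coeFn_toL2 (star y), coeFn_toL2 y] with s h1 h2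
  rw [h1, h2, extend_star, RCLike.norm_conj]

/-- An injective map on a finite-dimensional space is bounded below, and half of the bound survives
a small perturbation. Normalizing initial vectors is thus equivalent, up to constants, to
normalizing eigenfunctions. -/
lemma exists_flowL2_bounds (hq : IntegrableOn q (Icc 0 1)) (lam₀ : ℂ) :
    ∃ c > 0, ∃ C > 0, ∀ᶠ μ in 𝓝 lam₀, ∀ v : ℂ × ℂ,
      c * ‖v‖ ≤ ‖flowL2 hq μ v‖ ∧ ‖flowL2 hq μ v‖ ≤ C * ‖v‖ := by
  obtain ⟨K, hK, hanti⟩ := LinearMap.exists_antilipschitzWith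
    (flowL2 hq lam₀ : ℂ × ℂ →ₗ[ℂ] L2) (LinearMap.ker_eq_bot.2 (flowL2_injective hq lam₀))
  have hK' : (0 : ℝ) < K := hK
  have hlow : ∀ v : ℂ × ℂ, (K : ℝ)⁻¹ * ‖v‖ ≤ ‖flowL2 hq lam₀ v‖ := by
    intro v
    rw [inv_mul_le_iff₀ hK']
    exact ZeroHomClass.bound_of_antilipschitz _ hanti v
  have hcont : ContinuousAt (fun μ => flowL2 hq μ) lam₀ := by
    have : Differentiable ℂ fun μ => flowL2 hq μ :=
      (differentiable_const toL2).clm_comp (differentiable_flow hq)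
    exact this.continuous.continuousAt
  have hev : ∀ᶠ μ in 𝓝 lam₀, ‖flowL2 hq μ - flowL2 hq lam₀‖ < (K : ℝ)⁻¹ / 2 := by
    have := Metric.tendsto_nhds.1 hcont.tendsto ((K : ℝ)⁻¹ / 2) (by positivity)
    simpa only [dist_eq_norm] using this
  refine ⟨(K : ℝ)⁻¹ / 2, by positivity, ‖flowL2 hq lam₀‖ + (K : ℝ)⁻¹ / 2, by positivity, ?_⟩
  filter_upwards [hev] with μ hμ v
  have h1 : ‖flowL2 hq μ v - flowL2 hq lam₀ v‖ ≤ (K : ℝ)⁻¹ / 2 * ‖v‖ :=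
    ((flowL2 hq μ - flowL2 hq lam₀).le_opNorm v).trans
      (mul_le_mul_of_nonneg_right hμ.le (norm_nonneg _))
  have h2 := (flowL2 hq lam₀).le_opNorm v
  have h3 := norm_sub_norm_le (flowL2 hq lam₀ v) (flowL2 hq μ v)
  rw [norm_sub_rev] at h3
  have h4 := norm_sub_norm_le (flowL2 hq μ v) (flowL2 hq lam₀ v)
  have h5 := hlow v
  constructor <;> nlinarith

lemma IsFloquetPair.smul {t : ℝ} {μ : ℂ} {v w : ℂ × ℂ} (h : IsFloquetPair hq t μ v w) {a b : ℂ}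
    (ha : a ≠ 0) (hb : b ≠ 0) : IsFloquetPair hq t μ (a • v) (b • w) :=
  ⟨smul_ne_zero ha h.left_ne, smul_ne_zero hb h.right_ne,
    by rw [map_smul, h.left_eq, smul_comm], by rw [map_smul, h.right_eq, smul_comm], h.ne_inv⟩

lemma exists_isFloquetPair_norm_eq_one (hq : IntegrableOn q (Icc 0 1)) {t : ℝ} {μ : ℂ}
    (h : discriminant q μ = 2 * (Real.cos t : ℂ)) (ht : Real.sin t ≠ 0) :
    ∃ v w, IsFloquetPair hq t μ v w ∧ ‖v‖ = 1 ∧ ‖w‖ = 1 := by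
  obtain ⟨v, w, hvw⟩ := exists_isFloquetPair hq h ht
  have hv : ‖v‖ ≠ 0 := norm_ne_zero_iff.2 hvw.left_ne
  have hw : ‖w‖ ≠ 0 := norm_ne_zero_iff.2 hvw.right_ne
  refine ⟨_, _, hvw.smul (a := ((‖v‖⁻¹ : ℝ) : ℂ)) (b := ((‖w‖⁻¹ : ℝ) : ℂ)) ?_ ?_, ?_, ?_⟩
  · simpa using hvw.left_ne
  · simpa using hvw.right_ne
  · rw [norm_smul, Complex.norm_real, norm_inv, norm_norm, inv_mul_cancel₀ hv]
  · rw [norm_smul, Complex.norm_real, norm_inv, norm_norm, inv_mul_cancel₀ hw]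

section DoublePoint

variable {t₀ : ℝ} {lam₀ : ℂ}

lemma cos_sq_eq_one (ht₀ : t₀ = 0 ∨ t₀ = Real.pi) : (Real.cos t₀ : ℂ) ^ 2 = 1 := by
  rcases ht₀ with rfl | rfl <;> simp

lemma exp_eq_cos (ht₀ : t₀ = 0 ∨ t₀ = Real.pi) :
    Complex.exp (Complex.I * t₀) = (Real.cos t₀ : ℂ) := by
  rcases ht₀ with rfl | rfl
  · simp
  · rw [mul_comm, Complex.exp_pi_mul_I]; simp

/-- Near a double point, `|F'|` and `2 |sin t|` have the size of the distance to it. -/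
lemma exists_discriminant_bounds (hq : IntegrableOn q (Icc 0 1)) (ht₀ : t₀ = 0 ∨ t₀ = Real.pi)
    (ho : algMult q t₀ lam₀ = 2) :
    ∃ c > 0, ∃ C > 0, ∀ᶠ μ in 𝓝 lam₀,
      (c * ‖μ - lam₀‖ ≤ ‖deriv (discriminant q) μ‖ ∧
        ‖deriv (discriminant q) μ‖ ≤ C * ‖μ - lam₀‖) ∧
      ∀ t : ℝ, discriminant q μ = 2 * (Real.cos t : ℂ) →
        c * ‖μ - lam₀‖ ≤ 2 * |Real.sin t| ∧ 2 * |Real.sin t| ≤ C * ‖μ - lam₀‖ := by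
  obtain ⟨c, hc, C, hC, H⟩ := exists_bounds_of_order_two
    ((differentiable_discriminant hq).analyticAt lam₀) (cos_sq_eq_one ht₀) ho
  refine ⟨c, hc, C, hC, ?_⟩
  filter_upwards [H] with μ hμ
  refine ⟨hμ.1, fun t ht => ?_⟩
  have e : ‖4 - discriminant q μ ^ 2‖ = (2 * |Real.sin t|) ^ 2 := by
    have e1 : 4 - discriminant q μ ^ 2 = (((2 * Real.sin t) ^ 2 : ℝ) : ℂ) := by
      rw [ht]
      have := Real.sin_sq_add_cos_sq t
      have h2 : ((Real.sin t : ℂ)) ^ 2 + (Real.cos t : ℂ) ^ 2 = 1 := by exact_mod_cast this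
      rw [Complex.ofReal_pow, Complex.ofReal_mul, Complex.ofReal_ofNat]
      linear_combination -4 * h2
    rw [e1, Complex.norm_real, Real.norm_of_nonneg (by positivity), mul_pow, mul_pow, sq_abs]
  rw [e] at hμ
  exact ⟨le_of_sq_le_sq hμ.2.1 (by positivity), le_of_sq_le_sq hμ.2.2 (by positivity)⟩

/-- Near a double point, the cosine of the angle between the Floquet solutions `ψ_+` and
`conj ψ_-` has the size of the symplectic product of their initial data. -/
lemma exists_pairing_bounds (hq : IntegrableOn q (Icc 0 1)) (ht₀ : t₀ = 0 ∨ t₀ = Real.pi)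
    (ho : algMult q t₀ lam₀ = 2) :
    ∃ c > 0, ∃ C > 0, ∀ᶠ μ in 𝓝 lam₀, μ ≠ lam₀ → ∀ t v w, IsFloquetPair hq t μ v w →
      ‖v‖ = 1 → ‖w‖ = 1 →
      c * ‖symp v w‖ * (‖toL2 (star (flow hq μ w))‖ * ‖flowL2 hq μ v‖) ≤
        ‖pairing (flow hq μ w) (flow hq μ v)‖ ∧
      ‖pairing (flow hq μ w) (flow hq μ v)‖ ≤
        C * ‖symp v w‖ * (‖toL2 (star (flow hq μ w))‖ * ‖flowL2 hq μ v‖) := by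
  obtain ⟨c, hc, C, hC, H⟩ := exists_discriminant_bounds hq ht₀ ho
  obtain ⟨b, hb, B, hB, H'⟩ := exists_flowL2_bounds hq lam₀
  refine ⟨c / C / (B * B), by positivity, C / c / (b * b), by positivity, ?_⟩
  filter_upwards [H, H'] with μ hμ hμ' hne t v w h hv hw
  obtain ⟨⟨f1, f2⟩, hs⟩ := hμ
  obtain ⟨s1, s2⟩ := hs t h.discriminant_eq
  have hd : 0 < ‖μ - lam₀‖ := norm_pos_iff.2 (sub_ne_zero.2 hne)
  have hid := congrArg norm h.deriv_discriminant_mul_symp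
  rw [norm_mul, norm_mul, norm_mul, norm_mul, Complex.norm_ofNat, Complex.norm_I, mul_one,
    Complex.norm_real, Real.norm_eq_abs] at hid
  set p := ‖pairing (flow hq μ w) (flow hq μ v)‖
  set S := ‖symp v w‖
  set d := ‖μ - lam₀‖
  have hp : 0 ≤ p := norm_nonneg _
  have hS : 0 ≤ S := norm_nonneg _
  have hv' := hμ' v
  have hw' := hμ' w
  rw [hv, mul_one, mul_one] at hv'
  rw [hw, mul_one, mul_one] at hw'
  have hwn : ‖toL2 (star (flow hq μ w))‖ = ‖flowL2 hq μ w‖ := norm_toL2_star _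
  rw [hwn]
  have hN1 : b * b ≤ ‖flowL2 hq μ w‖ * ‖flowL2 hq μ v‖ :=
    mul_le_mul hw'.1 hv'.1 hb.le (norm_nonneg _)
  have hN2 : ‖flowL2 hq μ w‖ * ‖flowL2 hq μ v‖ ≤ B * B :=
    mul_le_mul hw'.2 hv'.2 (norm_nonneg _) hB.le
  set N := ‖flowL2 hq μ w‖ * ‖flowL2 hq μ v‖
  -- In the key identity `|F'|` and `2 |sin t|` are both comparable to `d`, so `d > 0` cancels and
  -- `S` is comparable to `p`.
  have hlow : c * S ≤ C * p := by
    have : d * (c * S) ≤ d * (C * p) := by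
      calc d * (c * S) = c * d * S := by ring
        _ ≤ ‖deriv (discriminant q) μ‖ * S := by gcongr
        _ = 2 * |Real.sin t| * p := hid
        _ ≤ C * d * p := by gcongr
        _ = _ := by ring
    exact le_of_mul_le_mul_left this hd
  have hup : c * p ≤ C * S := by
    have : d * (c * p) ≤ d * (C * S) := by
      calc d * (c * p) = c * d * p := by ring
        _ ≤ 2 * |Real.sin t| * p := by gcongr
        _ = ‖deriv (discriminant q) μ‖ * S := hid.symm
        _ ≤ C * d * S := by gcongr
        _ = _ := by ring
    exact le_of_mul_le_mul_left this hd
  constructor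
  · calc c / C / (B * B) * S * N ≤ c / C / (B * B) * S * (B * B) := by gcongr
      _ = c * S / C := by field_simp
      _ ≤ p := by rw [div_le_iff₀ hC, mul_comm p]; exact hlow
  · calc p ≤ C * S / c := by rw [le_div_iff₀ hc, mul_comm p]; exact hup
      _ = C / c / (b * b) * S * (b * b) := by field_simp
      _ ≤ C / c / (b * b) * S * N := by gcongr

lemma exists_norm_monodromy_sub_le (hq : IntegrableOn q (Icc 0 1)) (lam₀ : ℂ) :
    ∃ C > 0, ∀ᶠ μ in 𝓝 lam₀, ∀ v : ℂ × ℂ,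
      ‖monodromy hq μ v - monodromy hq lam₀ v‖ ≤ C * ‖μ - lam₀‖ * ‖v‖ := by
  have h1 := ((differentiable_monodromy_apply hq (1, 0)) lam₀).isBigO_sub.bound
  have h2 := ((differentiable_monodromy_apply hq (0, 1)) lam₀).isBigO_sub.bound
  obtain ⟨C₁, h1⟩ := h1
  obtain ⟨C₂, h2⟩ := h2
  refine ⟨|C₁| + |C₂| + 1, by positivity, ?_⟩
  filter_upwards [h1, h2] with μ h1 h2 v
  have e : monodromy hq μ v - monodromy hq lam₀ v =
      v.1 • (monodromy hq μ (1, 0) - monodromy hq lam₀ (1, 0)) +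
        v.2 • (monodromy hq μ (0, 1) - monodromy hq lam₀ (0, 1)) := by
    rw [monodromy_eq hq μ v, monodromy_eq hq lam₀ v, smul_sub, smul_sub]
    abel
  rw [e]
  refine (norm_add_le _ _).trans ?_
  rw [norm_smul, norm_smul]
  have hv1 : ‖v.1‖ ≤ ‖v‖ := norm_fst_le v
  have hv2 : ‖v.2‖ ≤ ‖v‖ := norm_snd_le v
  have hd := norm_nonneg (μ - lam₀)
  calc _ ≤ ‖v‖ * (|C₁| * ‖μ - lam₀‖) + ‖v‖ * (|C₂| * ‖μ - lam₀‖) := by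
        gcongr
        · exact h1.trans (mul_le_mul_of_nonneg_right (le_abs_self _) hd)
        · exact h2.trans (mul_le_mul_of_nonneg_right (le_abs_self _) hd)
    _ ≤ _ := by nlinarith [norm_nonneg v, mul_nonneg hd (norm_nonneg v)]

/-- If `N ≠ 0` is a linear map that is small at two unit vectors, then these are almost
collinear. -/
lemma exists_norm_symp_le {N : ℂ × ℂ →ₗ[ℂ] ℂ × ℂ} (hN : N ≠ 0) :
    ∃ K > 0, ∀ v w : ℂ × ℂ, ‖v‖ = 1 → ‖w‖ = 1 → ‖symp v w‖ ≤ K * (‖N v‖ + ‖N w‖) := by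
  -- One nonzero row `(a, b)` of `N` suffices: eliminating as in Cramer's rule writes `a · symp v w`
  -- and `b · symp v w` as combinations of `ℓ v` and `ℓ w` with coefficients of modulus at most `1`.
  have row : ∀ ℓ : ℂ × ℂ →ₗ[ℂ] ℂ, (∀ v, ‖ℓ v‖ ≤ ‖N v‖) → ℓ ≠ 0 →
      ∃ K > 0, ∀ v w : ℂ × ℂ, ‖v‖ = 1 → ‖w‖ = 1 → ‖symp v w‖ ≤ K * (‖N v‖ + ‖N w‖) := by
    intro ℓ hle hℓ
    have hform : ∀ v : ℂ × ℂ, ℓ v = v.1 * ℓ (1, 0) + v.2 * ℓ (0, 1) := by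
      intro v
      rw [← smul_eq_mul, ← smul_eq_mul, ← map_smul, ← map_smul, ← map_add]
      simp
    set a := ℓ (1, 0)
    set b := ℓ (0, 1)
    have hab : a ≠ 0 ∨ b ≠ 0 := by
      by_contra hcon
      push Not at hcon
      refine hℓ (LinearMap.ext fun v => ?_)
      rw [hform, hcon.1, hcon.2]
      simp
    have est : ∀ x y r s : ℂ, ‖x‖ ≤ 1 → ‖y‖ ≤ 1 → ‖r * x - s * y‖ ≤ ‖r‖ + ‖s‖ := by
      intro x y r s hx hy
      refine (norm_sub_le _ _).trans ?_
      rw [norm_mul, norm_mul]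
      exact add_le_add (mul_le_of_le_one_right (norm_nonneg _) hx)
        (mul_le_of_le_one_right (norm_nonneg _) hy)
    rcases hab with h0 | h0
    · refine ⟨‖a‖⁻¹, inv_pos.2 (norm_pos_iff.2 h0), fun v w hv hw => ?_⟩
      rw [inv_mul_eq_div, le_div_iff₀ (norm_pos_iff.2 h0), ← norm_mul]
      have e : symp v w * a = ℓ v * w.2 - ℓ w * v.2 := by
        rw [hform v, hform w, symp]
        ring
      rw [e]
      exact (est _ _ _ _ (hw ▸ norm_snd_le w) (hv ▸ norm_snd_le v)).trans
        (add_le_add (hle v) (hle w))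
    · refine ⟨‖b‖⁻¹, inv_pos.2 (norm_pos_iff.2 h0), fun v w hv hw => ?_⟩
      rw [inv_mul_eq_div, le_div_iff₀ (norm_pos_iff.2 h0), ← norm_mul]
      have e : symp v w * b = ℓ w * v.1 - ℓ v * w.1 := by
        rw [hform v, hform w, symp]
        ring
      rw [e, add_comm ‖N v‖]
      exact (est _ _ _ _ (hv ▸ norm_fst_le v) (hw ▸ norm_fst_le w)).trans
        (add_le_add (hle w) (hle v))
  by_cases h1 : (LinearMap.fst ℂ ℂ ℂ).comp N = 0
  · refine row ((LinearMap.snd ℂ ℂ ℂ).comp N) (fun v => norm_snd_le (N v)) fun h2 => hN ?_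
    refine LinearMap.ext fun v => Prod.ext ?_ ?_
    · exact congrArg (fun f : ℂ × ℂ →ₗ[ℂ] ℂ => f v) h1
    · exact congrArg (fun f : ℂ × ℂ →ₗ[ℂ] ℂ => f v) h2
  · exact row _ (fun v => norm_fst_le (N v)) h1

lemma norm_exp_sub_exp_le (t s : ℝ) :
    ‖Complex.exp (Complex.I * t) - Complex.exp (Complex.I * s)‖ ≤ |t - s| := by
  have e : Complex.exp (Complex.I * t) - Complex.exp (Complex.I * s) =
      Complex.exp (Complex.I * s) * (Complex.exp (Complex.I * ((t - s : ℝ) : ℂ)) - 1) := by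
    rw [mul_sub, ← Complex.exp_add, mul_one]
    congr 2
    push_cast
    ring
  have h1 : ‖Complex.exp (Complex.I * s)‖ = 1 := by rw [mul_comm, Complex.norm_exp_ofReal_mul_I]
  rw [e, norm_mul, h1, one_mul]
  exact Real.norm_exp_I_mul_ofReal_sub_one_le

/-- If the monodromy at `lam₀` is not scalar, the Floquet vectors become collinear at `lam₀`. -/
lemma exists_symp_le_of_not_scalar (hq : IntegrableOn q (Icc 0 1)) (ht₀ : t₀ = 0 ∨ t₀ = Real.pi)
    (hns : ¬ ∀ v, monodromy hq lam₀ v = Complex.exp (Complex.I * t₀) • v) :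
    ∃ K > 0, ∀ᶠ μ in 𝓝 lam₀, ∀ t v w, IsFloquetPair hq t μ v w → ‖v‖ = 1 → ‖w‖ = 1 →
      ‖symp v w‖ ≤ K * (‖μ - lam₀‖ + |t - t₀|) := by
  set e₀ := Complex.exp (Complex.I * t₀) with he₀
  -- As `e₀ = ±1` is its own inverse, both multipliers `e^{±it}` lie within `|t - t₀|` of it.
  have he₀inv : e₀⁻¹ = e₀ := by
    rw [he₀, exp_eq_cos ht₀]
    exact inv_eq_of_mul_eq_one_left (by rw [← sq, cos_sq_eq_one ht₀])
  set N : ℂ × ℂ →ₗ[ℂ] ℂ × ℂ := (monodromy hq lam₀ : ℂ × ℂ →ₗ[ℂ] ℂ × ℂ) - e₀ • LinearMap.id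
  have hN : N ≠ 0 := by
    intro h0
    refine hns fun v => sub_eq_zero.1 ?_
    exact congrArg (fun f : ℂ × ℂ →ₗ[ℂ] ℂ × ℂ => f v) h0
  obtain ⟨K, hK, hsymp⟩ := exists_norm_symp_le hN
  obtain ⟨C, hC, hM⟩ := exists_norm_monodromy_sub_le hq lam₀
  refine ⟨K * (2 * C + 2), by positivity, ?_⟩
  filter_upwards [hM] with μ hμ t v w h hv hw
  have key : ∀ (u : ℂ × ℂ) (e : ℂ), ‖u‖ = 1 → monodromy hq μ u = e • u → ‖e - e₀‖ ≤ |t - t₀| →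
      ‖N u‖ ≤ C * ‖μ - lam₀‖ + |t - t₀| := by
    intro u e hu hMu he
    have e1 : N u = (e - e₀) • u - (monodromy hq μ u - monodromy hq lam₀ u) := by
      change monodromy hq lam₀ u - e₀ • u = _
      rw [hMu, sub_smul]
      abel
    rw [e1]
    refine (norm_sub_le _ _).trans ?_
    have h2 := hμ u
    rw [norm_smul, hu, mul_one]
    rw [hu, mul_one] at h2
    linarith
  have hv' := key v _ hv h.left_eq (norm_exp_sub_exp_le t t₀)
  have hw' := key w _ hw h.right_eq (by
    rw [← he₀inv, he₀, ← Complex.exp_neg, ← Complex.exp_neg, ← mul_neg, ← mul_neg,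
      ← Complex.ofReal_neg, ← Complex.ofReal_neg]
    refine (norm_exp_sub_exp_le _ _).trans (le_of_eq ?_)
    rw [← abs_neg]
    congr 1
    ring)
  calc ‖symp v w‖ ≤ K * (‖N v‖ + ‖N w‖) := hsymp v w hv hw
    _ ≤ K * ((C * ‖μ - lam₀‖ + |t - t₀|) + (C * ‖μ - lam₀‖ + |t - t₀|)) := by gcongr
    _ ≤ _ := by
      have h1 := norm_nonneg (μ - lam₀)
      have h2 := abs_nonneg (t - t₀)
      rw [mul_assoc]
      refine mul_le_mul_of_nonneg_left ?_ hK.le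
      nlinarith [mul_nonneg hC.le h2]

/-- Two eigenvectors of a `2 × 2` matrix whose eigenvalues are separated in comparison with its
off-diagonal entries are separated. -/
lemma half_le_norm_symp {a b c d r s : ℂ} {v w : ℂ × ℂ} {η : ℝ} (hv : ‖v‖ = 1) (hw : ‖w‖ = 1)
    (hv1 : v.1 * a + v.2 * b = r * v.1) (hv2 : v.1 * c + v.2 * d = r * v.2)
    (hw1 : w.1 * a + w.2 * b = s * w.1) (hw2 : w.1 * c + w.2 * d = s * w.2)
    (hη : 0 ≤ η) (hη1 : η ≤ 1) (hb : η * ‖b‖ ≤ ‖r - s‖) (hc : η * ‖c‖ ≤ ‖r - s‖)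
    (hrs : r ≠ s) : η / 2 ≤ ‖symp v w‖ := by
  have hpos : 0 < ‖r - s‖ := norm_pos_iff.2 (sub_ne_zero.2 hrs)
  -- These identities settle the case where `|v.1 w.1|` or `|v.2 w.2|` is at least `1/2`. Otherwise
  -- the two vectors, of norm `1` for the maximum norm, peak in different coordinates, and the two
  -- terms of `symp` differ in modulus by at least `1/2`.
  have i1 : (r - s) * (v.1 * w.1) = -b * symp v w := by
    rw [symp]
    linear_combination -w.1 * hv1 + v.1 * hw1
  have i2 : (r - s) * (v.2 * w.2) = c * symp v w := by
    rw [symp]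
    linear_combination -w.2 * hv2 + v.2 * hw2
  have est : ∀ x k : ℂ, (r - s) * x = k * symp v w → η * ‖k‖ ≤ ‖r - s‖ → 1 / 2 ≤ ‖x‖ →
      η / 2 ≤ ‖symp v w‖ := by
    intro x k hx hk hx2
    have h1 := congrArg norm hx
    rw [norm_mul, norm_mul] at h1
    refine le_of_mul_le_mul_left ?_ hpos
    calc ‖r - s‖ * (η / 2) = η * (‖r - s‖ * (1 / 2)) := by ring
      _ ≤ η * (‖r - s‖ * ‖x‖) := by gcongr
      _ = η * ‖k‖ * ‖symp v w‖ := by rw [h1]; ring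
      _ ≤ _ := by gcongr
  have e1 := est _ _ i1 (by rwa [norm_neg])
  have e2 := est _ _ i2 hc
  have hv1' : ‖v.1‖ ≤ 1 := hv ▸ norm_fst_le v
  have hv2' : ‖v.2‖ ≤ 1 := hv ▸ norm_snd_le v
  have hw1' : ‖w.1‖ ≤ 1 := hw ▸ norm_fst_le w
  have hw2' : ‖w.2‖ ≤ 1 := hw ▸ norm_snd_le w
  rw [norm_mul] at e1 e2
  by_cases h1 : 1 / 2 ≤ ‖v.1‖ * ‖w.1‖
  · exact e1 h1
  by_cases h2 : 1 / 2 ≤ ‖v.2‖ * ‖w.2‖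
  · exact e2 h2
  push Not at h1 h2
  rw [Prod.norm_def] at hv hw
  have big : ∀ x y : ℂ, 1 / 2 ≤ ‖x‖ - ‖y‖ → ‖x - y‖ = ‖symp v w‖ → η / 2 ≤ ‖symp v w‖ := by
    intro x y hxy he
    rw [← he]
    have := norm_sub_norm_le x y
    linarith
  rcases max_choice ‖v.1‖ ‖v.2‖ with h3 | h3 <;> rcases max_choice ‖w.1‖ ‖w.2‖ with h4 | h4 <;>
    rw [hv] at h3 <;> rw [hw] at h4
  · rw [← h3, ← h4] at h1; norm_num at h1
  · refine big (v.1 * w.2) (v.2 * w.1) ?_ rfl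
    rw [norm_mul, norm_mul, ← h3, ← h4]
    rw [← h3, one_mul] at h1
    nlinarith [norm_nonneg w.1]
  · refine big (v.2 * w.1) (v.1 * w.2) ?_ (by rw [norm_sub_rev]; rfl)
    rw [norm_mul, norm_mul, ← h3, ← h4]
    rw [← h4, mul_one] at h1
    nlinarith [norm_nonneg v.1]
  · rw [← h3, ← h4] at h2; norm_num at h2

/-- If the monodromy at `lam₀` is scalar, the Floquet vectors stay separated at `lam₀`. -/
lemma exists_le_symp_of_scalar (hq : IntegrableOn q (Icc 0 1)) (ht₀ : t₀ = 0 ∨ t₀ = Real.pi)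
    (ho : algMult q t₀ lam₀ = 2)
    (hsc : ∀ v, monodromy hq lam₀ v = Complex.exp (Complex.I * t₀) • v) :
    ∃ κ > 0, ∀ᶠ μ in 𝓝 lam₀, μ ≠ lam₀ → ∀ t v w, IsFloquetPair hq t μ v w →
      ‖v‖ = 1 → ‖w‖ = 1 → κ ≤ ‖symp v w‖ := by
  obtain ⟨c, hc, C, hC, H⟩ := exists_discriminant_bounds hq ht₀ ho
  obtain ⟨D, hD, hM⟩ := exists_norm_monodromy_sub_le hq lam₀
  have hη0 : 0 < min 1 (c / D) := lt_min one_pos (by positivity)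
  refine ⟨min 1 (c / D) / 2, by positivity, ?_⟩
  filter_upwards [H, hM] with μ hμ hMμ hne t v w h hv hw
  obtain ⟨s1, -⟩ := hμ.2 t h.discriminant_eq
  have hvM := h.left_eq
  have hwM := h.right_eq
  rw [monodromy_eq hq μ, Prod.ext_iff] at hvM hwM
  have hrs : ‖Complex.exp (Complex.I * t) - (Complex.exp (Complex.I * t))⁻¹‖ =
      2 * |Real.sin t| := by
    rw [exp_sub_inv, norm_mul, norm_mul, Complex.norm_ofNat, Complex.norm_I, mul_one,
      Complex.norm_real, Real.norm_eq_abs]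
  -- The off-diagonal entries vanish at `lam₀`, so they are at most `D |μ - lam₀|`, while the
  -- multipliers are at least `c |μ - lam₀|` apart; hence the ratio `c / D`.
  have hoff : ∀ k : ℂ, ‖k‖ ≤ D * ‖μ - lam₀‖ → min 1 (c / D) * ‖k‖ ≤
      ‖Complex.exp (Complex.I * t) - (Complex.exp (Complex.I * t))⁻¹‖ := by
    intro k hk
    rw [hrs]
    calc min 1 (c / D) * ‖k‖ ≤ c / D * (D * ‖μ - lam₀‖) := by
          gcongr
          exact min_le_right _ _
      _ = c * ‖μ - lam₀‖ := by field_simp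
      _ ≤ _ := s1
  refine half_le_norm_symp hv hw hvM.1 hvM.2 hwM.1 hwM.2 hη0.le (min_le_left _ _)
    (hoff _ ?_) (hoff _ ?_) h.ne_inv
  · have h1 := (norm_fst_le _).trans (hMμ (0, 1))
    rw [hsc] at h1
    simpa using h1
  · have h1 := (norm_snd_le _).trans (hMμ (1, 0))
    rw [hsc] at h1
    simpa using h1

end DoublePoint

end Hill

/-! ### Numberings of the eigenvalues and the order of multiple ones. -/

namespace Hill

variable {q : ℝ → ℂ}

lemma finite_roots_inter_closedBall (hq : IntegrableOn q (Icc 0 1)) (c : ℂ) (R : ℝ) :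
    ({μ | discriminant q μ = c} ∩ Metric.closedBall 0 R).Finite := by
  by_contra hinf
  obtain ⟨x, -, hx⟩ := Set.Infinite.exists_accPt_of_subset_isCompact hinf
    (isCompact_closedBall (0 : ℂ) R) inter_subset_right
  rw [accPt_iff_frequently_nhdsNE] at hx
  have ha : AnalyticOnNhd ℂ (fun z => discriminant q z - c) univ := fun z _ =>
    ((differentiable_discriminant hq).sub_const c).analyticAt z
  have := ha.eqOn_zero_of_preconnected_of_frequently_eq_zero isPreconnected_univ (mem_univ x)
    (hx.mono fun z hz => sub_eq_zero.2 hz.1)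
  exact discriminant_not_const hq c fun z => sub_eq_zero.1 (this (mem_univ z))

lemma countable_roots (hq : IntegrableOn q (Icc 0 1)) (c : ℂ) :
    {μ | discriminant q μ = c}.Countable := by
  have e : {μ | discriminant q μ = c} =
      ⋃ n : ℕ, {μ | discriminant q μ = c} ∩ Metric.closedBall 0 n := by
    rw [← inter_iUnion, Metric.iUnion_closedBall_nat, inter_univ]
  rw [e]
  exact countable_iUnion fun n => (finite_roots_inter_closedBall hq c n).countable

lemma infinite_roots (hq : IntegrableOn q (Icc 0 1)) {t₀ : ℝ} (ht₀ : t₀ = 0 ∨ t₀ = Real.pi) :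
    {μ | discriminant q μ = 2 * (Real.cos t₀ : ℂ)}.Infinite := by
  intro hfin
  obtain ⟨X, hX⟩ := hfin.isBounded.exists_norm_le
  obtain ⟨μ, hμ, hroot⟩ := exists_large_root hq ht₀ X
  exact absurd (hX μ hroot) (not_le.2 hμ)

lemma algMult_ne_zero_iff (hq : IntegrableOn q (Icc 0 1)) (t : ℝ) (μ : ℂ) :
    algMult q t μ ≠ 0 ↔ discriminant q μ = 2 * (Real.cos t : ℂ) := by
  have ha : AnalyticAt ℂ (fun z => discriminant q z - 2 * (Real.cos t : ℂ)) μ :=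
    ((differentiable_discriminant hq).sub_const _).analyticAt μ
  rw [algMult, ha.analyticOrderAt_ne_zero, sub_eq_zero]

/-- The roots, each repeated according to its finite multiplicity, form a countable set. It is
infinite because there are arbitrarily large roots, so it is in bijection with `ℤ`. -/
lemma exists_isNumbering (hq : IntegrableOn q (Icc 0 1)) {t₀ : ℝ} (ht₀ : t₀ = 0 ∨ t₀ = Real.pi) :
    ∃ lam : ℤ → ℂ, IsNumbering q t₀ lam := by
  set Z := {μ | discriminant q μ = 2 * (Real.cos t₀ : ℂ)} with hZ
  have : Countable Z := (countable_roots hq _).to_subtype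
  have : Infinite Z := (infinite_roots hq ht₀).to_subtype
  have hmult : ∀ μ : ℂ, (((algMult q t₀ μ).toNat : ℕ) : ℕ∞) = algMult q t₀ μ := fun μ =>
    ENat.natCast_toNat (analyticOrderAt_discriminant_ne_top hq _ μ)
  have hpos : ∀ μ : Z, 0 < (algMult q t₀ μ).toNat := by
    intro μ
    rw [Nat.pos_iff_ne_zero]
    intro h0
    have h1 := hmult μ
    rw [h0] at h1
    exact (algMult_ne_zero_iff hq t₀ μ).2 μ.2 h1.symm
  have : Infinite (Σ μ : Z, Fin (algMult q t₀ μ).toNat) :=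
    Infinite.of_injective (fun μ : Z => (⟨μ, ⟨0, hpos μ⟩⟩ : Σ μ : Z, Fin (algMult q t₀ μ).toNat))
      fun μ ν h => congrArg Sigma.fst h
  obtain ⟨e⟩ := nonempty_equiv_of_countable (α := ℤ) (β := Σ μ : Z, Fin (algMult q t₀ μ).toNat)
  refine ⟨fun k => (e k).1, fun k => (isEigenvalue_iff hq t₀ _).2 (e k).1.2, fun μ => ?_⟩
  by_cases hμ : μ ∈ Z
  · have hset : {k : ℤ | ((e k).1 : ℂ) = μ} = e.symm '' (Sigma.mk (⟨μ, hμ⟩ : Z) '' univ) := by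
      ext k
      constructor
      · intro hk
        refine ⟨e k, ?_, e.symm_apply_apply k⟩
        have hk' : (e k).1 = ⟨μ, hμ⟩ := Subtype.ext hk
        rcases he : e k with ⟨ν, i⟩
        rw [he] at hk'
        subst hk'
        exact ⟨i, mem_univ _, rfl⟩
      · rintro ⟨_, ⟨i, -, rfl⟩, rfl⟩
        simp
    rw [hset, e.symm.injective.encard_image, sigma_mk_injective.encard_image, encard_univ,
      ENat.card_eq_coe_fintype_card, Fintype.card_fin]
    exact hmult μ
  · have hset : {k : ℤ | ((e k).1 : ℂ) = μ} = ∅ := by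
      ext k
      simp only [mem_ofPred_eq, mem_empty_iff_false, iff_false]
      rintro rfl
      exact hμ (e k).1.2
    rw [hset, encard_empty]
    by_contra h0
    exact hμ ((algMult_ne_zero_iff hq t₀ μ).1 (Ne.symm h0))

/-- A disc contains finitely many roots, each of finite multiplicity, so only finitely many indices
land in it, in whatever order the eigenvalues are numbered. -/
lemma IsNumbering.exists_norm_gt (hq : IntegrableOn q (Icc 0 1)) {t₀ : ℝ} {lam : ℤ → ℂ}
    (h : IsNumbering q t₀ lam) (R : ℝ) : ∃ N : ℕ, ∀ k : ℤ, (N : ℤ) < |k| → R < ‖lam k‖ := by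
  have hfin : {k : ℤ | ‖lam k‖ ≤ R}.Finite := by
    have hsub : {k : ℤ | ‖lam k‖ ≤ R} ⊆
        ⋃ μ ∈ {μ | discriminant q μ = 2 * (Real.cos t₀ : ℂ)} ∩ Metric.closedBall 0 R,
          {k : ℤ | lam k = μ} := by
      intro k hk
      simp only [mem_iUnion]
      refine ⟨lam k, ⟨(isEigenvalue_iff hq t₀ _).1 (h.1 k), ?_⟩, rfl⟩
      rw [mem_closedBall_zero_iff]
      exact hk
    refine Finite.subset ((finite_roots_inter_closedBall hq _ R).biUnion fun μ _ => ?_) hsub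
    rw [← encard_ne_top_iff, h.2 μ]
    exact analyticOrderAt_discriminant_ne_top hq _ μ
  obtain ⟨B, hB⟩ := (hfin.image fun k : ℤ => |k|).bddAbove
  refine ⟨B.toNat, fun k hk => ?_⟩
  by_contra hle
  have h1 : |k| ≤ B := hB ⟨k, not_lt.1 hle, rfl⟩
  have h2 := Int.self_le_toNat B
  omega

/-- Far from the origin multiple eigenvalues are double. -/
lemma exists_algMult_eq_two (hq : IntegrableOn q (Icc 0 1)) :
    ∃ R : ℝ, ∀ (t : ℝ) (μ : ℂ), R < ‖μ‖ → IsMultipleEigenvalue q t μ → algMult q t μ = 2 := by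
  obtain ⟨R, hR⟩ := exists_deriv_deriv_discriminant_ne_zero hq
  refine ⟨R, fun t μ hμ ⟨hev, h2⟩ => ?_⟩
  have ha := (differentiable_discriminant hq).analyticAt μ
  have hroot := (isEigenvalue_iff hq t μ).1 hev
  have h1 := ha.analyticOrderAt_deriv_add_one
  have h3 := ha.deriv.analyticOrderAt_deriv_add_one
  have e1 : algMult q t μ = analyticOrderAt (deriv (discriminant q)) μ + 1 := by
    rw [h1, hroot, algMult]
  have hd0 : deriv (discriminant q) μ = 0 := by
    by_contra hne
    have h0 := (ha.deriv.analyticOrderAt_eq_zero).2 hne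
    rw [e1, h0] at h2
    norm_num at h2
  have h0 := (ha.deriv.deriv.analyticOrderAt_eq_zero).2 (hR μ hμ hd0)
  rw [h0, hd0] at h3
  simp only [sub_zero] at h3
  rw [e1, ← h3]
  norm_num

lemma isSimpleEigenvalue_of_deriv_ne_zero (hq : IntegrableOn q (Icc 0 1)) {t : ℝ} {μ : ℂ}
    (h : discriminant q μ = 2 * (Real.cos t : ℂ)) (hd : deriv (discriminant q) μ ≠ 0) :
    IsSimpleEigenvalue q t μ := by
  refine ⟨(isEigenvalue_iff hq t μ).2 h, ?_⟩
  rw [algMult, ← h]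
  exact ((differentiable_discriminant hq).analyticAt μ).analyticOrderAt_sub_eq_one_of_deriv_ne_zero
    hd

/-! ### The dichotomy at a double eigenvalue: spectral singularities and ESS. -/

section DoublePoint

variable {t₀ : ℝ} {lam₀ : ℂ}

/-- The value `F(lam₀)` determines `cos t`, and the multiplicity depends on `t` only through `cos
t`; so `lam₀` is not a simple eigenvalue of any `H_t`. -/
lemma IsSimpleEigenvalue.ne_of_algMult_eq_two (hq : IntegrableOn q (Icc 0 1)) {t : ℝ} {μ : ℂ}
    (h : IsSimpleEigenvalue q t μ) (ho : algMult q t₀ lam₀ = 2) : μ ≠ lam₀ := by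
  rintro rfl
  have h1 := (isEigenvalue_iff hq t μ).1 h.1
  have h2 : discriminant q μ = 2 * (Real.cos t₀ : ℂ) := by
    rw [← algMult_ne_zero_iff hq, ho]
    norm_num
  have h3 := h.2
  rw [algMult, ← h1, h2] at h3
  rw [algMult, h3] at ho
  norm_num at ho

lemma IsFloquetPair.symp_ne_zero {hq : IntegrableOn q (Icc 0 1)} {t : ℝ} {μ : ℂ} {v w : ℂ × ℂ}
    (h : IsFloquetPair hq t μ v w) : symp v w ≠ 0 := by
  intro h0
  obtain ⟨c, rfl⟩ := exists_smul_of_symp_eq_zero h.left_ne h0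
  have h1 := h.right_eq
  rw [map_smul, h.left_eq, smul_comm, ← sub_eq_zero, ← sub_smul] at h1
  exact (smul_ne_zero (sub_ne_zero.2 h.ne_inv) h.right_ne) h1

lemma IsFloquetPair.pairing_ne_zero {hq : IntegrableOn q (Icc 0 1)} {t : ℝ} {μ : ℂ}
    {v w : ℂ × ℂ} (h : IsFloquetPair hq t μ v w) (hd : deriv (discriminant q) μ ≠ 0) :
    pairing (flow hq μ w) (flow hq μ v) ≠ 0 := by
  intro h0
  have := h.deriv_discriminant_mul_symp
  rw [h0, mul_zero] at this
  exact mul_ne_zero hd h.symp_ne_zero this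

/-- `|α|` in terms of the Floquet solutions. -/
lemma IsFloquetPair.norm_inner_eq {hq : IntegrableOn q (Icc 0 1)} {t : ℝ} {μ : ℂ} {v w : ℂ × ℂ}
    (h : IsFloquetPair hq t μ v w) {Ψ Ψs : L2} (hΨ : Ψ ∈ eigenspace (graph q t) μ)
    (hΨs : Ψs ∈ eigenspace (graph q t).adjoint (starRingEnd ℂ μ)) (h1 : ‖Ψ‖ = 1)
    (h2 : ‖Ψs‖ = 1) :
    ‖inner ℂ Ψs Ψ‖ * (‖toL2 (star (flow hq μ w))‖ * ‖flowL2 hq μ v‖) =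
      ‖pairing (flow hq μ w) (flow hq μ v)‖ := by
  rw [h.eigenspace_eq, Submodule.mem_span_singleton] at hΨ
  rw [h.adjoint_eigenspace_eq, Submodule.mem_span_singleton] at hΨs
  obtain ⟨a, rfl⟩ := hΨ
  obtain ⟨b, rfl⟩ := hΨs
  rw [norm_smul] at h1 h2
  rw [inner_smul_left, inner_smul_right, norm_mul, norm_mul, RCLike.norm_conj]
  change ‖b‖ * (‖a‖ * ‖pairing (flow hq μ w) (flow hq μ v)‖) * _ = _
  calc _ = (‖a‖ * ‖flowL2 hq μ v‖) * (‖b‖ * ‖toL2 (star (flow hq μ w))‖) *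
        ‖pairing (flow hq μ w) (flow hq μ v)‖ := by ring
    _ = _ := by rw [h1, h2, one_mul, one_mul]

/-- The branches of eigenvalues through a double point. -/
lemma exists_branch (hq : IntegrableOn q (Icc 0 1)) (ht₀ : t₀ = 0 ∨ t₀ = Real.pi)
    (ho : algMult q t₀ lam₀ = 2) :
    ∃ μ : ℝ → ℂ, ∃ K > 0, ∃ δ > 0, ContinuousOn μ (Ioo (t₀ - δ) (t₀ + δ)) ∧
      ∀ t ∈ Ioo (t₀ - δ) (t₀ + δ), discriminant q (μ t) = 2 * (Real.cos t : ℂ) ∧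
        ‖μ t - lam₀‖ ≤ K * |t - t₀| := by
  obtain ⟨ρ, hρ0, K, s, hs, hL, hρ⟩ := exists_sqrt_branch
    ((differentiable_discriminant hq).analyticAt lam₀) ho
  obtain ⟨κ, hκ⟩ := IsAlgClosed.exists_pow_nat_eq (-(Real.cos t₀ : ℂ)) (n := 2) two_pos
  have hκ1 : ‖κ‖ = 1 := by
    have h1 := congrArg norm hκ
    rw [norm_pow, norm_neg] at h1
    have h2 : ‖(Real.cos t₀ : ℂ)‖ = 1 := by rcases ht₀ with rfl | rfl <;> simp
    rw [h2] at h1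
    exact (pow_eq_one_iff_of_nonneg (norm_nonneg _) two_ne_zero).1 h1
  -- An explicit smooth square root of `2 cos t - 2 cos t₀ = -4 cos t₀ sin²((t - t₀)/2)`; this
  -- avoids choosing a branch on the two sides of `t₀`.
  set ζ : ℝ → ℂ := fun t => κ * ((2 * Real.sin ((t - t₀) / 2) : ℝ) : ℂ) with hζ
  have hζc : Continuous ζ := by fun_prop
  have hζ0 : ζ t₀ = 0 := by simp [hζ]
  have hζn : ∀ t, ‖ζ t‖ ≤ |t - t₀| := by
    intro t
    rw [hζ]
    simp only
    rw [norm_mul, hκ1, one_mul, Complex.norm_real, Real.norm_eq_abs, abs_mul, abs_two]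
    have := Real.abs_sin_le_abs (x := (t - t₀) / 2)
    rw [abs_div, abs_two] at this
    linarith
  have hmem : ∀ᶠ t in 𝓝 t₀, ζ t ∈ s := hζc.continuousAt.preimage_mem_nhds (by rwa [hζ0])
  obtain ⟨δ, hδ, hball⟩ := Metric.eventually_nhds_iff_ball.1 hmem
  rw [Real.ball_eq_Ioo] at hball
  have h0s : (0 : ℂ) ∈ s := mem_of_mem_nhds hs
  refine ⟨fun t => ρ (ζ t), K + 1, by positivity, δ, hδ,
    hL.continuousOn.comp hζc.continuousOn hball, fun t ht => ⟨?_, ?_⟩⟩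
  · rw [hρ _ (hball t ht)]
    have e : (2 * Real.cos t : ℝ) =
        2 * Real.cos t₀ - Real.cos t₀ * (2 * Real.sin ((t - t₀) / 2)) ^ 2 := by
      have h1 : Real.cos t = Real.cos t₀ * Real.cos (t - t₀) := by
        rcases ht₀ with rfl | rfl
        · simp
        · simp [Real.cos_sub_pi]
      have h2 : Real.cos (t - t₀) = 1 - 2 * Real.sin ((t - t₀) / 2) ^ 2 := by
        have h3 := Real.cos_sq' ((t - t₀) / 2)
        have h4 := Real.cos_two_mul ((t - t₀) / 2)
        rw [mul_div_cancel₀ _ two_ne_zero] at h4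
        rw [h4, h3]
        ring
      rw [h1, h2]
      ring
    have e' := congrArg (fun x : ℝ => (x : ℂ)) e
    simp only [Complex.ofReal_mul, Complex.ofReal_sub, Complex.ofReal_pow,
      Complex.ofReal_ofNat] at e'
    rw [e', hζ]
    simp only [Complex.ofReal_mul, Complex.ofReal_ofNat]
    rw [mul_pow, hκ]
    ring
  · have h1 := hL.dist_le_mul (ζ t) (hball t ht) 0 h0s
    rw [hρ0, dist_eq_norm, dist_zero_right] at h1
    refine h1.trans (mul_le_mul (by linarith) (hζn t) (norm_nonneg _) (by positivity))

lemma puncturedInterval_mem_nhdsNE (t₀ : ℝ) {δ : ℝ} (hδ : 0 < δ) :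
    puncturedInterval t₀ δ ∈ 𝓝[≠] t₀ := by
  have h1 : Ioo (t₀ - δ) (t₀ + δ) ∈ 𝓝 t₀ := Ioo_mem_nhds (by linarith) (by linarith)
  filter_upwards [mem_nhdsWithin_of_mem_nhds h1, self_mem_nhdsWithin] with t ht hne
  rcases lt_or_gt_of_ne (mem_compl_singleton_iff.1 hne) with h | h
  · exact Or.inl ⟨ht.1, h⟩
  · exact Or.inr ⟨h, ht.2⟩

lemma exists_puncturedInterval_subset {t₀ : ℝ} {p : ℝ → Prop} (h : ∀ᶠ t in 𝓝[≠] t₀, p t) :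
    ∃ δ > 0, ∀ t ∈ puncturedInterval t₀ δ, p t := by
  rw [eventually_nhdsWithin_iff, Metric.eventually_nhds_iff_ball] at h
  obtain ⟨δ, hδ, hball⟩ := h
  rw [Real.ball_eq_Ioo] at hball
  refine ⟨δ, hδ, ?_⟩
  rintro t (ht | ht)
  · exact hball t ⟨ht.1, by linarith [ht.2]⟩ ht.2.ne
  · exact hball t ⟨by linarith [ht.1], ht.2⟩ ht.1.ne'

lemma puncturedInterval_mono (t₀ : ℝ) {δ' δ : ℝ} (h : δ' ≤ δ) :
    puncturedInterval t₀ δ' ⊆ puncturedInterval t₀ δ :=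
  union_subset_union (Ioo_subset_Ioo_left (by linarith)) (Ioo_subset_Ioo_right (by linarith))

/-- If the monodromy is not scalar at a double point, then along a branch of simple eigenvalues
through this point `|α(t)|` is at most of the order of `|t - t₀|`. -/
lemma exists_singular_branch (hq : IntegrableOn q (Icc 0 1)) (ht₀ : t₀ = 0 ∨ t₀ = Real.pi)
    (ho : algMult q t₀ lam₀ = 2)
    (hns : ¬ ∀ v, monodromy hq lam₀ v = Complex.exp (Complex.I * t₀) • v) :
    ∃ μ : ℝ → ℂ, ∃ K > 0, ∃ δ > 0, ContinuousOn μ (puncturedInterval t₀ δ) ∧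
      Tendsto μ (𝓝[≠] t₀) (𝓝 lam₀) ∧
      ∀ t ∈ puncturedInterval t₀ δ, IsSimpleEigenvalue q t (μ t) ∧
        ∃ v w, IsFloquetPair hq t (μ t) v w ∧
          pairing (flow hq (μ t) w) (flow hq (μ t) v) ≠ 0 ∧
          ‖pairing (flow hq (μ t) w) (flow hq (μ t) v)‖ ≤ K * |t - t₀| *
            (‖toL2 (star (flow hq (μ t) w))‖ * ‖flowL2 hq (μ t) v‖) := by
  obtain ⟨μ, K, hK, δ, hδ, hcont, hμ⟩ := exists_branch hq ht₀ ho
  obtain ⟨c, hc, C, hC, H1⟩ := exists_discriminant_bounds hq ht₀ ho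
  obtain ⟨b, hb, B, hB, H2⟩ := exists_pairing_bounds hq ht₀ ho
  obtain ⟨D, hD, H3⟩ := exists_symp_le_of_not_scalar hq ht₀ hns
  have hroot : discriminant q lam₀ = 2 * (Real.cos t₀ : ℂ) := by
    rw [← algMult_ne_zero_iff hq, ho]
    norm_num
  have hIoo : ∀ᶠ t in 𝓝[≠] t₀, t ∈ Ioo (t₀ - δ) (t₀ + δ) :=
    mem_nhdsWithin_of_mem_nhds (Ioo_mem_nhds (by linarith) (by linarith))
  have htend : Tendsto μ (𝓝[≠] t₀) (𝓝 lam₀) := by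
    rw [tendsto_iff_norm_sub_tendsto_zero]
    have h0 : Tendsto (fun t => K * |t - t₀|) (𝓝[≠] t₀) (𝓝 0) := by
      have : Continuous fun t => K * |t - t₀| := by fun_prop
      have h1 := this.tendsto t₀
      simp only [sub_self, abs_zero, mul_zero] at h1
      exact h1.mono_left nhdsWithin_le_nhds
    refine squeeze_zero' (Eventually.of_forall fun _ => norm_nonneg _) ?_ h0
    filter_upwards [hIoo] with t ht using (hμ t ht).2
  have hcos : ∀ᶠ t in 𝓝[≠] t₀, Real.sin t ≠ 0 := by
    have h1 : Ioo (t₀ - 1) (t₀ + 1) ∈ 𝓝 t₀ := Ioo_mem_nhds (by linarith) (by linarith)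
    filter_upwards [mem_nhdsWithin_of_mem_nhds h1, self_mem_nhdsWithin] with t ht hne
    have hne' : t - t₀ ≠ 0 := sub_ne_zero.2 (mem_compl_singleton_iff.1 hne)
    have h2 : Real.sin (t - t₀) ≠ 0 := by
      intro h0
      have h3 := (Real.sin_eq_zero_iff_of_lt_of_lt (x := t - t₀)
        (by linarith [ht.1, Real.pi_gt_three]) (by linarith [ht.2, Real.pi_gt_three])).1 h0
      exact hne' h3
    rcases ht₀ with rfl | rfl
    · simpa using h2
    · simpa [Real.sin_sub_pi] using h2
  obtain ⟨δ', hδ', hall⟩ := exists_puncturedInterval_subset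
    ((htend.eventually H1).and ((htend.eventually H2).and ((htend.eventually H3).and
      (hcos.and hIoo))))
  -- `B` compares the pairing with `symp`, `D` bounds `symp` by `|μ - lam₀| + |t - t₀|`, and `K`
  -- bounds the first summand along the branch.
  refine ⟨μ, B * (D * (K + 1)), by positivity, δ', hδ', ?_, htend, fun t ht => ?_⟩
  · exact hcont.mono fun t ht => (hall t ht).2.2.2.2
  · obtain ⟨h1, h2, h3, hsin, htI⟩ := hall t ht
    obtain ⟨hdisc, hdist⟩ := hμ t htI
    have hne : μ t ≠ lam₀ := by
      intro h0
      obtain ⟨-, h5⟩ := h1.2 t hdisc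
      rw [h0, sub_self, norm_zero, mul_zero] at h5
      have h6 := abs_pos.2 hsin
      linarith
    have hd : deriv (discriminant q) (μ t) ≠ 0 := by
      rw [← norm_pos_iff]
      exact lt_of_lt_of_le (mul_pos hc (norm_pos_iff.2 (sub_ne_zero.2 hne))) h1.1.1
    obtain ⟨v, w, hp, hv, hw⟩ := exists_isFloquetPair_norm_eq_one hq hdisc hsin
    refine ⟨isSimpleEigenvalue_of_deriv_ne_zero hq hdisc hd, v, w, hp, hp.pairing_ne_zero hd, ?_⟩
    refine ((h2 hne t v w hp hv hw).2).trans ?_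
    refine mul_le_mul_of_nonneg_right ?_ (by positivity)
    have h7 := h3 t v w hp hv hw
    calc B * ‖symp v w‖ ≤ B * (D * (K * |t - t₀| + |t - t₀|)) := by
          gcongr
          exact h7.trans (by gcongr)
      _ = _ := by ring

/-- If the monodromy is scalar at a double point, then `|α|` is bounded away from zero near it. -/
lemma exists_regular_neighbourhood (hq : IntegrableOn q (Icc 0 1)) (ht₀ : t₀ = 0 ∨ t₀ = Real.pi)
    (ho : algMult q t₀ lam₀ = 2)
    (hsc : ∀ v, monodromy hq lam₀ v = Complex.exp (Complex.I * t₀) • v) :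
    ∃ κ > 0, ∀ᶠ μ in 𝓝 lam₀, ∀ t, IsSimpleEigenvalue q t μ →
      ∃ v w, IsFloquetPair hq t μ v w ∧
        0 < ‖toL2 (star (flow hq μ w))‖ * ‖flowL2 hq μ v‖ ∧
        κ * (‖toL2 (star (flow hq μ w))‖ * ‖flowL2 hq μ v‖) ≤
          ‖pairing (flow hq μ w) (flow hq μ v)‖ := by
  obtain ⟨c, hc, C, hC, H1⟩ := exists_discriminant_bounds hq ht₀ ho
  obtain ⟨b, hb, B, hB, H2⟩ := exists_pairing_bounds hq ht₀ ho
  obtain ⟨κ, hκ, H3⟩ := exists_le_symp_of_scalar hq ht₀ ho hsc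
  refine ⟨b * κ, by positivity, ?_⟩
  filter_upwards [H1, H2, H3] with μ h1 h2 h3 t hsimple
  have hne : μ ≠ lam₀ := hsimple.ne_of_algMult_eq_two hq ho
  have hdisc := (isEigenvalue_iff hq t μ).1 hsimple.1
  -- `2 |sin t| ≥ c |μ - lam₀| > 0`: near `lam₀` this holds for every `t` at once, so a Floquet pair
  -- exists for each simple eigenvalue there.
  have hsin : Real.sin t ≠ 0 := by
    intro h0
    obtain ⟨h4, -⟩ := h1.2 t hdisc
    rw [h0, abs_zero, mul_zero] at h4
    exact absurd (mul_pos hc (norm_pos_iff.2 (sub_ne_zero.2 hne))) (not_lt.2 h4)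
  obtain ⟨v, w, hp, hv, hw⟩ := exists_isFloquetPair_norm_eq_one hq hdisc hsin
  refine ⟨v, w, hp, ?_, ?_⟩
  · have e : ‖toL2 (star (flow hq μ w))‖ = ‖flowL2 hq μ w‖ := norm_toL2_star _
    rw [e]
    exact mul_pos (norm_pos_iff.2 (IsFloquetPair.flowL2_ne_zero hp.right_ne))
      (norm_pos_iff.2 (IsFloquetPair.flowL2_ne_zero hp.left_ne))
  · refine le_trans ?_ (h2 hne t v w hp hv hw).1
    refine mul_le_mul_of_nonneg_right ?_ (by positivity)
    exact mul_le_mul_of_nonneg_left (h3 hne t v w hp hv hw) hb.le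

lemma isSpectralSingularity_of_not_scalar (hq : IntegrableOn q (Icc 0 1))
    (ht₀ : t₀ = 0 ∨ t₀ = Real.pi) (ho : algMult q t₀ lam₀ = 2)
    (hns : ¬ ∀ v, monodromy hq lam₀ v = Complex.exp (Complex.I * t₀) • v) :
    IsSpectralSingularity q lam₀ := by
  obtain ⟨μ, K, hK, δ, hδ, -, htend, H⟩ := exists_singular_branch hq ht₀ ho hns
  have ht₀' : t₀ ∈ Ico (0 : ℝ) (2 * Real.pi) := by
    rcases ht₀ with rfl | rfl
    · exact ⟨le_rfl, by linarith [Real.pi_pos]⟩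
    · exact ⟨Real.pi_pos.le, by linarith [Real.pi_pos]⟩
  refine ⟨⟨t₀, ht₀', ?_⟩, fun ε hε M => ?_⟩
  · rw [isEigenvalue_iff hq, ← algMult_ne_zero_iff hq, ho]
    norm_num
  · have hle : 𝓝[>] t₀ ≤ 𝓝[≠] t₀ := nhdsWithin_mono _ fun t (ht : t₀ < t) => ht.ne'
    have h1 : ∀ᶠ t in 𝓝[>] t₀, μ t ∈ Metric.ball lam₀ ε :=
      (htend.mono_left hle).eventually (Metric.ball_mem_nhds _ hε)
    have h2 : ∀ᶠ t in 𝓝[>] t₀, t ∈ puncturedInterval t₀ δ :=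
      hle (puncturedInterval_mem_nhdsNE t₀ hδ)
    have h3 : ∀ᶠ t in 𝓝[>] t₀, t < 2 * Real.pi :=
      mem_nhdsWithin_of_mem_nhds (gt_mem_nhds ht₀'.2)
    have h4 : ∀ᶠ t in 𝓝[>] t₀, K * |t - t₀| * (|M| + 1) < 1 := by
      have hc : Continuous fun t => K * |t - t₀| * (|M| + 1) := by fun_prop
      have h5 := hc.tendsto t₀
      simp only [sub_self, abs_zero, mul_zero, zero_mul] at h5
      exact mem_nhdsWithin_of_mem_nhds (h5.eventually (gt_mem_nhds one_pos))
    obtain ⟨t, h1, h2, h3, h4, h5⟩ :=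
      (h1.and (h2.and (h3.and (h4.and self_mem_nhdsWithin)))).exists
    have ht : t₀ < t := h5
    obtain ⟨hsimple, v, w, hp, hpne, hple⟩ := H t h2
    obtain ⟨P, hP, hPn⟩ := exists_isSpectralProjection hp hpne
    refine ⟨t, ⟨ht₀'.1.trans ht.le, h3⟩, μ t, h1, hsimple, P, hP, lt_of_lt_of_le ?_ hPn⟩
    have hpp := norm_pos_iff.2 hpne
    rw [lt_div_iff₀ hpp]
    set N := ‖toL2 (star (flow hq (μ t) w))‖ * ‖flowL2 hq (μ t) v‖
    set p := ‖pairing (flow hq (μ t) w) (flow hq (μ t) v)‖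
    have hN : 0 < N := by
      by_contra hN0
      have h6 : K * |t - t₀| * N ≤ 0 :=
        mul_nonpos_of_nonneg_of_nonpos (by positivity) (not_lt.1 hN0)
      linarith
    calc M * p ≤ (|M| + 1) * p := by
          gcongr
          linarith [le_abs_self M]
      _ ≤ (|M| + 1) * (K * |t - t₀| * N) := by gcongr
      _ = K * |t - t₀| * (|M| + 1) * N := by ring
      _ < 1 * N := by gcongr
      _ = N := one_mul N

lemma not_isSpectralSingularity_of_scalar (hq : IntegrableOn q (Icc 0 1))
    (ht₀ : t₀ = 0 ∨ t₀ = Real.pi) (ho : algMult q t₀ lam₀ = 2)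
    (hsc : ∀ v, monodromy hq lam₀ v = Complex.exp (Complex.I * t₀) • v) :
    ¬ IsSpectralSingularity q lam₀ := by
  rintro ⟨-, H⟩
  obtain ⟨κ, hκ, hev⟩ := exists_regular_neighbourhood hq ht₀ ho hsc
  obtain ⟨ε, hε, hball⟩ := Metric.eventually_nhds_iff_ball.1 hev
  obtain ⟨t, -, μ, hμ, hsimple, P, hP, hlt⟩ := H ε hε κ⁻¹
  obtain ⟨v, w, hp, hN, hle⟩ := hball μ hμ t hsimple
  have hpos := lt_of_lt_of_le (mul_pos hκ hN) hle
  have h1 := hP.norm_le hp (norm_pos_iff.1 hpos)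
  refine absurd (hlt.trans_le h1) (not_lt.2 ?_)
  rw [div_le_iff₀ hpos, inv_mul_eq_div, le_div_iff₀ hκ, mul_comm]
  exact hle

/-- Comparison with the non-integrable `1/(t - t₀)`. The constant is enlarged to `|K| + 1` so that
it is positive. -/
lemma lintegral_inv_eq_top {f : ℝ → ENNReal} {K δ : ℝ} (hδ : 0 < δ)
    (hf : ∀ t ∈ Ioo t₀ (t₀ + δ), f t ≤ ENNReal.ofReal (K * (t - t₀))) :
    ∫⁻ t in Ioo t₀ (t₀ + δ), (f t)⁻¹ = ⊤ := by
  have hnot : ¬ IntervalIntegrable (fun t : ℝ => (t - t₀)⁻¹) volume t₀ (t₀ + δ) := by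
    rw [intervalIntegrable_sub_inv_iff]
    rintro (h | h)
    · linarith
    · exact h left_mem_uIcc
  rw [intervalIntegrable_iff_integrableOn_Ioo_of_le (by linarith)] at hnot
  have hmeas : AEStronglyMeasurable (fun t : ℝ => (t - t₀)⁻¹)
      (volume.restrict (Ioo t₀ (t₀ + δ))) := by
    have : Measurable fun t : ℝ => (t - t₀)⁻¹ := by fun_prop
    exact this.aestronglyMeasurable
  have htop : ∫⁻ t in Ioo t₀ (t₀ + δ), ‖(t - t₀)⁻¹‖ₑ = ⊤ := by
    by_contra hne
    exact hnot ⟨hmeas, lt_top_iff_ne_top.2 hne⟩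
  have hm : Measurable fun t : ℝ => ‖(t - t₀)⁻¹‖ₑ := by fun_prop
  have hconst : ∫⁻ t in Ioo t₀ (t₀ + δ), (ENNReal.ofReal (|K| + 1))⁻¹ * ‖(t - t₀)⁻¹‖ₑ = ⊤ := by
    rw [lintegral_const_mul _ hm, htop]
    exact ENNReal.mul_top (ENNReal.inv_ne_zero.2 ENNReal.ofReal_ne_top)
  rw [← top_le_iff, ← hconst]
  refine setLIntegral_mono' measurableSet_Ioo fun t ht => ?_
  have hpos : 0 < t - t₀ := sub_pos.2 ht.1
  have h1 : f t ≤ ENNReal.ofReal (|K| + 1) * ENNReal.ofReal (t - t₀) := by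
    rw [← ENNReal.ofReal_mul (by positivity)]
    refine (hf t ht).trans (ENNReal.ofReal_le_ofReal ?_)
    exact mul_le_mul_of_nonneg_right (by linarith [le_abs_self K]) hpos.le
  have h2 : ‖(t - t₀)⁻¹‖ₑ = (ENNReal.ofReal (t - t₀))⁻¹ := by
    rw [Real.enorm_eq_ofReal (inv_nonneg.2 hpos.le), ENNReal.ofReal_inv_of_pos hpos]
  rw [h2, ← ENNReal.mul_inv (Or.inr ENNReal.ofReal_ne_top) (Or.inl ENNReal.ofReal_ne_top)]
  exact ENNReal.inv_le_inv.2 h1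

lemma isESS_of_not_scalar (hq : IntegrableOn q (Icc 0 1)) (ht₀ : t₀ = 0 ∨ t₀ = Real.pi)
    (ho : algMult q t₀ lam₀ = 2)
    (hns : ¬ ∀ v, monodromy hq lam₀ v = Complex.exp (Complex.I * t₀) • v) :
    IsESS q lam₀ := by
  obtain ⟨μ, K, hK, δ, hδ, hcont, htend, H⟩ := exists_singular_branch hq ht₀ ho hns
  have ht₀' : t₀ ∈ Ioc (-Real.pi) Real.pi := by
    rcases ht₀ with rfl | rfl
    · exact ⟨by linarith [Real.pi_pos], Real.pi_pos.le⟩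
    · exact ⟨by linarith [Real.pi_pos], le_rfl⟩
  have hex : ∀ t, ∃ Ψ Ψs : L2, t ∈ puncturedInterval t₀ δ →
      Ψ ∈ eigenspace (graph q t) (μ t) ∧ ‖Ψ‖ = 1 ∧
      Ψs ∈ eigenspace (graph q t).adjoint (starRingEnd ℂ (μ t)) ∧ ‖Ψs‖ = 1 ∧
      ‖inner ℂ Ψs Ψ‖ ≤ K * |t - t₀| := by
    intro t
    by_cases ht : t ∈ puncturedInterval t₀ δ
    · obtain ⟨-, v, w, hp, hpne, hple⟩ := H t ht
      set ψ := flowL2 hq (μ t) v with hψ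
      set ψs := toL2 (star (flow hq (μ t) w)) with hψs
      have hψ0 : ‖ψ‖ ≠ 0 := norm_ne_zero_iff.2 (IsFloquetPair.flowL2_ne_zero hp.left_ne)
      have hψs0 : ‖ψs‖ ≠ 0 := by
        rw [hψs, norm_toL2_star]
        exact norm_ne_zero_iff.2 (IsFloquetPair.flowL2_ne_zero (hq := hq) (μ := μ t) hp.right_ne)
      have m1 : ((‖ψ‖⁻¹ : ℝ) : ℂ) • ψ ∈ eigenspace (graph q t) (μ t) := by
        rw [hp.eigenspace_eq]
        exact Submodule.smul_mem _ _ (Submodule.mem_span_singleton_self _)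
      have m2 : ((‖ψs‖⁻¹ : ℝ) : ℂ) • ψs ∈
          eigenspace (graph q t).adjoint (starRingEnd ℂ (μ t)) := by
        rw [hp.adjoint_eigenspace_eq]
        exact Submodule.smul_mem _ _ (Submodule.mem_span_singleton_self _)
      have n1 : ‖((‖ψ‖⁻¹ : ℝ) : ℂ) • ψ‖ = 1 := by
        rw [norm_smul, Complex.norm_real, norm_inv, norm_norm, inv_mul_cancel₀ hψ0]
      have n2 : ‖((‖ψs‖⁻¹ : ℝ) : ℂ) • ψs‖ = 1 := by
        rw [norm_smul, Complex.norm_real, norm_inv, norm_norm, inv_mul_cancel₀ hψs0]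
      refine ⟨_, _, fun _ => ⟨m1, n1, m2, n2, ?_⟩⟩
      have h1 := hp.norm_inner_eq m1 m2 n1 n2
      rw [← h1] at hple
      refine le_of_mul_le_mul_right hple ?_
      positivity
    · exact ⟨0, 0, fun h => absurd h ht⟩
  choose Ψ Ψs hΨ using hex
  refine ⟨t₀, ht₀', ?_, δ, hδ, μ, Ψ, Ψs, hcont, fun t ht => ?_, htend, fun δ' hδ' => ?_⟩
  · rw [isEigenvalue_iff hq, ← algMult_ne_zero_iff hq, ho]
    norm_num
  · obtain ⟨h1, h2, h3, h4, -⟩ := hΨ t ht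
    exact ⟨(H t ht).1, h1, h2, h3, h4⟩
  · have htop := lintegral_inv_eq_top (t₀ := t₀) (K := K) hδ'.1
      (f := fun t => ‖inner ℂ (Ψs t) (Ψ t)‖ₑ) (fun t ht => by
        have h5 := (hΨ t (puncturedInterval_mono t₀ hδ'.2 (Or.inr ht))).2.2.2.2
        rw [abs_of_pos (sub_pos.2 ht.1)] at h5
        rw [← ofReal_norm]
        exact ENNReal.ofReal_le_ofReal h5)
    -- Divergence on the right half of the punctured interval is enough.
    rw [← top_le_iff, ← htop]
    exact lintegral_mono_set subset_union_right

/-- The quasimomentum `s₀` in the definition of an ESS need not be `t₀`, but the lower bound for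
`|α|` near `lam₀` is uniform in `t`. So `1/|α|` is bounded by a constant on an interval of finite
length. -/
lemma not_isESS_of_scalar (hq : IntegrableOn q (Icc 0 1)) (ht₀ : t₀ = 0 ∨ t₀ = Real.pi)
    (ho : algMult q t₀ lam₀ = 2)
    (hsc : ∀ v, monodromy hq lam₀ v = Complex.exp (Complex.I * t₀) • v) :
    ¬ IsESS q lam₀ := by
  rintro ⟨s₀, -, -, δ, hδ, μ, Ψ, Ψs, -, H, htend, hint⟩
  obtain ⟨κ, hκ, hev⟩ := exists_regular_neighbourhood hq ht₀ ho hsc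
  obtain ⟨η, hη, hgood⟩ := exists_puncturedInterval_subset (htend.eventually hev)
  have hδ' : min η δ ∈ Ioc 0 δ := ⟨lt_min hη hδ, min_le_right _ _⟩
  have hle : ∫⁻ t in puncturedInterval s₀ (min η δ), ‖inner ℂ (Ψs t) (Ψ t)‖ₑ⁻¹ ≤
      ∫⁻ _ in puncturedInterval s₀ (min η δ), (ENNReal.ofReal κ)⁻¹ := by
    refine setLIntegral_mono' (measurableSet_Ioo.union measurableSet_Ioo) fun t ht => ?_
    obtain ⟨hsimple, h1, h2, h3, h4⟩ := H t (puncturedInterval_mono s₀ (min_le_right _ _) ht)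
    obtain ⟨v, w, hp, hN, hpair⟩ :=
      hgood t (puncturedInterval_mono s₀ (min_le_left _ _) ht) t hsimple
    rw [← hp.norm_inner_eq h1 h3 h2 h4] at hpair
    rw [ENNReal.inv_le_inv, ← ofReal_norm]
    exact ENNReal.ofReal_le_ofReal (le_of_mul_le_mul_right hpair hN)
  rw [hint _ hδ', setLIntegral_const, top_le_iff] at hle
  refine ENNReal.mul_ne_top (ENNReal.inv_ne_top.2 (by simpa using hκ)) ?_ hle
  refine ne_of_lt (lt_of_le_of_lt (measure_union_le _ _) ?_)
  simp [Real.volume_Ioo]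

end DoublePoint

end Hill

theorem theorem15 (q : ℝ → ℂ) (hper : Function.Periodic q 1)
    (hint : IntervalIntegrable q MeasureTheory.volume 0 1)
    (t₀ : ℝ) (ht₀ : t₀ = 0 ∨ t₀ = Real.pi) :
    (∃ lam : ℤ → ℂ, Hill.IsNumbering q t₀ lam) ∧
    ∀ lam : ℤ → ℂ, Hill.IsNumbering q t₀ lam →
      ∃ N : ℕ, ∀ k : ℤ, (N : ℤ) < |k| → Hill.IsMultipleEigenvalue q t₀ (lam k) →
        (Hill.IsSpectralSingularity q (lam k) ↔ Hill.geomMult q t₀ (lam k) = 1) ∧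
        (Hill.IsESS q (lam k) ↔ Hill.geomMult q t₀ (lam k) = 1) := by
  have hq : IntegrableOn q (Icc 0 1) :=
    (intervalIntegrable_iff_integrableOn_Icc_of_le zero_le_one).1 hint
  refine ⟨Hill.exists_isNumbering hq ht₀, fun lam hlam => ?_⟩
  -- `R` depends on `q` only; the numbering enters solely through the `N` beyond which `|λ_k| > R`.
  obtain ⟨R, hR⟩ := Hill.exists_algMult_eq_two hq
  obtain ⟨N, hN⟩ := hlam.exists_norm_gt hq R
  refine ⟨N, fun k hk hmult => ?_⟩
  have ho := hR t₀ (lam k) (hN k hk) hmult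
  rw [Hill.geomMult_eq_one_iff hq hmult.1]
  refine ⟨⟨fun h hsc => ?_, Hill.isSpectralSingularity_of_not_scalar hq ht₀ ho⟩,
    fun h hsc => ?_, Hill.isESS_of_not_scalar hq ht₀ ho⟩
  · exact Hill.not_isSpectralSingularity_of_scalar hq ht₀ ho hsc h
  · exact Hill.not_isESS_of_scalar hq ht₀ ho hsc h
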